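/- **Setting.** Let $\mathcal H\neq 0$ be a finite-dimensional complex Hilbert space and $\mathcal N\subset\mathcal M\subset\mathcal B(\mathcal H)$ unital $*$-subalgebras (with the unit of $\mathcal B(\mathcal H)$). Write $\mathcal A'$ for the commutant and $\mathcal Z(\mathcal A)=\mathcal A\cap\mathcal A'$ for the centre of $\mathcal A$. The inclusion is *connected*: $\mathcal Z(\mathcal M)\cap\mathcal Z(\mathcal N)=\mathbb C\mathbf 1$. *Relative entropy.* If $\mathcal A\cong\bigoplus_j M_{m_j}(\mathbb C)\otimes\mathbf 1_{m'_j}$, the canonical trace is $\mathrm{Tr}_{\mathcal A}(\bigoplus_j a_j\otimes\mathbf 1)=\sum_j\mathrm{Tr}\,a_j$; the density matrix $\rho^\phi\in\mathcal A$ of a state $\phi$ on $\mathcal A$ is given by $\mathrm{Tr}_{\mathcal A}(\rho^\phi a)=\phi(a)$ for all $a\in\mathcal A$; and $S_{\mathcal A}(\phi|\chi)=\mathrm{Tr}_{\mathcal A}\big(\rho^\phi(\log\rho^\phi-\log\rho^\chi)\big)$, which is $+\infty$ if $\ker\rho^\chi\not\subset\ker\rho^\phi$. For a state on $\mathcal B(\mathcal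 H)$, restrictions to subalgebras are understood. *Conditional expectations.* $C(\mathcal M,\mathcal N)$ is the set of positive unital linear maps $\varepsilon:\mathcal M\to\mathcal N$ with $\varepsilon(n_1mn_2)=n_1\varepsilon(m)n_2$ for $m\in\mathcal M$, $n_1,n_2\in\mathcal N$. Let $P_k$ and $Q_j$ be the minimal projections of $\mathcal Z(\mathcal N)$ and $\mathcal Z(\mathcal M)$. Then $\varepsilon(x)P_k=\varphi_k(x)P_k$ for $x\in\mathcal M\cap\mathcal N'$, with $\varphi_k$ a state on $P_k(\mathcal M\cap\mathcal N')\cong\bigoplus_{j:\,P_kQ_j\ne0}M_{\mu_{kj}}(\mathbb C)$; write its density matrix as $\bigoplus_j p_{kj}\,\rho_{kj}$ with $\mathrm{Tr}\,\rho_{kj}=1$ and $\sum_j p_{kj}=1$. *Index.* Let $t_{1,jk},\dots,t_{\mu_{kj},jk}$ be the eigenvalues of $\rho_{kj}$ in $M_{\mu_{kj}}(\mathbb C)$, and put $$\lambda_{jk}(\varepsilon)=\sum_{l=1}^{\mu_{kj}}\frac1{t_{l,jk}},\qquad \lambda_j(\varepsilon)=\sum_{k:\,P_kQ_j\neq0}\frac{\lambda_{jk}(\varepsilon)}{p_{kj}},\qquad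 \lambda(\varepsilon)=\max_j\lambda_j(\varepsilon)\in(0,\infty],$$ where $1/0=\infty$, and $\lambda_j(\varepsilon)=\infty$ if some $p_{kj}=0$ with $P_kQ_j\ne0$. Let $\hat C(\mathcal M,\mathcal N)$ be the set of $\varepsilon\in C(\mathcal M,\mathcal N)$ with $\lambda(\varepsilon)<\infty$ and $\lambda_j(\varepsilon)$ independent of $j$. The same definitions apply to the inclusion $\mathcal M'\subset\mathcal N'$. **Theorem (entropic certainty principle).** 1. For every $\varepsilon\in\hat C(\mathcal M,\mathcal N)$ there is a unique $\varepsilon'\in\hat C(\mathcal N',\mathcal M')$ such that $$S_{\mathcal M}(\omega|\omega\circ\varepsilon)+S_{\mathcal N'}(\omega|\omega\circ\varepsilon')=\log\lambda(\varepsilon)$$ for every pure state $\omega=\langle\psi,\,\cdot\,\psi\rangle$ ($\|\psi\|=1$) of $\mathcal B(\mathcal H)$. Moreover $\lambda(\varepsilon')=\lambda(\varepsilon)$. 2. There is exactly one $\varepsilon_0\in C(\mathcal M,\mathcal N)$ that minimizes $\lambda$ over $C(\mathcal M,\mathcal N)$, and $\varepsilon_0\in\hat C(\mathcal M,\mathcal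 N)$. 3. The minimal index $[\mathcal M:\mathcal N]:=\min_{\varepsilon\in C(\mathcal M,\mathcal N)}\lambda(\varepsilon)=\lambda(\varepsilon_0)$ depends only on the inclusion $\mathcal N\subset\mathcal M$: if $\mathcal N_1\subset\mathcal M_1\subset\mathcal B(\mathcal K)$ are unital $*$-subalgebras, $\mathcal K$ a finite-dimensional Hilbert space, and $\Phi:\mathcal M\to\mathcal M_1$ is a $*$-isomorphism with $\Phi(\mathcal N)=\mathcal N_1$, then $[\mathcal M_1:\mathcal N_1]=[\mathcal M:\mathcal N]$. -/

import Mathlib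

open scoped ENNReal InnerProductSpace

noncomputable section

namespace EntropicCertainty

variable {H : Type*} [NormedAddCommGroup H] [InnerProductSpace ℂ H] [CompleteSpace H]

/-! ## Finite-dimensional operator algebras and their canonical traces -/

/-- The commutant `A'` of a unital *-algebra `A ⊆ B(H)`. -/
def commutant (A : StarSubalgebra ℂ (H →L[ℂ] H)) : StarSubalgebra ℂ (H →L[ℂ] H) :=
  StarSubalgebra.centralizer ℂ (A : Set (H →L[ℂ] H))

/-- The centre `Z(A) = A ∩ A'`. -/
def centre (A : StarSubalgebra ℂ (H →L[ℂ] H)) : StarSubalgebra ℂ (H →L[ℂ] H) :=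
  A ⊓ commutant A

/-- An inclusion `N ⊆ M` is connected if `Z(M) ∩ Z(N)` consists of the scalars only. -/
def IsConnectedInclusion (M N : StarSubalgebra ℂ (H →L[ℂ] H)) : Prop :=
  centre M ⊓ centre N = ⊥

/-- The minimal (nonzero) projections of the centre of `A`. -/
def minCentralProj (A : StarSubalgebra ℂ (H →L[ℂ] H)) : Set (H →L[ℂ] H) :=
  {P | P ∈ centre A ∧ IsStarProjection P ∧ P ≠ 0 ∧
    ∀ Q ∈ centre A, IsStarProjection Q → Q * P = Q → Q = 0 ∨ Q = P}

/-- The dimension of the range of `E`. -/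
def rk (E : H →L[ℂ] H) : ℕ := Module.finrank ℂ (LinearMap.range E.toLinearMap)

/-- The operator trace on `B(H)`, for `H` finite-dimensional. -/
def opTrace : (H →L[ℂ] H) →ₗ[ℂ] ℂ where
  toFun x := LinearMap.trace ℂ H x.toLinearMap
  map_add' x y := by simp
  map_smul' c x := by simp

/-- If `E` is a minimal central projection of `A`, then `E A ≅ M_m(ℂ) ⊗ 1_{m'}`, acting on
`E H ≅ ℂ^m ⊗ ℂ^{m'}`. This is the size `m`, the square root of `dim (E A) = m ^ 2`. -/
def blockSize (A : StarSubalgebra ℂ (H →L[ℂ] H)) (E : H →L[ℂ] H) : ℕ :=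
  Nat.sqrt (Module.finrank ℂ
    (A.toSubalgebra.toSubmodule.map (LinearMap.mulLeft ℂ E)))

/-- The multiplicity `m' = dim (E H) / m` of the block `E A ≅ M_m(ℂ) ⊗ 1_{m'}`. -/
def blockMult (A : StarSubalgebra ℂ (H →L[ℂ] H)) (E : H →L[ℂ] H) : ℕ :=
  rk E / blockSize A E

/-- The canonical trace of `A ≅ ⨁ⱼ M_{mⱼ}(ℂ) ⊗ 1_{m'ⱼ}`, that is `⨁ⱼ aⱼ ⊗ 1 ↦ ∑ⱼ Tr aⱼ`. On the
`j`-th block the operator trace is `m'ⱼ` times the matrix trace. -/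
def canonicalTrace (A : StarSubalgebra ℂ (H →L[ℂ] H)) (a : H →L[ℂ] H) : ℂ :=
  ∑ᶠ P ∈ minCentralProj A, opTrace (P * a) / (blockMult A P : ℂ)

/-- The density matrix of a functional `φ` on `A`: the unique `ρ ∈ A` such that
`Tr_A (ρ a) = φ a` for all `a ∈ A`. -/
def density (A : StarSubalgebra ℂ (H →L[ℂ] H)) (φ : A →ₗ[ℂ] ℂ) : H →L[ℂ] H :=
  Classical.epsilon fun ρ => ρ ∈ A ∧ ∀ a : A, canonicalTrace A (ρ * (a : H →L[ℂ] H)) = φ a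

open Classical in
/-- The relative entropy `S_A(φ | χ) = Tr_A (ρ^φ (log ρ^φ - log ρ^χ))` of two states of `A`. As
usual it is `+∞` unless the support of `ρ^φ` is contained in that of `ρ^χ`. -/
def relEntropy (A : StarSubalgebra ℂ (H →L[ℂ] H)) (φ χ : A →ₗ[ℂ] ℂ) : EReal :=
  if LinearMap.ker (density A χ).toLinearMap ≤ LinearMap.ker (density A φ).toLinearMap then
    (((canonicalTrace A
      (density A φ * (CFC.log (density A φ) - CFC.log (density A χ)))).re : ℝ) : EReal)
  else ⊤

/-- The restriction to `A` of a functional on `B(H)`. -/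
def restrict (ω : (H →L[ℂ] H) →ₗ[ℂ] ℂ) (A : StarSubalgebra ℂ (H →L[ℂ] H)) : A →ₗ[ℂ] ℂ :=
  ω ∘ₗ A.subtype.toAlgHom.toLinearMap

/-- Pure states of `B(H)`: the states `a ↦ ⟨ψ, a ψ⟩` given by unit vectors `ψ`. -/
def IsPureState (ω : (H →L[ℂ] H) →ₗ[ℂ] ℂ) : Prop :=
  ∃ ψ : H, ‖ψ‖ = 1 ∧ ∀ a : H →L[ℂ] H, ω a = ⟪ψ, a ψ⟫_ℂ

/-! ## Conditional expectations and their index -/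

/-- A conditional expectation `M → N`: a positive unital linear map with the `N`-bimodule
property. -/
structure IsCondExp (M N : StarSubalgebra ℂ (H →L[ℂ] H)) (ε : M →ₗ[ℂ] N) : Prop where
  pos : ∀ m : M, 0 ≤ (m : H →L[ℂ] H) → 0 ≤ (ε m : H →L[ℂ] H)
  unital : ε 1 = 1
  bimodule : ∀ m n₁ n₂ : M, (n₁ : H →L[ℂ] H) ∈ N → (n₂ : H →L[ℂ] H) ∈ N →
    (ε (n₁ * m * n₂) : H →L[ℂ] H) = n₁ * (ε m : H →L[ℂ] H) * n₂

/-- The space `C(M, N)` of conditional expectations. -/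
def condExps (M N : StarSubalgebra ℂ (H →L[ℂ] H)) : Set (M →ₗ[ℂ] N) :=
  {ε | IsCondExp M N ε}

/-- The relative commutant `M ∩ N'`. -/
def relCommutant (M N : StarSubalgebra ℂ (H →L[ℂ] H)) : StarSubalgebra ℂ (H →L[ℂ] H) :=
  M ⊓ commutant N

/-- A conditional expectation `ε : M → N` maps `M ∩ N'` into `Z(N)`. For a minimal projection `P`
of `Z(N)` this is the functional `φ_P` on `M ∩ N'` with `ε(x) P = φ_P(x) P`. It vanishes on
`(1 - P) (M ∩ N')` and is a state on `P (M ∩ N') = P M P ∩ N'`. -/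
def partialState {M N : StarSubalgebra ℂ (H →L[ℂ] H)} (ε : M →ₗ[ℂ] N) (P : H →L[ℂ] H) :
    relCommutant M N →ₗ[ℂ] ℂ where
  toFun x := opTrace (P * (ε ⟨x, x.2.1⟩ : H →L[ℂ] H)) / (rk P : ℂ)
  map_add' x y := by
    have h : (⟨((x + y : relCommutant M N) : H →L[ℂ] H), (x + y).2.1⟩ : M) =
      ⟨x, x.2.1⟩ + ⟨y, y.2.1⟩ := rfl
    rw [h, map_add]
    simp [mul_add, add_div]
  map_smul' c x := by
    have h : (⟨((c • x : relCommutant M N) : H →L[ℂ] H), (c • x).2.1⟩ : M) =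
      c • ⟨x, x.2.1⟩ := rfl
    rw [h, map_smul]
    simp [mul_div_assoc]

/-- The density matrix `ρ_P = ⨁_Q p_{PQ} ρ_{PQ}` of `φ_P`, where `Q` runs over the minimal
projections of `Z(M)`. -/
def partialDensity {M N : StarSubalgebra ℂ (H →L[ℂ] H)} (ε : M →ₗ[ℂ] N) (P : H →L[ℂ] H) :
    H →L[ℂ] H :=
  density (relCommutant M N) (partialState ε P)

/-- The weight `p_{PQ} = Tr (Q ρ_P)` of the block `P Q (M ∩ N') ≅ M_μ(ℂ)`. -/
def blockWeight {M N : StarSubalgebra ℂ (H →L[ℂ] H)} (ε : M →ₗ[ℂ] N) (P Q : H →L[ℂ] H) : ℝ :=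
  (canonicalTrace (relCommutant M N) (Q * partialDensity ε P)).re

/-- The normalized density matrix `ρ_{PQ}` in the block `P Q (M ∩ N') ≅ M_μ(ℂ)`. -/
def blockDensity {M N : StarSubalgebra ℂ (H →L[ℂ] H)} (ε : M →ₗ[ℂ] N) (P Q : H →L[ℂ] H) :
    H →L[ℂ] H :=
  ((blockWeight ε P Q)⁻¹ : ℂ) • (Q * partialDensity ε P)

/-- The partial index `λ_{PQ} = ∑_l 1 / t_l`, over the eigenvalues `t_1, …, t_μ` of `ρ_{PQ}` in
`P Q (M ∩ N') ≅ M_μ(ℂ)`, with `1 / 0 = ∞`. The eigenvalue `t` of a matrix in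
`M_μ(ℂ) ≅ M_μ(ℂ) ⊗ 1_{μ'}` has in `M_μ(ℂ)` the multiplicity `1 / μ'` times the dimension of its
eigenspace in `P Q H ≅ ℂ^μ ⊗ ℂ^{μ'}`. -/
def partialIndex {M N : StarSubalgebra ℂ (H →L[ℂ] H)} (ε : M →ₗ[ℂ] N) (P Q : H →L[ℂ] H) :
    ℝ≥0∞ :=
  ∑' t : ℝ,
    ((Module.finrank ℂ
        (Module.End.eigenspace (blockDensity ε P Q).toLinearMap (t : ℂ) ⊓
          LinearMap.range (P * Q).toLinearMap : Submodule ℂ H) : ℝ≥0∞) /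
      (blockMult (relCommutant M N) (P * Q) : ℝ≥0∞)) * (ENNReal.ofReal t)⁻¹

/-- For a minimal projection `Q` of `Z(M)`, the number `λ_Q(ε) = ∑_P λ_{PQ}(ε) / p_{PQ}`, where `P`
runs over the minimal projections of `Z(N)` with `P Q ≠ 0`. -/
def centralIndex {M N : StarSubalgebra ℂ (H →L[ℂ] H)} (ε : M →ₗ[ℂ] N) (Q : H →L[ℂ] H) : ℝ≥0∞ :=
  ∑' P : {P : H →L[ℂ] H // P ∈ minCentralProj N ∧ P * Q ≠ 0},
    partialIndex ε P Q / ENNReal.ofReal (blockWeight ε P Q)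

/-- The algebraic index `λ(ε) = max_Q λ_Q(ε)`, over the minimal projections `Q` of `Z(M)`. -/
def index {M N : StarSubalgebra ℂ (H →L[ℂ] H)} (ε : M →ₗ[ℂ] N) : ℝ≥0∞ :=
  ⨆ Q ∈ minCentralProj M, centralIndex ε Q

/-- The space `Ĉ(M, N)` of conditional expectations of finite index such that `λ_Q(ε)` does not
depend on the minimal projection `Q` of `Z(M)`. -/
def scalarCondExps (M N : StarSubalgebra ℂ (H →L[ℂ] H)) : Set (M →ₗ[ℂ] N) :=
  {ε | ε ∈ condExps M N ∧ index ε < ∞ ∧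
    ∀ Q₁ ∈ minCentralProj M, ∀ Q₂ ∈ minCentralProj M, centralIndex ε Q₁ = centralIndex ε Q₂}

/-- The minimal index `[M : N]`. -/
def minimalIndex (M N : StarSubalgebra ℂ (H →L[ℂ] H)) : ℝ≥0∞ :=
  ⨅ ε ∈ condExps M N, index ε

/-- The entropic certainty relation for `ε : M → N` and `ε' : N' → M'`:
`S_M(ω | ω ∘ ε) + S_{N'}(ω | ω ∘ ε') = log λ(ε)` for all pure states `ω` of `B(H)`. -/
def CertaintyRelation {M N : StarSubalgebra ℂ (H →L[ℂ] H)} (ε : M →ₗ[ℂ] N)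
    (ε' : commutant N →ₗ[ℂ] commutant M) : Prop :=
  ∀ ω : (H →L[ℂ] H) →ₗ[ℂ] ℂ, IsPureState ω →
    relEntropy M (restrict ω M) (restrict ω N ∘ₗ ε) +
      relEntropy (commutant N) (restrict ω (commutant N)) (restrict ω (commutant M) ∘ₗ ε') =
    ENNReal.log (index ε)

end EntropicCertainty

end

open scoped ENNReal InnerProductSpace
set_option linter.unusedSectionVars false
open scoped ComplexOrder
noncomputable section
namespace EntropicCertainty
variable {H : Type*} [NormedAddCommGroup H] [InnerProductSpace ℂ H] [CompleteSpace H]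

/-! Everything is carried by one operator. Put R = M ∩ N'. A conditional expectation ε : M → N is
the adjoint, for the canonical traces, of multiplication by a positive ρ in R
(`exists_isDensityOf`); the positive ρ in R that occur are exactly those with Tr_R(Pρ) = 1 for each
minimal projection P of Z(N) (`IsDensityOf.ctr_eq_one`, `exists_condExp_of_density`). Finite index
forces ρ to be invertible, and then λ_Q(ε) = Tr_R(Q ρ⁻¹) (`IsDensityOf.centralIndex_eq`).

Certainty relation. The inclusion of M' in N' has the same relative commutant R, and Z(M') = Z(M).
If all λ_Q equal μ, then ρ⁻¹/μ has the normalization required of a density for N' → M'; it defines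
ε', whose index is Tr_R(P μρ) = μ. For a vector ψ the density of ω∘ε is the commuting product ρ_N ρ,
so S_M(ω|ω∘ε) = ⟨log ρ_M⟩ − ⟨log ρ_N⟩ − ⟨log ρ⟩. The densities of ψ in an algebra and in its
commutant agree on ψ, as in the Schmidt decomposition (`vecDensity_commutant_apply`). Hence in the
sum of the two entropies the densities of ψ cancel, leaving −⟨log ρ⟩ − ⟨log(ρ⁻¹/μ)⟩ = log μ.
Conversely the relation for all ψ fixes the quadratic form of the logarithm of the dual density,
hence ε'.

Minimal index. For the matrix m_PQ = Tr_R(PQ), connectedness provides strictly positive unit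
singular vectors u, v with singular value d (`exists_isPerronPair`). With U = d ∑ u_P P, V = ∑ v_Q Q
and X = Uρ − V, one finds 0 ≤ Tr_R(X ρ⁻¹ X) = d² − 2d² + ∑ v_Q² λ_Q ≤ λ(ε) − d², and equality forces
ρ = U⁻¹V, which does give index d². So the minimal index is d², determined by a matrix of block
sizes computed inside M.

The structure theory behind this (bicommutant theorem, sizes and multiplicities of blocks) comes
from Casimir sums ∑ f_i x f_i⋆ over Hilbert–Schmidt bases and from the tensor rearrangement
`realign`. -/

lemma clm_mul_apply (x y : H →L[ℂ] H) (v : H) : (x * y) v = x (y v) := rfl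

/-! ## The operator trace and the Hilbert–Schmidt inner product -/

lemma opTrace_mul_comm (x y : H →L[ℂ] H) : opTrace (x * y) = opTrace (y * x) :=
  LinearMap.trace_mul_comm ℂ x.toLinearMap y.toLinearMap

section FiniteDimensional

variable [FiniteDimensional ℂ H]

lemma opTrace_eq_sum {ι : Type*} [Fintype ι] (b : OrthonormalBasis ι ℂ H) (x : H →L[ℂ] H) :
    opTrace x = ∑ i, ⟪b i, x (b i)⟫_ℂ :=
  LinearMap.trace_eq_sum_inner x.toLinearMap b

lemma opTrace_star (x : H →L[ℂ] H) : opTrace (star x) = star (opTrace x) := by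
  rw [opTrace_eq_sum (stdOrthonormalBasis ℂ H), opTrace_eq_sum (stdOrthonormalBasis ℂ H), star_sum]
  refine Finset.sum_congr rfl fun i _ => ?_
  rw [ContinuousLinearMap.star_eq_adjoint, ContinuousLinearMap.adjoint_inner_right]
  exact (inner_conj_symm _ _).symm

lemma opTrace_star_mul_self {ι : Type*} [Fintype ι] (b : OrthonormalBasis ι ℂ H)
    (x : H →L[ℂ] H) : opTrace (star x * x) = ((∑ i, ‖x (b i)‖ ^ 2 : ℝ) : ℂ) := by
  rw [opTrace_eq_sum b]
  rw [Complex.ofReal_sum]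
  refine Finset.sum_congr rfl fun i _ => ?_
  rw [Complex.ofReal_pow, clm_mul_apply, ContinuousLinearMap.star_eq_adjoint,
    ContinuousLinearMap.adjoint_inner_right, inner_self_eq_norm_sq_to_K]
  rfl

lemma opTrace_star_mul_self_nonneg (x : H →L[ℂ] H) : 0 ≤ opTrace (star x * x) := by
  rw [opTrace_star_mul_self (stdOrthonormalBasis ℂ H)]
  exact_mod_cast Finset.sum_nonneg fun i _ => by positivity

lemma eq_zero_of_opTrace_star_mul_self {x : H →L[ℂ] H} (h : opTrace (star x * x) = 0) :
    x = 0 := by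
  rw [opTrace_star_mul_self (stdOrthonormalBasis ℂ H)] at h
  have h' : (∑ i, ‖x (stdOrthonormalBasis ℂ H i)‖ ^ 2 : ℝ) = 0 := by exact_mod_cast h
  rw [Finset.sum_eq_zero_iff_of_nonneg fun i _ => by positivity] at h'
  apply ContinuousLinearMap.coe_injective
  refine (stdOrthonormalBasis ℂ H).toBasis.ext fun i => ?_
  simpa using h' i (Finset.mem_univ i)

lemma opTrace_mul_rankOne (a : H →L[ℂ] H) (p q : H) :
    opTrace (a * InnerProductSpace.rankOne ℂ p q) = ⟪q, a p⟫_ℂ := by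
  have : a * InnerProductSpace.rankOne ℂ p q = InnerProductSpace.rankOne ℂ (a p) q := by
    ext z; simp
  rw [this]
  exact InnerProductSpace.trace_rankOne (𝕜 := ℂ) (a p) q

lemma opTrace_projection {E : H →L[ℂ] H} (hE : IsStarProjection E) : opTrace E = (rk E : ℂ) := by
  have h : LinearMap.IsProj (LinearMap.range E.toLinearMap) E.toLinearMap := by
    refine ⟨fun x => ⟨x, rfl⟩, ?_⟩
    rintro _ ⟨y, rfl⟩
    exact congrArg (fun T : H →L[ℂ] H => T y) hE.isIdempotentElem.eq
  exact h.trace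

lemma rk_pos {E : H →L[ℂ] H} (hE : E ≠ 0) : 0 < rk E := by
  rw [rk, Module.finrank_pos_iff]
  rw [Submodule.nontrivial_iff_ne_bot, Ne, LinearMap.range_eq_bot]
  intro h
  exact hE (ContinuousLinearMap.coe_injective h)

/-- A finite sum expression of an operator as a sum of rank one operators. -/
lemma eq_sum_rankOne (x : H →L[ℂ] H) :
    x = ∑ i, InnerProductSpace.rankOne ℂ (x (stdOrthonormalBasis ℂ H i))
      (stdOrthonormalBasis ℂ H i) := by
  ext z
  conv_lhs => rw [← (stdOrthonormalBasis ℂ H).sum_repr' z]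
  simp

lemma linearMap_ext_rankOne {V : Type*} [AddCommGroup V] [Module ℂ V]
    {F G : (H →L[ℂ] H) →ₗ[ℂ] V}
    (h : ∀ p q : H, F (InnerProductSpace.rankOne ℂ p q) = G (InnerProductSpace.rankOne ℂ p q)) :
    F = G := by
  ext x
  rw [eq_sum_rankOne x, map_sum, map_sum]
  exact Finset.sum_congr rfl fun i _ => h _ _

/-- Interchanging the middle tensor factors in an identity between maps on `B(H)`. -/
lemma realign {ι κ : Type*} [Fintype ι] [Fintype κ] {a b : ι → H →L[ℂ] H} {h k : κ → H →L[ℂ] H}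
    (H₀ : ∀ x, ∑ i, a i * x * b i = ∑ l, opTrace (k l * x) • h l) (x : H →L[ℂ] H) :
    ∑ l, h l * x * k l = ∑ i, opTrace (b i * x) • a i := by
  let F : (H →L[ℂ] H) →ₗ[ℂ] (H →L[ℂ] H) :=
    ∑ l, LinearMap.mulRight ℂ (k l) ∘ₗ LinearMap.mulLeft ℂ (h l)
  let G : (H →L[ℂ] H) →ₗ[ℂ] (H →L[ℂ] H) :=
    ∑ i, LinearMap.toSpanSingleton ℂ _ (a i) ∘ₗ opTrace ∘ₗ LinearMap.mulLeft ℂ (b i)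
  have hFG : F = G := by
    -- At |p⟩⟨q|, applied to u, the claim is the hypothesis at |u⟩⟨q|, applied to p: the
    -- rearrangement only exchanges p and u.
    refine linearMap_ext_rankOne fun p q => ?_
    ext u
    have := congrArg (fun T : H →L[ℂ] H => T p) (H₀ (InnerProductSpace.rankOne ℂ u q))
    simp only [_root_.sum_apply, clm_mul_apply,
      _root_.smul_apply, InnerProductSpace.rankOne_apply, map_smul,
      opTrace_mul_rankOne] at this
    simp only [F, G, LinearMap.sum_apply, LinearMap.comp_apply, LinearMap.mulLeft_apply,
      LinearMap.mulRight_apply, _root_.sum_apply, clm_mul_apply,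
      LinearMap.toSpanSingleton_apply,
      _root_.smul_apply, InnerProductSpace.rankOne_apply, map_smul,
      opTrace_mul_rankOne]
    exact this.symm
  simpa [F, G] using congrArg (fun T => T x) hFG

/-- Hilbert–Schmidt orthonormal bases of a space of operators. -/
structure IsHSBasis (V : Submodule ℂ (H →L[ℂ] H)) {ι : Type*} [Fintype ι] (f : ι → H →L[ℂ] H) :
    Prop where
  mem : ∀ i, f i ∈ V
  count : ∑ i, opTrace (star (f i) * f i) = (Module.finrank ℂ V : ℂ)
  expand : ∀ x ∈ V, x = ∑ i, opTrace (star (f i) * x) • f i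

/-- The embedding of `B(H)` into the Hilbert space `H ⊕ ⋯ ⊕ H` which induces the Hilbert–Schmidt
inner product. -/
def hsEmbedding : (H →L[ℂ] H) →ₗ[ℂ] PiLp 2 (fun _ : Fin (Module.finrank ℂ H) => H) where
  toFun a := WithLp.toLp 2 fun i => a (stdOrthonormalBasis ℂ H i)
  map_add' a b := by ext; simp
  map_smul' c a := by ext; simp

lemma inner_hsEmbedding (a b : H →L[ℂ] H) :
    ⟪hsEmbedding a, hsEmbedding b⟫_ℂ = opTrace (star a * b) := by
  rw [opTrace_eq_sum (stdOrthonormalBasis ℂ H), PiLp.inner_apply]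
  refine Finset.sum_congr rfl fun i _ => ?_
  rw [clm_mul_apply, ContinuousLinearMap.star_eq_adjoint,
    ContinuousLinearMap.adjoint_inner_right]
  rfl

lemma hsEmbedding_injective : Function.Injective (hsEmbedding (H := H)) := by
  rw [← LinearMap.ker_eq_bot, LinearMap.ker_eq_bot']
  intro a ha
  apply eq_zero_of_opTrace_star_mul_self
  rw [← inner_hsEmbedding, ha, inner_zero_left]

/-- Pulls an orthonormal basis back along `hsEmbedding`. Orthogonality is returned separately
because it serves only to build matrix units; the Casimir computations need just `count` and
`expand`. -/
lemma exists_isHSBasis (V : Submodule ℂ (H →L[ℂ] H)) :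
    ∃ f : Fin (Module.finrank ℂ V) → H →L[ℂ] H, IsHSBasis V f ∧
      ∀ i j, opTrace (star (f i) * f j) = if i = j then 1 else 0 := by
  have hfin : Module.finrank ℂ (V.map hsEmbedding) = Module.finrank ℂ V :=
    (Submodule.equivMapOfInjective hsEmbedding hsEmbedding_injective V).finrank_eq.symm
  let b := (stdOrthonormalBasis ℂ (V.map (hsEmbedding (H := H)))).reindex (finCongr hfin)
  have hb : ∀ i, ∃ x ∈ V, hsEmbedding x = (b i : PiLp 2 _) := fun i => (b i).2
  choose f hfV hf using hb
  have horth : ∀ i j, opTrace (star (f i) * f j) = if i = j then 1 else 0 := by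
    intro i j
    rw [← inner_hsEmbedding, hf, hf, ← Submodule.coe_inner]
    exact orthonormal_iff_ite.1 b.orthonormal i j
  refine ⟨f, ⟨hfV, by simp [horth], fun x hx => ?_⟩, horth⟩
  apply hsEmbedding_injective
  have h1 := b.sum_repr' ⟨hsEmbedding x, Submodule.mem_map_of_mem hx⟩
  have h2 := congrArg Subtype.val h1
  rw [← show _ = hsEmbedding x from h2, map_sum, Submodule.coe_sum]
  refine Finset.sum_congr rfl fun i _ => ?_
  rw [map_smul, Submodule.coe_smul, Submodule.coe_inner, hf, ← hf, inner_hsEmbedding]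

end FiniteDimensional
end EntropicCertainty
end

open scoped ENNReal InnerProductSpace
set_option linter.unusedSectionVars false
open scoped ComplexOrder
noncomputable section
namespace EntropicCertainty
variable {H : Type*} [NormedAddCommGroup H] [InnerProductSpace ℂ H] [CompleteSpace H]
section FiniteDimensional
variable [FiniteDimensional ℂ H]

/-! ## Functional calculus in finite dimension -/

lemma finite_real_spectrum (a : H →L[ℂ] H) : (spectrum ℝ a).Finite := by
  have h : (spectrum ℂ a).Finite := by
    have e := AlgEquiv.spectrum_eq (Module.End.toContinuousLinearMap (𝕜 := ℂ) H) a.toLinearMap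
    have : Module.End.toContinuousLinearMap (𝕜 := ℂ) H a.toLinearMap = a := by ext; rfl
    rw [this] at e
    rw [e]
    exact Module.End.finite_spectrum _
  rw [← spectrum.preimage_algebraMap (R := ℝ) ℂ]
  exact h.preimage (FaithfulSMul.algebraMap_injective ℝ ℂ).injOn

lemma continuousOn_spectrum (f : ℝ → ℝ) (a : H →L[ℂ] H) : ContinuousOn f (spectrum ℝ a) :=
  (finite_real_spectrum a).continuousOn f

open Polynomial in
-- Spectra are finite, so Lagrange interpolation replaces f by a polynomial. Having one polynomial
-- for a and b is what allows their functional calculi to be compared on a single vector.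
lemma exists_polynomial_cfc (f : ℝ → ℝ) {a b : H →L[ℂ] H} (ha : IsSelfAdjoint a)
    (hb : IsSelfAdjoint b) (t : ℝ) :
    ∃ p : ℝ[X], cfc f a = aeval a p ∧ cfc f b = aeval b p ∧ p.eval t = f t := by
  classical
  let s : Finset ℝ := insert t ((finite_real_spectrum a).toFinset ∪ (finite_real_spectrum b).toFinset)
  let p := Lagrange.interpolate s id f
  have hp : ∀ x ∈ s, p.eval x = f x := fun x hx =>
    Lagrange.eval_interpolate_at_node (v := id) f Function.injective_id.injOn hx
  refine ⟨p, ?_, ?_, hp t (by simp [s])⟩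
  · rw [← cfc_polynomial p a]
    exact cfc_congr fun x hx => (hp x (by simp [s, hx])).symm
  · rw [← cfc_polynomial p b]
    exact cfc_congr fun x hx => (hp x (by simp [s, hx])).symm

open Polynomial in
lemma aeval_apply_eigenvector (p : ℝ[X]) {a : H →L[ℂ] H} {t : ℝ} {v : H} (hv : a v = (t : ℂ) • v) :
    aeval a p v = ((p.eval t : ℝ) : ℂ) • v := by
  induction p using Polynomial.induction_on' with
  | add p q hp hq => simp [hp, hq, add_smul]
  | monomial n c =>
    have h : (a ^ n) v = ((t ^ n : ℝ) : ℂ) • v := by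
      induction n with
      | zero => simp
      | succ n ih =>
        rw [pow_succ, clm_mul_apply, hv, map_smul, ih, smul_smul, pow_succ]
        push_cast; ring_nf
    rw [aeval_monomial, clm_mul_apply, h, map_smul, eval_monomial, Algebra.algebraMap_eq_smul_one]
    rw [_root_.smul_apply, one_apply_eq_self, ← Complex.coe_smul, smul_smul]
    push_cast; ring_nf

lemma cfc_apply_eigenvector (f : ℝ → ℝ) {a : H →L[ℂ] H} (ha : IsSelfAdjoint a) {t : ℝ} {v : H}
    (hv : a v = (t : ℂ) • v) : cfc f a v = (f t : ℂ) • v := by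
  obtain ⟨p, hp, -, ht⟩ := exists_polynomial_cfc f ha ha t
  rw [hp, aeval_apply_eigenvector p hv, ht]

open Polynomial in
lemma aeval_mem (A : StarSubalgebra ℂ (H →L[ℂ] H)) {a : H →L[ℂ] H} (ha : a ∈ A) (p : ℝ[X]) :
    aeval a p ∈ A := by
  induction p using Polynomial.induction_on' with
  | add p q hp hq => rw [map_add]; exact add_mem hp hq
  | monomial n c =>
    rw [aeval_monomial, Algebra.algebraMap_eq_smul_one, ← Complex.coe_smul, smul_mul_assoc, one_mul]
    exact A.smul_mem (pow_mem ha n) _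

lemma cfc_mem (A : StarSubalgebra ℂ (H →L[ℂ] H)) (f : ℝ → ℝ) {a : H →L[ℂ] H} (ha : a ∈ A)
    (hsa : IsSelfAdjoint a) : cfc f a ∈ A := by
  obtain ⟨p, hp, -, -⟩ := exists_polynomial_cfc f hsa hsa 0
  rw [hp]
  exact aeval_mem A ha p

open Polynomial in
/-- Commuting self-adjoint operators which agree on a vector have the same functional calculus on
this vector. -/
lemma cfc_apply_eq_of_apply_eq (f : ℝ → ℝ) {a b : H →L[ℂ] H} (ha : IsSelfAdjoint a)
    (hb : IsSelfAdjoint b) (hab : Commute a b) {v : H} (hv : a v = b v) :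
    cfc f a v = cfc f b v := by
  obtain ⟨p, hp, hp', -⟩ := exists_polynomial_cfc f ha hb 0
  rw [hp, hp']
  clear hp hp'
  have hpow : ∀ n : ℕ, (a ^ n) v = (b ^ n) v := by
    intro n
    induction n with
    | zero => simp
    | succ n ih =>
      rw [pow_succ, clm_mul_apply, hv, ← clm_mul_apply, (hab.pow_left n).eq, clm_mul_apply, ih,
        ← clm_mul_apply, ← pow_succ']
  induction p using Polynomial.induction_on' with
  | add p q hp hq => simp [hp, hq]
  | monomial n c =>
    rw [aeval_monomial, aeval_monomial, clm_mul_apply, clm_mul_apply, hpow]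

open Classical in
/-- The spectral projection of `a` for the eigenvalue `t`. -/
def specProj (a : H →L[ℂ] H) (t : ℝ) : H →L[ℂ] H := cfc (fun x => if x = t then (1 : ℝ) else 0) a

lemma isStarProjection_specProj (a : H →L[ℂ] H) (t : ℝ) :
    IsStarProjection (specProj a t) := by
  refine ⟨?_, cfc_predicate _ _⟩
  unfold specProj
  rw [IsIdempotentElem, ← cfc_mul _ _ a (continuousOn_spectrum _ a) (continuousOn_spectrum _ a)]
  congr 1
  ext x
  split_ifs <;> simp

lemma mul_specProj {a : H →L[ℂ] H} (ha : IsSelfAdjoint a) (t : ℝ) :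
    a * specProj a t = (t : ℂ) • specProj a t := by
  unfold specProj
  conv_lhs =>
    enter [1]
    rw [← cfc_id' ℝ a]
  rw [← cfc_mul _ _ a (continuousOn_spectrum _ a) (continuousOn_spectrum _ a), Complex.coe_smul,
    ← cfc_smul t _ a (continuousOn_spectrum _ a)]
  congr 1
  ext x
  split_ifs with h <;> simp [h]

lemma specProj_apply_eigenvector {a : H →L[ℂ] H} (ha : IsSelfAdjoint a) {t : ℝ} {v : H}
    (hv : a v = (t : ℂ) • v) : specProj a t v = v := by
  unfold specProj
  rw [cfc_apply_eigenvector _ ha hv]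
  simp

lemma specProj_mem (A : StarSubalgebra ℂ (H →L[ℂ] H)) {a : H →L[ℂ] H} (ha : a ∈ A)
    (hsa : IsSelfAdjoint a) (t : ℝ) : specProj a t ∈ A :=
  cfc_mem A _ ha hsa

lemma sum_specProj {a : H →L[ℂ] H} (ha : IsSelfAdjoint a) :
    ∑ t ∈ (finite_real_spectrum a).toFinset, specProj a t = 1 := by
  unfold specProj
  rw [← cfc_sum _ _ _ fun _ _ => continuousOn_spectrum _ a, ← cfc_one ℝ a]
  refine cfc_congr fun x hx => ?_
  simp [Finset.sum_apply, hx]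

/-- A commuting pair of self-adjoint operators is jointly diagonalizable, so that an operator is
zero once it vanishes on the joint eigenvectors. -/
lemma eq_of_joint_eigenvectors {a b x y : H →L[ℂ] H} (ha : IsSelfAdjoint a) (hb : IsSelfAdjoint b)
    (hab : Commute a b)
    (h : ∀ (s t : ℝ) (v : H), a v = (s : ℂ) • v → b v = (t : ℂ) • v → x v = y v) : x = y := by
  have hpa : ∑ t ∈ (finite_real_spectrum a).toFinset, specProj a t = 1 := sum_specProj ha
  have hpb : ∑ t ∈ (finite_real_spectrum b).toFinset, specProj b t = 1 := sum_specProj hb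
  ext v
  have hv : v = ∑ t ∈ (finite_real_spectrum b).toFinset, ∑ s ∈ (finite_real_spectrum a).toFinset,
      specProj a s (specProj b t v) := by
    have := congrArg₂ (fun S T : H →L[ℂ] H => S (T v)) hpa hpb
    simpa only [_root_.sum_apply, map_sum, one_apply_eq_self] using this.symm
  rw [hv]
  simp only [map_sum]
  refine Finset.sum_congr rfl fun t _ => Finset.sum_congr rfl fun s _ => h s t _ ?_ ?_
  · rw [← clm_mul_apply, mul_specProj ha]; rfl
  · have hc : Commute b (specProj a s) := (hab.cfc_real _).symm
    rw [← clm_mul_apply, hc.eq, clm_mul_apply, ← clm_mul_apply b, mul_specProj hb]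
    simp

/-- Additivity of the logarithm on joint eigenvectors. With the convention `Real.log 0 = 0` it fails
on the kernel of a, and the factor a on the right removes just that part; so a may be singular while
b must be injective. -/
lemma log_mul_mul {a b : H →L[ℂ] H} (ha : IsSelfAdjoint a) (hb : IsSelfAdjoint b)
    (hab : Commute a b) (hunit : ∀ v, b v = 0 → v = 0) :
    CFC.log (a * b) * a = (CFC.log a + CFC.log b) * a := by
  have hsa : IsSelfAdjoint (a * b) := ha.commute_iff hb |>.1 hab
  refine eq_of_joint_eigenvectors ha hb hab fun s t v hs ht => ?_
  have hst : (a * b) v = ((s * t : ℝ) : ℂ) • v := by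
    rw [clm_mul_apply, ht, map_smul, hs, smul_smul]; push_cast; ring_nf
  unfold CFC.log
  rw [clm_mul_apply, clm_mul_apply, hs, map_smul, map_smul, cfc_apply_eigenvector _ hsa hst,
    _root_.add_apply, cfc_apply_eigenvector _ ha hs, cfc_apply_eigenvector _ hb ht, ← add_smul]
  by_cases hv : v = 0
  · simp [hv]
  by_cases hs0 : s = 0
  · simp [hs0]
  have ht0 : t ≠ 0 := by
    rintro rfl
    exact hv (hunit v (by simpa using ht))
  rw [Real.log_mul hs0 ht0]
  push_cast
  rfl

end FiniteDimensional
end EntropicCertainty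
end

open scoped ENNReal InnerProductSpace
set_option linter.unusedSectionVars false
open scoped ComplexOrder
noncomputable section
namespace EntropicCertainty
variable {H : Type*} [NormedAddCommGroup H] [InnerProductSpace ℂ H] [CompleteSpace H]

/-! ## Minimal central projections -/

lemma mem_commutant {A : StarSubalgebra ℂ (H →L[ℂ] H)} {x : H →L[ℂ] H} :
    x ∈ commutant A ↔ ∀ a ∈ A, a * x = x * a := by
  rw [commutant, StarSubalgebra.mem_centralizer_iff]
  exact ⟨fun h a ha => (h a ha).1, fun h a ha => ⟨h a ha, h _ (star_mem ha)⟩⟩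

lemma le_commutant_commutant (A : StarSubalgebra ℂ (H →L[ℂ] H)) : A ≤ commutant (commutant A) :=
  fun _ ha => mem_commutant.2 fun _ hx => (mem_commutant.1 hx _ ha).symm

lemma commutant_anti {A B : StarSubalgebra ℂ (H →L[ℂ] H)} (h : A ≤ B) :
    commutant B ≤ commutant A :=
  fun _ hx => mem_commutant.2 fun a ha => mem_commutant.1 hx a (h ha)

section MinCentralProj

variable {A : StarSubalgebra ℂ (H →L[ℂ] H)} {P Q : H →L[ℂ] H}

lemma minCentralProj_mem (hP : P ∈ minCentralProj A) : P ∈ A := hP.1.1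

lemma minCentralProj_comm (hP : P ∈ minCentralProj A) {a : H →L[ℂ] H} (ha : a ∈ A) :
    a * P = P * a := mem_commutant.1 hP.1.2 a ha

lemma minCentralProj_sq (hP : P ∈ minCentralProj A) : P * P = P := hP.2.1.isIdempotentElem.eq

lemma minCentralProj_star (hP : P ∈ minCentralProj A) : star P = P := hP.2.1.isSelfAdjoint.star_eq

lemma minCentralProj_orthogonal (hP : P ∈ minCentralProj A) (hQ : Q ∈ minCentralProj A)
    (h : P * Q ≠ 0) : P = Q := by
  have hc : P * Q = Q * P := minCentralProj_comm hQ (minCentralProj_mem hP)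
  have hproj : IsStarProjection (P * Q) := hP.2.1.mul hQ.2.1 hc
  have hmem : P * Q ∈ centre A := mul_mem hP.1 hQ.1
  have h1 := (hP.2.2.2 _ hmem hproj (by rw [hc, mul_assoc, minCentralProj_sq hP])).resolve_left h
  have h2 := (hQ.2.2.2 _ hmem hproj (by rw [mul_assoc, minCentralProj_sq hQ])).resolve_left h
  rw [← h1, h2]

lemma mem_minCentralProj_of_scalar (hP : P ∈ centre A) (hproj : IsStarProjection P) (h0 : P ≠ 0)
    (h : ∀ z ∈ centre A, ∃ c : ℂ, z * P = c • P) : P ∈ minCentralProj A := by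
  refine ⟨hP, hproj, h0, fun Q hQ hQp hQP => ?_⟩
  obtain ⟨c, hc⟩ := h Q hQ
  rw [hQP] at hc
  by_cases hc0 : c = 0
  · left; rw [hc, hc0, zero_smul]
  · right
    have h1 := hQp.isIdempotentElem.eq
    rw [hc, smul_mul_smul_comm, hproj.isIdempotentElem.eq] at h1
    have h2 : c * c = c := smul_left_injective ℂ h0 h1
    have h3 : c = 1 := mul_left_cancel₀ hc0 (by rw [h2, mul_one])
    rw [hc, h3, one_smul]

variable [FiniteDimensional ℂ H]

/-- An element commuting with a projection which is minimal in a *-algebra acts as a scalar on its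
range. -/
lemma mul_eq_smul_of_minimal {e z : H →L[ℂ] H} (he : e ∈ A) (hep : IsStarProjection e)
    (he0 : e ≠ 0) (hmin : ∀ F ∈ A, IsStarProjection F → F * e = F → F = 0 ∨ F = e)
    (hz : z ∈ A) (hze : z * e = e * z) : ∃ c : ℂ, z * e = c • e := by
  have hmaps : ∀ x ∈ LinearMap.range e.toLinearMap, z.toLinearMap x ∈ LinearMap.range e.toLinearMap := by
    rintro _ ⟨y, rfl⟩
    exact ⟨z y, (congrArg (fun T : H →L[ℂ] H => T y) hze).symm⟩
  have : Nontrivial (LinearMap.range e.toLinearMap) := Module.finrank_pos_iff.1 (rk_pos he0)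
  -- Let v be an eigenvector of z in the range of e, with eigenvalue c, and w = z − c. The kernel
  -- projection of w⋆w lies in A, commutes with e and fixes v, so by minimality its product with e
  -- is e, whence w e = 0. Passing to w⋆w avoids assuming z normal.
  obtain ⟨c, hc⟩ := Module.End.exists_eigenvalue (z.toLinearMap.restrict hmaps)
  obtain ⟨v, hv⟩ := hc.exists_hasEigenvector
  have hv0 : (v : H) ≠ 0 := fun h => hv.2 (Subtype.ext h)
  have hzv : z v = c • (v : H) := congrArg Subtype.val hv.apply_eq_smul
  have hev : e v = v := by
    obtain ⟨y, hy⟩ := v.2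
    rw [← hy]
    exact congrArg (fun T : H →L[ℂ] H => T y) hep.isIdempotentElem.eq
  have hw : z - c • 1 ∈ A := sub_mem hz (A.smul_mem (one_mem _) c)
  have hwe : Commute (z - c • 1) e := by
    rw [Commute, SemiconjBy, sub_mul, mul_sub, hze]
    simp
  set w := z - c • 1 with hw_def
  have hysa : IsSelfAdjoint (star w * w) := IsSelfAdjoint.star_mul_self w
  have hwv : w v = 0 := by simp [hw_def, hzv]
  have hE := specProj_mem A (mul_mem (star_mem hw) hw) hysa 0
  have hEv : specProj (star w * w) 0 v = v :=
    specProj_apply_eigenvector hysa (by rw [clm_mul_apply, hwv]; simp)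
  have hwe' : Commute (star w) e := by
    have := hwe.star_star
    rwa [hep.isSelfAdjoint.star_eq] at this
  have hcomm : specProj (star w * w) 0 * e = e * specProj (star w * w) 0 :=
    (hwe'.mul_left hwe).cfc_real _
  have hPE' : e * specProj (star w * w) 0 = e := by
    refine (hmin _ (mul_mem he hE) (hep.mul (isStarProjection_specProj _ _) hcomm.symm)
      (by rw [mul_assoc, hcomm, ← mul_assoc, hep.isIdempotentElem.eq])).resolve_left fun h => hv0 ?_
    have := congrArg (fun T : H →L[ℂ] H => T v) h
    simpa [clm_mul_apply, hEv, hev] using this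
  have hyP : star w * w * e = 0 := by
    rw [← hPE', ← hcomm, ← mul_assoc, mul_specProj hysa]
    simp
  have hwP : w * e = 0 := by
    rw [← CStarRing.star_mul_self_eq_zero_iff, star_mul, mul_assoc, ← mul_assoc (star w), hyP,
      mul_zero]
  refine ⟨c, ?_⟩
  rw [hw_def, sub_mul, smul_mul_assoc, one_mul, sub_eq_zero] at hwP
  exact hwP

lemma centre_mul_minCentralProj {z : H →L[ℂ] H} (hz : z ∈ centre A) (hP : P ∈ minCentralProj A) :
    ∃ c : ℂ, z * P = c • P :=
  mul_eq_smul_of_minimal hP.1 hP.2.1 hP.2.2.1 hP.2.2.2 hz (minCentralProj_comm hP hz.1)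

variable (A) in
lemma finite_minCentralProj : (minCentralProj A).Finite := by
  have hli : LinearIndependent ℂ (fun P : minCentralProj A => (P : H →L[ℂ] H)) := by
    rw [linearIndependent_iff']
    intro s g hg P hPs
    have h1 := congrArg (fun T : H →L[ℂ] H => T * (P : H →L[ℂ] H)) hg
    simp only [Finset.sum_mul, zero_mul, smul_mul_assoc] at h1
    rw [Finset.sum_eq_single P, minCentralProj_sq P.2] at h1
    · exact (smul_eq_zero.1 h1).resolve_right P.2.2.2.1
    · intro Q _ hQP
      by_contra hne
      exact hQP (Subtype.ext (minCentralProj_orthogonal Q.2 P.2 fun h => hne (by rw [h, smul_zero])))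
    · exact fun h => (h hPs).elim
  have : Finite (minCentralProj A) := hli.finite
  exact Set.toFinite _

/-- The finite set of minimal central projections. -/
def mcp (A : StarSubalgebra ℂ (H →L[ℂ] H)) : Finset (H →L[ℂ] H) := (finite_minCentralProj A).toFinset

@[simp] lemma mem_mcp : P ∈ mcp A ↔ P ∈ minCentralProj A := by simp [mcp]

lemma rk_lt_of_mul_eq {E F : H →L[ℂ] H} (hE : IsStarProjection E) (hF : IsStarProjection F)
    (h : E * F = E) (hne : E ≠ F) : rk E < rk F := by
  have hFE : IsStarProjection (F - E) := hE.sub_of_mul_eq_left hF h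
  have h1 : (rk F : ℂ) = rk E + rk (F - E) := by
    rw [← opTrace_projection hE, ← opTrace_projection hF, ← opTrace_projection hFE, map_sub]
    ring
  have h2 : rk F = rk E + rk (F - E) := by exact_mod_cast h1
  have h3 := rk_pos (sub_ne_zero.2 hne.symm)
  omega

lemma exists_minCentralProj_le {z : H →L[ℂ] H} (hz : z ∈ centre A) (hzp : IsStarProjection z)
    (h0 : z ≠ 0) : ∃ P ∈ minCentralProj A, P * z = P := by
  induction hn : rk z using Nat.strong_induction_on generalizing z with
  | _ n ih =>
    by_cases hmin : ∀ Q ∈ centre A, IsStarProjection Q → Q * z = Q → Q = 0 ∨ Q = z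
    · exact ⟨z, ⟨hz, hzp, h0, hmin⟩, hzp.isIdempotentElem.eq⟩
    · push Not at hmin
      obtain ⟨Q, hQ, hQp, hQz, hQ0, hQne⟩ := hmin
      obtain ⟨P, hP, hPQ⟩ := ih (rk Q) (hn ▸ rk_lt_of_mul_eq hQp hzp hQz hQne) hQ hQp hQ0 rfl
      exact ⟨P, hP, by rw [← hPQ, mul_assoc, hQz]⟩

variable (A) in
lemma sum_mcp : ∑ P ∈ mcp A, P = 1 := by
  by_contra hne
  set e := ∑ P ∈ mcp A, P with he
  have hPe : ∀ P ∈ minCentralProj A, P * e = P := by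
    intro P hP
    rw [he, Finset.mul_sum, Finset.sum_eq_single P, minCentralProj_sq hP]
    · intro Q hQ hQP
      by_contra h
      exact hQP (minCentralProj_orthogonal hP (mem_mcp.1 hQ) h).symm
    · exact fun h => (h (mem_mcp.2 hP)).elim
  have hec : e ∈ centre A := sum_mem fun P hP => (mem_mcp.1 hP).1
  have hep : IsStarProjection e := by
    refine ⟨?_, ?_⟩
    · rw [IsIdempotentElem]
      nth_rw 1 [he]
      rw [Finset.sum_mul]
      exact Finset.sum_congr rfl fun P hP => hPe P (mem_mcp.1 hP)
    · rw [IsSelfAdjoint, he, star_sum]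
      exact Finset.sum_congr rfl fun P hP => minCentralProj_star (mem_mcp.1 hP)
  -- A minimal central projection below 1 − e would satisfy both P e = P and P e = 0.
  obtain ⟨P, hP, hP1⟩ := exists_minCentralProj_le (sub_mem (one_mem _) hec) hep.one_sub
    (sub_ne_zero.2 (Ne.symm hne))
  rw [mul_sub, mul_one, hPe P hP, sub_self] at hP1
  exact hP.2.2.1 hP1.symm

/-- The central element which is `w P` on the block of `P`. -/
def wsum (A : StarSubalgebra ℂ (H →L[ℂ] H)) (w : (H →L[ℂ] H) → ℝ) : H →L[ℂ] H :=
  ∑ P ∈ mcp A, (w P : ℂ) • P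

lemma mul_wsum (hP : P ∈ minCentralProj A) (w : (H →L[ℂ] H) → ℝ) :
    P * wsum A w = (w P : ℂ) • P := by
  rw [wsum, Finset.mul_sum, Finset.sum_eq_single P, mul_smul_comm, minCentralProj_sq hP]
  · intro Q hQ hQP
    by_contra h
    exact hQP (minCentralProj_orthogonal hP (mem_mcp.1 hQ)
      fun h' => h (by rw [mul_smul_comm, h', smul_zero])).symm
  · exact fun h => (h (mem_mcp.2 hP)).elim

variable (A) in
lemma wsum_mem (w : (H →L[ℂ] H) → ℝ) : wsum A w ∈ centre A :=
  sum_mem fun _ hP => (centre A).smul_mem (mem_mcp.1 hP).1 _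

lemma wsum_comm (w : (H →L[ℂ] H) → ℝ) {a : H →L[ℂ] H} (ha : a ∈ A) :
    a * wsum A w = wsum A w * a := mem_commutant.1 (wsum_mem A w).2 a ha

lemma star_wsum (w : (H →L[ℂ] H) → ℝ) : star (wsum A w) = wsum A w := by
  rw [wsum, star_sum]
  refine Finset.sum_congr rfl fun P hP => ?_
  rw [star_smul, minCentralProj_star (mem_mcp.1 hP)]
  simp

lemma wsum_mul (w w' : (H →L[ℂ] H) → ℝ) : wsum A w * wsum A w' = wsum A fun P => w P * w' P := by
  conv_lhs => rw [wsum]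
  rw [Finset.sum_mul]
  refine Finset.sum_congr rfl fun P hP => ?_
  rw [smul_mul_assoc, mul_wsum (mem_mcp.1 hP), smul_smul]
  push_cast; rfl

lemma wsum_congr {w w' : (H →L[ℂ] H) → ℝ} (h : ∀ P ∈ minCentralProj A, w P = w' P) :
    wsum A w = wsum A w' :=
  Finset.sum_congr rfl fun P hP => by rw [h P (mem_mcp.1 hP)]

variable (A) in
lemma wsum_one : wsum A (fun _ => 1) = 1 := by
  simp [wsum, sum_mcp]

lemma opTrace_wsum_mul (w : (H →L[ℂ] H) → ℝ) (x : H →L[ℂ] H) :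
    opTrace (wsum A w * x) = ∑ P ∈ mcp A, (w P : ℂ) * opTrace (P * x) := by
  rw [wsum, Finset.sum_mul, map_sum]
  exact Finset.sum_congr rfl fun P _ => by rw [smul_mul_assoc, map_smul, smul_eq_mul]

end MinCentralProj

/-! ## Casimir elements -/

section Casimir

variable [FiniteDimensional ℂ H]

lemma IsHSBasis.adjoint {V : Submodule ℂ (H →L[ℂ] H)} {ι : Type*} [Fintype ι] {f : ι → H →L[ℂ] H}
    (hf : IsHSBasis V f) (hV : ∀ x ∈ V, star x ∈ V) : IsHSBasis V fun i => star (f i) where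
  mem i := hV _ (hf.mem i)
  count := by
    rw [← hf.count]
    exact Finset.sum_congr rfl fun i _ => by rw [star_star, opTrace_mul_comm]
  expand x hx := by
    have h := congrArg (Star.star : _ → H →L[ℂ] H) (hf.expand _ (hV x hx))
    rw [star_star, star_sum] at h
    nth_rw 1 [h]
    simp only [star_smul, ← opTrace_star, star_mul, star_star]
    exact Finset.sum_congr rfl fun i _ => by rw [opTrace_mul_comm]

/-- Left multiplication by a on the f_i and right multiplication by a on the f_j⋆ have the same
coefficients, so a passes from one side of the Casimir sum to the other. -/
lemma IsHSBasis.comm {V : Submodule ℂ (H →L[ℂ] H)} {ι : Type*} [Fintype ι] {f : ι → H →L[ℂ] H}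
    (hf : IsHSBasis V f) {a : H →L[ℂ] H} (ha : ∀ x ∈ V, a * x ∈ V) (ha' : ∀ x ∈ V, star a * x ∈ V)
    (x : H →L[ℂ] H) :
    a * ∑ i, f i * x * star (f i) = (∑ i, f i * x * star (f i)) * a := by
  have h1 : ∀ i, a * f i = ∑ j, opTrace (star (f j) * (a * f i)) • f j := fun i =>
    hf.expand _ (ha _ (hf.mem i))
  have h2 : ∀ j, star (f j) * a = ∑ i, opTrace (star (f j) * (a * f i)) • star (f i) := by
    intro j
    have h := congrArg (Star.star : _ → H →L[ℂ] H) (hf.expand _ (ha' _ (hf.mem j)))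
    rw [star_mul, star_star, star_sum] at h
    rw [h]
    refine Finset.sum_congr rfl fun i _ => ?_
    rw [star_smul, ← opTrace_star, star_mul, star_mul, star_star, star_star, mul_assoc]
  rw [Finset.mul_sum, Finset.sum_mul]
  calc ∑ i, a * (f i * x * star (f i))
      = ∑ i, ∑ j, opTrace (star (f j) * (a * f i)) • (f j * x * star (f i)) := by
        refine Finset.sum_congr rfl fun i _ => ?_
        rw [← mul_assoc, ← mul_assoc]
        nth_rw 1 [h1 i]
        rw [Finset.sum_mul, Finset.sum_mul]
        simp only [smul_mul_assoc]
    _ = ∑ j, ∑ i, opTrace (star (f j) * (a * f i)) • (f j * x * star (f i)) := Finset.sum_comm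
    _ = ∑ j, f j * x * star (f j) * a := by
        refine Finset.sum_congr rfl fun j _ => ?_
        rw [mul_assoc (f j * x), h2 j, Finset.mul_sum]
        simp only [mul_smul_comm]

/-- The corner `P A`. -/
def corner (A : StarSubalgebra ℂ (H →L[ℂ] H)) (P : H →L[ℂ] H) : Submodule ℂ (H →L[ℂ] H) :=
  A.toSubalgebra.toSubmodule.map (LinearMap.mulLeft ℂ P)

variable {A : StarSubalgebra ℂ (H →L[ℂ] H)} {P : H →L[ℂ] H}

lemma mem_corner (hP : P ∈ A) (hPP : P * P = P) {x : H →L[ℂ] H} :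
    x ∈ corner A P ↔ x ∈ A ∧ P * x = x := by
  constructor
  · rintro ⟨y, hy, rfl⟩
    exact ⟨mul_mem hP hy, by simp [← mul_assoc, hPP]⟩
  · rintro ⟨hx, hPx⟩
    exact ⟨x, hx, hPx⟩

lemma mem_corner' (hP : P ∈ minCentralProj A) {x : H →L[ℂ] H} :
    x ∈ corner A P ↔ x ∈ A ∧ P * x = x :=
  mem_corner (minCentralProj_mem hP) (minCentralProj_sq hP)

lemma corner_mul_left (hP : P ∈ minCentralProj A) {a x : H →L[ℂ] H} (ha : a ∈ A)
    (hx : x ∈ corner A P) : a * x ∈ corner A P := by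
  rw [mem_corner' hP] at hx ⊢
  exact ⟨mul_mem ha hx.1, by rw [← mul_assoc, ← minCentralProj_comm hP ha, mul_assoc, hx.2]⟩

lemma corner_star (hP : P ∈ minCentralProj A) {x : H →L[ℂ] H}
    (hx : x ∈ corner A P) : star x ∈ corner A P := by
  rw [mem_corner' hP] at hx ⊢
  refine ⟨star_mem hx.1, ?_⟩
  rw [← minCentralProj_comm hP (star_mem hx.1)]
  nth_rw 1 [← minCentralProj_star hP]
  rw [← star_mul, hx.2]

lemma opTrace_minCentralProj (hP : P ∈ minCentralProj A) : opTrace P = (rk P : ℂ) :=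
  opTrace_projection hP.2.1

lemma rk_ne_zero (hP : P ∈ minCentralProj A) : (rk P : ℂ) ≠ 0 := by
  exact_mod_cast (rk_pos hP.2.2.1).ne'

section

variable {ι : Type*} [Fintype ι] {f : ι → H →L[ℂ] H}

lemma casimir_mem_commutant (hP : P ∈ minCentralProj A) (hf : IsHSBasis (corner A P) f)
    (x : H →L[ℂ] H) : ∑ i, f i * x * star (f i) ∈ commutant A :=
  mem_commutant.2 fun _ ha => hf.comm (fun _ hx => corner_mul_left hP ha hx)
    (fun _ hx => corner_mul_left hP (star_mem ha) hx) x

/-- The ratio `dim (P A) / dim (P H)`. -/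
def casimirConst (A : StarSubalgebra ℂ (H →L[ℂ] H)) (P : H →L[ℂ] H) : ℂ :=
  (Module.finrank ℂ (corner A P) : ℂ) / (rk P : ℂ)

/-- For x in A the sum is central and supported on P, hence a multiple of P; the trace identifies
the factor. -/
lemma casimir_of_mem (hP : P ∈ minCentralProj A) (hf : IsHSBasis (corner A P) f)
    {x : H →L[ℂ] H} (hx : x ∈ A) :
    ∑ i, f i * x * star (f i) = (opTrace (∑ i, star (f i) * f i * x) / (rk P : ℂ)) • P := by
  have hfA := fun i => (mem_corner' hP).1 (hf.mem i)
  have hmem : ∑ i, f i * x * star (f i) ∈ centre A :=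
    ⟨sum_mem fun i _ => mul_mem (mul_mem (hfA i).1 hx) (star_mem (hfA i).1),
      casimir_mem_commutant hP hf x⟩
  obtain ⟨c, hc⟩ := centre_mul_minCentralProj hmem hP
  have hP' : (∑ i, f i * x * star (f i)) * P = ∑ i, f i * x * star (f i) := by
    rw [minCentralProj_comm hP hmem.1, Finset.mul_sum]
    refine Finset.sum_congr rfl fun i _ => ?_
    rw [← mul_assoc, ← mul_assoc, (hfA i).2]
  rw [hP'] at hc
  have ht := congrArg opTrace hc
  rw [map_smul, smul_eq_mul, opTrace_minCentralProj hP] at ht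
  rw [hc, eq_div_of_mul_eq (rk_ne_zero hP) ht.symm]
  congr 2
  rw [map_sum, map_sum]
  refine Finset.sum_congr rfl fun i _ => ?_
  rw [opTrace_mul_comm, mul_assoc]

lemma casimir_mul_star (hP : P ∈ minCentralProj A) (hf : IsHSBasis (corner A P) f) :
    ∑ i, f i * star (f i) = casimirConst A P • P := by
  have h := casimir_of_mem hP hf (one_mem A)
  simp only [mul_one] at h
  rw [h, map_sum, hf.count, casimirConst]

lemma casimir_star_mul (hP : P ∈ minCentralProj A) (hf : IsHSBasis (corner A P) f) :
    ∑ i, star (f i) * f i = casimirConst A P • P := by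
  simpa using casimir_mul_star hP (hf.adjoint fun _ => corner_star hP)

lemma casimirConst_ne_zero (hP : P ∈ minCentralProj A) : casimirConst A P ≠ 0 := by
  have : Nontrivial (corner A P) :=
    ⟨⟨P, (mem_corner' hP).2 ⟨minCentralProj_mem hP, minCentralProj_sq hP⟩⟩, 0,
      fun h => hP.2.2.1 (congrArg Subtype.val h)⟩
  have : Module.finrank ℂ (corner A P) ≠ 0 := Module.finrank_pos.ne'
  exact div_ne_zero (by exact_mod_cast this) (rk_ne_zero hP)

lemma casimir_of_mem_corner (hP : P ∈ minCentralProj A) (hf : IsHSBasis (corner A P) f)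
    {x : H →L[ℂ] H} (hx : x ∈ corner A P) :
    ∑ i, f i * x * star (f i) = (casimirConst A P * opTrace x / (rk P : ℂ)) • P := by
  rw [mem_corner' hP] at hx
  rw [casimir_of_mem hP hf hx.1, ← Finset.sum_mul, casimir_star_mul hP hf, smul_mul_assoc, hx.2,
    map_smul, smul_eq_mul]

/-- The trace is multiplicative, up to normalization, on a factor and its commutant. -/
lemma opTrace_mul_of_commutant (hP : P ∈ minCentralProj A) {x y : H →L[ℂ] H}
    (hx : x ∈ corner A P) (hy : y ∈ commutant A) :
    opTrace (x * y) = opTrace x * opTrace (P * y) / (rk P : ℂ) := by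
  obtain ⟨f, hf, -⟩ := exists_isHSBasis (corner A P)
  have hfA := fun i => (mem_corner' hP).1 (hf.mem i)
  -- Two evaluations of one trace: here y is moved past f_i⋆, producing Tr(x y); afterwards the
  -- Casimir sum is first replaced by a multiple of P, producing Tr x · Tr(P y).
  have h1 : opTrace ((∑ i, f i * x * star (f i)) * y) = casimirConst A P * opTrace (x * y) := by
    have h2 : ∀ i, opTrace (f i * x * star (f i) * y) = opTrace (star (f i) * f i * (x * y)) := by
      intro i
      rw [mul_assoc, mem_commutant.1 hy _ (star_mem (hfA i).1), ← mul_assoc, opTrace_mul_comm]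
      simp only [mul_assoc]
    rw [Finset.sum_mul, map_sum, Finset.sum_congr rfl fun i _ => h2 i, ← map_sum, ← Finset.sum_mul,
      casimir_star_mul hP hf, smul_mul_assoc, map_smul, ← mul_assoc, ((mem_corner' hP).1 hx).2,
      smul_eq_mul]
  rw [casimir_of_mem_corner hP hf hx, smul_mul_assoc, map_smul, smul_eq_mul] at h1
  refine mul_left_cancel₀ (casimirConst_ne_zero hP) ?_
  rw [← h1]
  ring

lemma sum_opTrace_star_smul (hP : P ∈ minCentralProj A) (hf : IsHSBasis (corner A P) f) :
    ∑ i, opTrace (star (f i)) • f i = P := by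
  have h := hf.expand P ((mem_corner' hP).2 ⟨minCentralProj_mem hP, minCentralProj_sq hP⟩)
  conv_rhs => rw [h]
  refine Finset.sum_congr rfl fun i _ => ?_
  have := ((mem_corner' hP).1 (hf.mem i)).2
  congr 2
  rw [← minCentralProj_star hP, ← star_mul, this]

end
end Casimir
end EntropicCertainty
end

open scoped ENNReal InnerProductSpace
set_option linter.unusedSectionVars false
open scoped ComplexOrder
noncomputable section
namespace EntropicCertainty
variable {H : Type*} [NormedAddCommGroup H] [InnerProductSpace ℂ H] [CompleteSpace H]
section PairOfAlgebras
variable [FiniteDimensional ℂ H]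

/-! ## Relative commutants and the bicommutant theorem -/

variable {A B : StarSubalgebra ℂ (H →L[ℂ] H)} {P Q : H →L[ℂ] H}

lemma le_commutant_symm (hAB : B ≤ commutant A) : A ≤ commutant B :=
  (le_commutant_commutant A).trans (commutant_anti hAB)

lemma pair_comm (hAB : B ≤ commutant A) {a b : H →L[ℂ] H} (ha : a ∈ A) (hb : b ∈ B) :
    a * b = b * a := mem_commutant.1 (hAB hb) a ha

lemma pair_mem (hAB : B ≤ commutant A) (hP : P ∈ minCentralProj A) (hQ : Q ∈ minCentralProj B) :
    P * Q ∈ commutant A ⊓ commutant B :=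
  ⟨mul_mem hP.1.2 (hAB hQ.1.1), mul_mem (le_commutant_symm hAB hP.1.1) hQ.1.2⟩

lemma isStarProjection_pair (hAB : B ≤ commutant A) (hP : P ∈ minCentralProj A)
    (hQ : Q ∈ minCentralProj B) : IsStarProjection (P * Q) :=
  hP.2.1.mul hQ.2.1 (pair_comm hAB hP.1.1 hQ.1.1)

lemma mem_corner_pair (hAB : B ≤ commutant A) (hP : P ∈ minCentralProj A)
    (hQ : Q ∈ minCentralProj B) {x : H →L[ℂ] H} :
    x ∈ corner (commutant A ⊓ commutant B) (P * Q) ↔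
      x ∈ commutant A ⊓ commutant B ∧ P * Q * x = x :=
  mem_corner (pair_mem hAB hP hQ) (isStarProjection_pair hAB hP hQ).isIdempotentElem.eq

section

variable {ι κ ν : Type*} [Fintype ι] [Fintype κ] [Fintype ν]
  {f : ι → H →L[ℂ] H} {g : κ → H →L[ℂ] H} {h : ν → H →L[ℂ] H}

lemma sum_pair_eq (f : ι → H →L[ℂ] H) (g : κ → H →L[ℂ] H) (x : H →L[ℂ] H) :
    ∑ i : ι × κ, f i.1 * g i.2 * x * star (f i.1 * g i.2) =
      ∑ i, f i * (∑ j, g j * x * star (g j)) * star (f i) := by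
  rw [Fintype.sum_prod_type]
  refine Finset.sum_congr rfl fun i _ => ?_
  rw [Finset.mul_sum, Finset.sum_mul]
  refine Finset.sum_congr rfl fun j _ => ?_
  simp only [star_mul, mul_assoc]

/-- Since A and B commute, the double sum can be read with either algebra outermost, which places it
in both commutants. -/
lemma pair_casimir_mem (hAB : B ≤ commutant A) (hP : P ∈ minCentralProj A)
    (hQ : Q ∈ minCentralProj B) (hf : IsHSBasis (corner A P) f) (hg : IsHSBasis (corner B Q) g)
    (x : H →L[ℂ] H) :
    ∑ i : ι × κ, f i.1 * g i.2 * x * star (f i.1 * g i.2) ∈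
      corner (commutant A ⊓ commutant B) (P * Q) := by
  have hfA := fun i => (mem_corner' hP).1 (hf.mem i)
  have hgB := fun i => (mem_corner' hQ).1 (hg.mem i)
  rw [mem_corner_pair hAB hP hQ]
  refine ⟨⟨?_, ?_⟩, ?_⟩
  · rw [sum_pair_eq]
    exact casimir_mem_commutant hP hf _
  · have : ∑ i : ι × κ, f i.1 * g i.2 * x * star (f i.1 * g i.2) =
        ∑ i : κ × ι, g i.1 * f i.2 * x * star (g i.1 * f i.2) := by
      rw [← (Equiv.prodComm ι κ).sum_comp]
      refine Finset.sum_congr rfl fun i _ => ?_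
      simp only [Equiv.prodComm_apply, Prod.fst_swap, Prod.snd_swap]
      rw [pair_comm hAB (hfA _).1 (hgB _).1]
    rw [this, sum_pair_eq]
    exact casimir_mem_commutant hQ hg _
  · rw [Finset.mul_sum]
    refine Finset.sum_congr rfl fun i _ => ?_
    have : P * Q * (f i.1 * g i.2) = f i.1 * g i.2 := by
      rw [mul_assoc, ← mul_assoc Q, ← pair_comm hAB (hfA _).1 hQ.1.1, mul_assoc, (hgB _).2,
        ← mul_assoc, (hfA _).2]
    rw [← mul_assoc, ← mul_assoc, this]

/-- Up to a constant, the double Casimir sum is the Hilbert–Schmidt projection onto the block of the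
common commutant. Each h_l commutes with every f and g, so pairing with it leaves only the scalar
Casimir sums of the two algebras. -/
lemma pair_casimir (hAB : B ≤ commutant A) (hP : P ∈ minCentralProj A)
    (hQ : Q ∈ minCentralProj B) (hf : IsHSBasis (corner A P) f) (hg : IsHSBasis (corner B Q) g)
    (hh : IsHSBasis (corner (commutant A ⊓ commutant B) (P * Q)) h) (x : H →L[ℂ] H) :
    ∑ i : ι × κ, f i.1 * g i.2 * x * star (f i.1 * g i.2) =
      ∑ l, opTrace (star (h l) * x) • ((casimirConst A P * casimirConst B Q) • h l) := by
  have hfA := fun i => (mem_corner' hP).1 (hf.mem i)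
  have hgB := fun i => (mem_corner' hQ).1 (hg.mem i)
  have hhR := fun i => (mem_corner_pair hAB hP hQ).1 (hh.mem i)
  rw [hh.expand _ (pair_casimir_mem hAB hP hQ hf hg x)]
  refine Finset.sum_congr rfl fun l _ => ?_
  rw [smul_smul]
  congr 1
  have hl := star_mem (hhR l).1
  have h1 : ∀ i : ι × κ, opTrace (star (h l) * (f i.1 * g i.2 * x * star (f i.1 * g i.2))) =
      opTrace (star (g i.2) * (star (f i.1) * f i.1) * g i.2 * (star (h l) * x)) := by
    intro i
    have h2 : star (h l) * (f i.1 * g i.2 * x * star (f i.1 * g i.2)) =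
        f i.1 * g i.2 * (star (h l) * x) * star (f i.1 * g i.2) := by
      rw [← mul_assoc, ← mul_assoc, ← mul_assoc, ← mem_commutant.1 hl.1 _ (hfA i.1).1,
        mul_assoc (f i.1), ← mem_commutant.1 hl.2 _ (hgB i.2).1]
      simp only [mul_assoc]
    rw [h2, opTrace_mul_comm, star_mul]
    simp only [mul_assoc]
  rw [Finset.mul_sum, map_sum, Finset.sum_congr rfl fun i _ => h1 i, Fintype.sum_prod_type_right]
  have h3 : ∀ j, ∑ i, opTrace (star (g j) * (star (f i) * f i) * g j * (star (h l) * x)) =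
      casimirConst A P * opTrace (star (g j) * g j * (P * (star (h l) * x))) := by
    intro j
    rw [← map_sum, ← Finset.sum_mul, ← Finset.sum_mul, ← Finset.mul_sum, casimir_star_mul hP hf,
      mul_smul_comm, smul_mul_assoc, smul_mul_assoc, map_smul, smul_eq_mul, mul_assoc (star (g j)) P,
      pair_comm hAB hP.1.1 (hgB j).1]
    simp only [mul_assoc]
  rw [Finset.sum_congr rfl fun j _ => h3 j, ← Finset.mul_sum, ← map_sum, ← Finset.sum_mul,
    casimir_star_mul hQ hg, smul_mul_assoc, map_smul, smul_eq_mul, ← mul_assoc, mul_comm]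
  congr 2
  have h4 : star (h l) * (P * Q) = star (h l) := by
    have := congrArg star (hhR l).2
    rwa [star_mul, (isStarProjection_pair hAB hP hQ).isSelfAdjoint.star_eq] at this
  have h5 : P * Q * star (h l) = star (h l) * (P * Q) := by
    rw [mul_assoc, mem_commutant.1 hl.2 _ hQ.1.1, ← mul_assoc, mem_commutant.1 hl.1 _ hP.1.1,
      mul_assoc]
  rw [← mul_assoc, ← mul_assoc, ← pair_comm hAB hP.1.1 hQ.1.1, h5, h4]

/-- `realign` applied to `pair_casimir`: the products f g and the basis h of the common commutant
exchange their roles. -/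
lemma pair_casimir_dual (hAB : B ≤ commutant A) (hP : P ∈ minCentralProj A)
    (hQ : Q ∈ minCentralProj B) (hf : IsHSBasis (corner A P) f) (hg : IsHSBasis (corner B Q) g)
    (hh : IsHSBasis (corner (commutant A ⊓ commutant B) (P * Q)) h) (x : H →L[ℂ] H) :
    (casimirConst A P * casimirConst B Q) • ∑ l, h l * x * star (h l) =
      ∑ i : ι × κ, opTrace (star (f i.1 * g i.2) * x) • (f i.1 * g i.2) := by
  rw [← realign (pair_casimir hAB hP hQ hf hg hh) x, Finset.smul_sum]
  simp only [smul_mul_assoc]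

lemma opTrace_pair (hAB : B ≤ commutant A) (hP : P ∈ minCentralProj A)
    (hQ : Q ∈ minCentralProj B) {x y : H →L[ℂ] H} (hx : x ∈ corner A P) (hy : y ∈ corner B Q) :
    opTrace (x * y) = opTrace x * opTrace y * ((rk (P * Q) : ℂ) / (rk P * rk Q)) := by
  have hyB := ((mem_corner' hQ).1 hy).1
  rw [opTrace_mul_of_commutant hP hx (hAB hyB), pair_comm hAB hP.1.1 hyB,
    opTrace_mul_of_commutant hQ hy (le_commutant_symm hAB hP.1.1),
    ← pair_comm hAB hP.1.1 hQ.1.1, opTrace_projection (isStarProjection_pair hAB hP hQ)]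
  have h1 := rk_ne_zero hP
  have h2 := rk_ne_zero hQ
  field_simp

/-- At x = 1 the traces factor by `opTrace_pair`, so the double sum splits into the expansions of P
and of Q. Taking the trace of this identity yields the dimension of the block. -/
lemma pair_casimir_dual_one (hAB : B ≤ commutant A) (hP : P ∈ minCentralProj A)
    (hQ : Q ∈ minCentralProj B)
    (hh : IsHSBasis (corner (commutant A ⊓ commutant B) (P * Q)) h) :
    (casimirConst A P * casimirConst B Q) • ∑ l, h l * star (h l) =
      ((rk (P * Q) : ℂ) / (rk P * rk Q)) • (P * Q) := by
  obtain ⟨f, hf, -⟩ := exists_isHSBasis (corner A P)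
  obtain ⟨g, hg, -⟩ := exists_isHSBasis (corner B Q)
  have h0 := pair_casimir_dual hAB hP hQ hf hg hh 1
  simp only [mul_one] at h0
  have h1 : P * Q = ∑ i : _ × _, (opTrace (star (f i.1)) • f i.1) * (opTrace (star (g i.2)) • g i.2) := by
    conv_lhs => rw [← sum_opTrace_star_smul hP hf, ← sum_opTrace_star_smul hQ hg]
    rw [Finset.sum_mul_sum, Fintype.sum_prod_type]
  rw [h0]
  conv_rhs => enter [2]; rw [h1]
  rw [Finset.smul_sum]
  refine Finset.sum_congr rfl fun i _ => ?_
  rw [smul_mul_smul_comm, smul_smul]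
  congr 1
  rw [opTrace_star, opTrace_pair hAB hP hQ (hf.mem _) (hg.mem _), opTrace_star, opTrace_star]
  simp
  ring

/-- The dimension of a block of the relative commutant. -/
lemma finrank_corner_pair (hAB : B ≤ commutant A) (hP : P ∈ minCentralProj A)
    (hQ : Q ∈ minCentralProj B) :
    Module.finrank ℂ (corner (commutant A ⊓ commutant B) (P * Q)) *
      (Module.finrank ℂ (corner A P) * Module.finrank ℂ (corner B Q)) = rk (P * Q) ^ 2 := by
  obtain ⟨h, hh, -⟩ := exists_isHSBasis (corner (commutant A ⊓ commutant B) (P * Q))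
  have h1 := congrArg opTrace (pair_casimir_dual_one hAB hP hQ hh)
  rw [map_smul, map_smul, opTrace_projection (isStarProjection_pair hAB hP hQ), map_sum,
    Finset.sum_congr rfl fun i _ => opTrace_mul_comm (h i) (star (h i)), hh.count] at h1
  have h2 := rk_ne_zero hP
  have h3 := rk_ne_zero hQ
  simp only [casimirConst, smul_eq_mul] at h1
  field_simp at h1
  have h4 : (Module.finrank ℂ (corner (commutant A ⊓ commutant B) (P * Q)) : ℂ) *
      (Module.finrank ℂ (corner A P) * Module.finrank ℂ (corner B Q)) = rk (P * Q) ^ 2 := by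
    rw [← h1]; ring
  exact_mod_cast h4

/-- As z commutes with every h_l, the sum ∑ h z h⋆ is a nonzero multiple of z P Q, while
`pair_casimir_dual` writes it in terms of the products f g. This is the bicommutant theorem on one
block. -/
lemma commutant_pair_mul_proj (hAB : B ≤ commutant A) (hP : P ∈ minCentralProj A)
    (hQ : Q ∈ minCentralProj B) (hPQ : P * Q ≠ 0) (hf : IsHSBasis (corner A P) f)
    (hg : IsHSBasis (corner B Q) g) {z : H →L[ℂ] H}
    (hz : z ∈ commutant (commutant A ⊓ commutant B)) :
    ∃ c : ι × κ → ℂ, z * (P * Q) = ∑ i, c i • (f i.1 * g i.2) := by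
  obtain ⟨h, hh, -⟩ := exists_isHSBasis (corner (commutant A ⊓ commutant B) (P * Q))
  have hhR := fun i => (mem_corner_pair hAB hP hQ).1 (hh.mem i)
  have h1 := pair_casimir_dual hAB hP hQ hf hg hh z
  have h2 : ∑ l, h l * z * star (h l) = z * ∑ l, h l * star (h l) := by
    rw [Finset.mul_sum]
    exact Finset.sum_congr rfl fun l _ => by
      rw [mem_commutant.1 hz _ (hhR l).1, mul_assoc]
  rw [h2, ← mul_smul_comm, pair_casimir_dual_one hAB hP hQ hh, mul_smul_comm] at h1
  have h3 : (rk (P * Q) : ℂ) / (rk P * rk Q) ≠ 0 :=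
    div_ne_zero (by exact_mod_cast (rk_pos hPQ).ne') (mul_ne_zero (rk_ne_zero hP) (rk_ne_zero hQ))
  refine ⟨fun i => ((rk (P * Q) : ℂ) / (rk P * rk Q))⁻¹ * opTrace (star (f i.1 * g i.2) * z), ?_⟩
  simp only [← smul_smul]
  rw [← Finset.smul_sum, ← h1, smul_smul, inv_mul_cancel₀ h3, one_smul]

lemma pair_casimir_self (hAB : B ≤ commutant A) (hP : P ∈ minCentralProj A)
    (hQ : Q ∈ minCentralProj B) (hf : IsHSBasis (corner A P) f)
    (hg : IsHSBasis (corner B Q) g) {x y : H →L[ℂ] H} (hx : x ∈ corner A P) (hy : y ∈ corner B Q) :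
    ∃ c : ℂ, ∑ i : ι × κ, f i.1 * g i.2 * (x * y) * star (f i.1 * g i.2) = c • (P * Q) := by
  have hfA := fun i => (mem_corner' hP).1 (hf.mem i)
  have hgB := fun i => (mem_corner' hQ).1 (hg.mem i)
  have hxA := ((mem_corner' hP).1 hx).1
  have h1 : ∑ j, g j * (x * y) * star (g j) = x * ∑ j, g j * y * star (g j) := by
    rw [Finset.mul_sum]
    refine Finset.sum_congr rfl fun j _ => ?_
    rw [← mul_assoc, ← pair_comm hAB hxA (hgB j).1]
    simp only [mul_assoc]
  have h2 : ∑ i, f i * (x * Q) * star (f i) = (∑ i, f i * x * star (f i)) * Q := by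
    rw [Finset.sum_mul]
    refine Finset.sum_congr rfl fun j _ => ?_
    simp only [mul_assoc]
    rw [pair_comm hAB (star_mem (hfA j).1) hQ.1.1]
  rw [sum_pair_eq, h1, casimir_of_mem_corner hQ hg hy]
  simp only [mul_smul_comm, smul_mul_assoc]
  rw [← Finset.smul_sum, h2, casimir_of_mem_corner hP hf hx, smul_mul_assoc, smul_smul]
  exact ⟨_, rfl⟩

/-- Two evaluations of the double Casimir sum of z P Q. Since z commutes with all f and g, it
factors out with a nonzero constant; since z P Q is a combination of products f g,
`pair_casimir_self` makes the sum a multiple of P Q. -/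
lemma centre_pair_mul (hAB : B ≤ commutant A) (hP : P ∈ minCentralProj A)
    (hQ : Q ∈ minCentralProj B) (hPQ : P * Q ≠ 0) {z : H →L[ℂ] H}
    (hz : z ∈ centre (commutant A ⊓ commutant B)) : ∃ c : ℂ, z * (P * Q) = c • (P * Q) := by
  obtain ⟨f, hf, -⟩ := exists_isHSBasis (corner A P)
  obtain ⟨g, hg, -⟩ := exists_isHSBasis (corner B Q)
  have hfA := fun i => (mem_corner' hP).1 (hf.mem i)
  have hgB := fun i => (mem_corner' hQ).1 (hg.mem i)
  obtain ⟨c, hc⟩ := commutant_pair_mul_proj hAB hP hQ hPQ hf hg hz.2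
  choose e he using fun k : _ × _ => pair_casimir_self hAB hP hQ hf hg (hf.mem k.1) (hg.mem k.2)
  have hc0 : casimirConst A P * casimirConst B Q ≠ 0 :=
    mul_ne_zero (casimirConst_ne_zero hP) (casimirConst_ne_zero hQ)
  have h1 : ∑ i : _ × _, f i.1 * g i.2 * (z * (P * Q)) * star (f i.1 * g i.2) =
      (∑ k, c k * e k) • (P * Q) := by
    rw [hc, Finset.sum_smul]
    simp only [← smul_smul, ← he, Finset.mul_sum, Finset.sum_mul, Finset.smul_sum]
    rw [Finset.sum_comm]
    simp only [mul_smul_comm, smul_mul_assoc]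
  have h2 : ∑ i : _ × _, f i.1 * g i.2 * (z * (P * Q)) * star (f i.1 * g i.2) =
      (casimirConst A P * casimirConst B Q) • (z * (P * Q)) := by
    have h3 : ∀ i : _ × _, f i.1 * g i.2 * (z * (P * Q)) * star (f i.1 * g i.2) =
        z * (f i.1 * (g i.2 * star (g i.2)) * star (f i.1)) := by
      intro i
      have h4 : P * Q * star (f i.1 * g i.2) = star (f i.1 * g i.2) := by
        rw [star_mul, ← mul_assoc, mul_assoc P, ((mem_corner' hQ).1 (corner_star hQ (hg.mem i.2))).2,
          pair_comm hAB hP.1.1 (star_mem (hgB _).1), mul_assoc,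
          ((mem_corner' hP).1 (corner_star hP (hf.mem i.1))).2]
      rw [← mul_assoc, mul_assoc _ (P * Q), h4, mul_assoc (f i.1), mem_commutant.1 hz.1.2 _ (hgB _).1,
        ← mul_assoc, mem_commutant.1 hz.1.1 _ (hfA _).1, star_mul]
      simp only [mul_assoc]
    rw [Finset.sum_congr rfl fun i _ => h3 i, ← Finset.mul_sum, Fintype.sum_prod_type]
    have h5 : ∀ i, ∑ j, f i * (g j * star (g j)) * star (f i) =
        casimirConst B Q • (f i * star (f i) * Q) := by
      intro i
      rw [← Finset.sum_mul, ← Finset.mul_sum, casimir_mul_star hQ hg, mul_smul_comm, smul_mul_assoc,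
        mul_assoc, ← pair_comm hAB (star_mem (hfA _).1) hQ.1.1, mul_assoc]
    rw [Finset.sum_congr rfl fun i _ => h5 i, ← Finset.smul_sum, ← Finset.sum_mul,
      casimir_mul_star hP hf, smul_mul_assoc, smul_smul, mul_smul_comm, mul_comm (casimirConst B Q)]
  rw [h2] at h1
  refine ⟨(casimirConst A P * casimirConst B Q)⁻¹ * ∑ k, c k * e k, ?_⟩
  rw [← smul_smul, ← h1, smul_smul, inv_mul_cancel₀ hc0, one_smul]

end

lemma pair_mem_minCentralProj (hAB : B ≤ commutant A) (hP : P ∈ minCentralProj A)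
    (hQ : Q ∈ minCentralProj B) (hPQ : P * Q ≠ 0) :
    P * Q ∈ minCentralProj (commutant A ⊓ commutant B) := by
  refine mem_minCentralProj_of_scalar ⟨pair_mem hAB hP hQ, ?_⟩ (isStarProjection_pair hAB hP hQ) hPQ
    fun z hz => centre_pair_mul hAB hP hQ hPQ hz
  refine mul_mem ?_ ?_
  · exact commutant_anti inf_le_left (le_commutant_commutant _ hP.1.1)
  · exact commutant_anti inf_le_right (le_commutant_commutant _ hQ.1.1)

/-! ### The trivial algebra -/

lemma commutant_bot : commutant (⊥ : StarSubalgebra ℂ (H →L[ℂ] H)) = ⊤ := by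
  refine eq_top_iff.2 fun x _ => mem_commutant.2 fun a ha => ?_
  obtain ⟨c, rfl⟩ := StarSubalgebra.mem_bot.1 ha
  exact Algebra.commutes c x

lemma bot_le_commutant : (⊥ : StarSubalgebra ℂ (H →L[ℂ] H)) ≤ commutant A := bot_le

lemma one_mem_minCentralProj_bot [Nontrivial H] :
    (1 : H →L[ℂ] H) ∈ minCentralProj (⊥ : StarSubalgebra ℂ (H →L[ℂ] H)) := by
  refine mem_minCentralProj_of_scalar (one_mem _) (.one _) one_ne_zero fun z hz => ?_
  obtain ⟨c, rfl⟩ := StarSubalgebra.mem_bot.1 hz.1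
  exact ⟨c, by rw [Algebra.algebraMap_eq_smul_one, mul_one]⟩

lemma finrank_corner_bot [Nontrivial H] :
    Module.finrank ℂ (corner (⊥ : StarSubalgebra ℂ (H →L[ℂ] H)) 1) = 1 := by
  rw [finrank_eq_one_iff']
  have h1 : (1 : H →L[ℂ] H) ∈ corner (⊥ : StarSubalgebra ℂ (H →L[ℂ] H)) 1 :=
    (mem_corner' one_mem_minCentralProj_bot).2 ⟨one_mem _, one_mul _⟩
  refine ⟨⟨1, h1⟩, fun h => one_ne_zero (congrArg Subtype.val h), fun w => ?_⟩
  obtain ⟨c, hc⟩ := StarSubalgebra.mem_bot.1 ((mem_corner' one_mem_minCentralProj_bot).1 w.2).1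
  exact ⟨c, Subtype.ext (by rw [← hc, Algebra.algebraMap_eq_smul_one]; rfl)⟩

/-- Taking the scalars as second algebra turns a statement on common commutants into one on the
commutant of A. -/
lemma finrank_corner_commutant [Nontrivial H] (hP : P ∈ minCentralProj A) :
    Module.finrank ℂ (corner (commutant A) P) * Module.finrank ℂ (corner A P) = rk P ^ 2 := by
  have h := finrank_corner_pair bot_le_commutant hP one_mem_minCentralProj_bot
  rwa [commutant_bot, inf_top_eq, mul_one, finrank_corner_bot, mul_one] at h

/-- The basic duality between bases of a factor and its commutant. -/
lemma casimir_dual [Nontrivial H] (hP : P ∈ minCentralProj A) {ι ν : Type*} [Fintype ι] [Fintype ν]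
    {f : ι → H →L[ℂ] H} {h : ν → H →L[ℂ] H} (hf : IsHSBasis (corner A P) f)
    (hh : IsHSBasis (corner (commutant A) P) h) (x : H →L[ℂ] H) :
    casimirConst A P • ∑ l, h l * x * star (h l) = ∑ i, opTrace (star (f i) * x) • f i := by
  obtain ⟨g, hg, -⟩ := exists_isHSBasis (corner (⊥ : StarSubalgebra ℂ (H →L[ℂ] H)) 1)
  have hg1 : ∀ j, ∃ c : ℂ, g j = c • 1 := fun j => by
    obtain ⟨c, hc⟩ := StarSubalgebra.mem_bot.1
      ((mem_corner' one_mem_minCentralProj_bot).1 (hg.mem j)).1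
    exact ⟨c, by rw [← hc, Algebra.algebraMap_eq_smul_one]⟩
  choose c hc using hg1
  set s' := casimirConst (⊥ : StarSubalgebra ℂ (H →L[ℂ] H)) 1 with hs'
  have hsum : ∑ j, c j * star (c j) = s' := by
    have h1 := casimir_mul_star one_mem_minCentralProj_bot hg
    simp only [hc, star_smul, star_one, smul_mul_smul_comm, mul_one, ← Finset.sum_smul] at h1
    exact smul_left_injective ℂ one_ne_zero h1
  have hh' : IsHSBasis (corner (commutant A ⊓ commutant ⊥) (P * 1)) h := by
    rwa [commutant_bot, inf_top_eq, mul_one]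
  have h2 := pair_casimir_dual bot_le_commutant hP one_mem_minCentralProj_bot hf hg hh' x
  have h3 : ∀ i, ∑ j, opTrace (star (f i * g j) * x) • (f i * g j) =
      s' • (opTrace (star (f i) * x) • f i) := by
    intro i
    rw [← hsum, Finset.sum_smul]
    refine Finset.sum_congr rfl fun j _ => ?_
    rw [hc, mul_smul_comm, mul_one, star_smul, smul_mul_assoc, map_smul, smul_smul, smul_smul,
      smul_eq_mul]
    congr 1
    ring
  rw [Fintype.sum_prod_type, Finset.sum_congr rfl fun i _ => h3 i, ← Finset.smul_sum, mul_comm,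
    ← smul_smul] at h2
  exact smul_right_injective _ (casimirConst_ne_zero one_mem_minCentralProj_bot) h2

/-- By `commutant_pair_mul_proj`, with the scalars as second algebra, each piece z P is a
combination of elements of A. -/
theorem commutant_commutant [Nontrivial H] (A : StarSubalgebra ℂ (H →L[ℂ] H)) :
    commutant (commutant A) = A := by
  refine le_antisymm (fun z hz => ?_) (le_commutant_commutant A)
  have : z = ∑ P ∈ mcp A, z * P := by rw [← Finset.mul_sum, sum_mcp, mul_one]
  rw [this]
  refine sum_mem fun P hP => ?_
  rw [mem_mcp] at hP
  obtain ⟨f, hf, -⟩ := exists_isHSBasis (corner A P)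
  obtain ⟨g, hg, -⟩ := exists_isHSBasis (corner (⊥ : StarSubalgebra ℂ (H →L[ℂ] H)) 1)
  obtain ⟨c, hc⟩ := commutant_pair_mul_proj bot_le_commutant hP one_mem_minCentralProj_bot
    (by rw [mul_one]; exact hP.2.2.1) hf hg (z := z) (by rwa [commutant_bot, inf_top_eq])
  rw [mul_one] at hc
  rw [hc]
  refine sum_mem fun i _ => A.smul_mem (mul_mem ((mem_corner' hP).1 (hf.mem _)).1 ?_) _
  exact (bot_le : _ ≤ A) ((mem_corner' one_mem_minCentralProj_bot).1 (hg.mem _)).1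

lemma centre_commutant [Nontrivial H] (A : StarSubalgebra ℂ (H →L[ℂ] H)) :
    centre (commutant A) = centre A := by
  rw [centre, commutant_commutant, inf_comm, centre]

lemma minCentralProj_commutant [Nontrivial H] (A : StarSubalgebra ℂ (H →L[ℂ] H)) :
    minCentralProj (commutant A) = minCentralProj A := by
  rw [minCentralProj, minCentralProj, centre_commutant]

end PairOfAlgebras
end EntropicCertainty
end

open scoped ENNReal InnerProductSpace
set_option linter.unusedSectionVars false
open scoped ComplexOrder
noncomputable section
namespace EntropicCertainty
variable {H : Type*} [NormedAddCommGroup H] [InnerProductSpace ℂ H] [CompleteSpace H]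
section BlockSize
variable [FiniteDimensional ℂ H] {A : StarSubalgebra ℂ (H →L[ℂ] H)} {P : H →L[ℂ] H}

/-! ## Sizes and multiplicities of blocks -/

lemma exists_minimal_projection (hP : P ∈ minCentralProj A) :
    ∃ e ∈ corner A P, IsStarProjection e ∧ e ≠ 0 ∧
      ∀ F ∈ A, IsStarProjection F → F * e = F → F = 0 ∨ F = e := by
  let S : Set (H →L[ℂ] H) := {e | e ∈ corner A P ∧ IsStarProjection e ∧ e ≠ 0}
  obtain ⟨e, he, hmin⟩ := (measure (rk (H := H))).wf.has_min S
    ⟨P, (mem_corner' hP).2 ⟨hP.1.1, minCentralProj_sq hP⟩, hP.2.1, hP.2.2.1⟩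
  refine ⟨e, he.1, he.2.1, he.2.2, fun F hF hFp hFe => ?_⟩
  by_contra! hcon
  refine hmin F ⟨(mem_corner' hP).2 ⟨hF, ?_⟩, hFp, hcon.1⟩ (rk_lt_of_mul_eq hFp he.2.1 hFe hcon.2)
  rw [← minCentralProj_comm hP hF, ← hFe, mul_assoc,
    minCentralProj_comm hP ((mem_corner' hP).1 he.1).1, ((mem_corner' hP).1 he.1).2]

/-- For a minimal projection e of the block, e A e = ℂ e, so an orthonormal basis g of V = A e
satisfies g_k⋆ g_l = δ_kl e / rk e. The products g_k g_l⋆ are then rescaled matrix units; they span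
the block because ∑ g_k g_k⋆ is a nonzero multiple of P. The dimension is therefore (dim A e)². -/
lemma exists_finrank_corner_eq_sq (hP : P ∈ minCentralProj A) :
    ∃ m, Module.finrank ℂ (corner A P) = m ^ 2 := by
  obtain ⟨e, heA, hep, he0, hmin⟩ := exists_minimal_projection hP
  obtain ⟨heA, hPe⟩ := (mem_corner' hP).1 heA
  have hee : e * e = e := hep.isIdempotentElem.eq
  have hscalar : ∀ x ∈ A, ∃ c : ℂ, e * x * e = c • e := by
    intro x hx
    obtain ⟨c, hc⟩ := mul_eq_smul_of_minimal heA hep he0 hmin (mul_mem (mul_mem heA hx) heA)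
      (by rw [mul_assoc, hee, ← mul_assoc, ← mul_assoc, hee])
    exact ⟨c, by rw [← hc, mul_assoc _ e e, hee]⟩
  have htr : opTrace e = (rk e : ℂ) := opTrace_projection hep
  have hr0 : (rk e : ℂ) ≠ 0 := by exact_mod_cast (rk_pos he0).ne'
  let V : Submodule ℂ (H →L[ℂ] H) := A.toSubalgebra.toSubmodule.map (LinearMap.mulRight ℂ e)
  have hV : ∀ x, x ∈ V ↔ x ∈ A ∧ x * e = x := by
    intro x
    constructor
    · rintro ⟨y, hy, rfl⟩
      exact ⟨mul_mem hy heA, by simp [mul_assoc, hee]⟩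
    · rintro ⟨hx, hxe⟩
      exact ⟨x, hx, hxe⟩
  obtain ⟨g, hg, hgo⟩ := exists_isHSBasis V
  have hgV := fun k => (hV _).1 (hg.mem k)
  have hge : ∀ k, e * star (g k) = star (g k) := fun k => by
    have := congrArg star (hgV k).2
    rwa [star_mul, hep.isSelfAdjoint.star_eq] at this
  have hmid : ∀ k l, ∀ a ∈ A, ∃ c : ℂ, star (g k) * a * g l = c • e := by
    intro k l a ha
    obtain ⟨c, hc⟩ := hscalar _ (mul_mem (mul_mem (star_mem (hgV k).1) ha) (hgV l).1)
    refine ⟨c, ?_⟩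
    rw [← hc]
    simp only [mul_assoc, (hgV l).2]
    rw [← mul_assoc e, hge]
  have hgg : ∀ k l, star (g k) * g l = (if k = l then (rk e : ℂ)⁻¹ else 0) • e := by
    intro k l
    obtain ⟨c, hc⟩ := hmid k l 1 (one_mem _)
    rw [mul_one] at hc
    have h1 := hgo k l
    rw [hc, map_smul, htr, smul_eq_mul] at h1
    rw [hc]
    congr 1
    rw [eq_div_of_mul_eq hr0 h1]
    split_ifs <;> simp
  have hVl : ∀ a ∈ A, ∀ x ∈ V, a * x ∈ V := fun a ha x hx => by
    rw [hV] at hx ⊢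
    exact ⟨mul_mem ha hx.1, by rw [mul_assoc, hx.2]⟩
  have hPg : ∀ k, P * g k = g k := fun k => by
    rw [← minCentralProj_comm hP (hgV k).1, ← (hgV k).2, mul_assoc, minCentralProj_comm hP heA, hPe]
  set z := ∑ k, g k * star (g k) with hz
  have hzc : z ∈ centre A := by
    refine ⟨sum_mem fun k _ => mul_mem (hgV k).1 (star_mem (hgV k).1),
      mem_commutant.2 fun a ha => ?_⟩
    simpa using hg.comm (hVl a ha) (hVl _ (star_mem ha)) 1
  obtain ⟨t, ht⟩ := centre_mul_minCentralProj hzc hP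
  have hzP : z * P = z := by
    rw [minCentralProj_comm hP hzc.1, hz, Finset.mul_sum]
    exact Finset.sum_congr rfl fun k _ => by rw [← mul_assoc, hPg]
  rw [hzP] at ht
  have hzg : ∀ l, z * g l = (rk e : ℂ)⁻¹ • g l := by
    intro l
    rw [hz, Finset.sum_mul, Finset.sum_eq_single l]
    · rw [mul_assoc, hgg, if_pos rfl, mul_smul_comm, (hgV l).2]
    · intro k _ hk
      rw [mul_assoc, hgg, if_neg hk, zero_smul, mul_zero]
    · exact fun h => (h (Finset.mem_univ _)).elim
  have hze : z * e = (rk e : ℂ)⁻¹ • e := by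
    have he := hg.expand e ((hV e).2 ⟨heA, hee⟩)
    generalize (rk e : ℂ)⁻¹ = r at hzg ⊢
    rw [he, Finset.mul_sum, Finset.smul_sum]
    refine Finset.sum_congr rfl fun k _ => ?_
    rw [mul_smul_comm, hzg, smul_comm]
  have ht' : t = (rk e : ℂ)⁻¹ := by
    rw [ht, smul_mul_assoc, hPe] at hze
    exact smul_left_injective ℂ he0 hze
  have ht0 : t ≠ 0 := by rw [ht']; exact inv_ne_zero hr0
  refine ⟨Module.finrank ℂ V, ?_⟩
  let F : Fin (Module.finrank ℂ V) × Fin (Module.finrank ℂ V) → H →L[ℂ] H :=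
    fun k => g k.1 * star (g k.2)
  have horth : ∀ k l, opTrace (star (F k) * F l) = if k = l then t else 0 := by
    intro k l
    have h1 : star (F k) * F l = g k.2 * (star (g k.1) * g l.1) * star (g l.2) := by
      simp only [F, star_mul, star_star, mul_assoc]
    rw [h1, hgg, mul_smul_comm, smul_mul_assoc, (hgV _).2, map_smul, opTrace_mul_comm, hgo, ht',
      smul_eq_mul]
    by_cases h : k = l
    · simp [h]
    · rw [if_neg h]
      by_cases h2 : k.1 = l.1
      · rw [if_neg (fun h3 : l.2 = k.2 => h (Prod.ext h2 h3.symm)), mul_zero]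
      · rw [if_neg h2, zero_mul]
  have hli : LinearIndependent ℂ F := by
    rw [Fintype.linearIndependent_iff]
    intro c hc k
    have h1 := congrArg (fun x => opTrace (star (F k) * x)) hc
    simp only [Finset.mul_sum, map_sum, mul_smul_comm, map_smul, horth, mul_zero, map_zero,
      smul_eq_mul, mul_ite, Finset.sum_ite_eq, Finset.mem_univ, if_true] at h1
    exact (mul_eq_zero.1 h1).resolve_right ht0
  have hspan : corner A P = Submodule.span ℂ (Set.range F) := by
    refine le_antisymm (fun a ha => ?_) (Submodule.span_le.2 ?_)
    · rw [mem_corner' hP] at ha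
      have h1 : a = (t⁻¹ * t⁻¹) • (z * a * z) := by
        rw [ht, smul_mul_assoc, smul_mul_smul_comm, ha.2, minCentralProj_comm hP ha.1, ha.2,
          smul_smul]
        field_simp
        rw [one_smul]
      rw [h1]
      refine Submodule.smul_mem _ _ ?_
      rw [hz, Finset.sum_mul, Finset.sum_mul_sum]
      refine Submodule.sum_mem _ fun k _ => Submodule.sum_mem _ fun l _ => ?_
      obtain ⟨c, hc⟩ := hmid k l a ha.1
      have h2 : g k * star (g k) * a * (g l * star (g l)) = c • F (k, l) := by
        calc _ = g k * (star (g k) * a * g l) * star (g l) := by simp only [mul_assoc]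
          _ = _ := by rw [hc, mul_smul_comm, smul_mul_assoc, (hgV k).2]
      rw [h2]
      exact Submodule.smul_mem _ _ (Submodule.subset_span ⟨_, rfl⟩)
    · rintro _ ⟨k, rfl⟩
      exact (mem_corner' hP).2 ⟨mul_mem (hgV _).1 (star_mem (hgV _).1), by
        simp only [F]; rw [← mul_assoc, hPg]⟩
  rw [hspan, finrank_span_eq_card hli]
  simp [sq]

lemma blockSize_sq (hP : P ∈ minCentralProj A) :
    blockSize A P ^ 2 = Module.finrank ℂ (corner A P) := by
  obtain ⟨m, hm⟩ := exists_finrank_corner_eq_sq hP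
  have : blockSize A P = m := by
    change Nat.sqrt (Module.finrank ℂ (corner A P)) = m
    rw [hm, Nat.sqrt_eq']
  rw [this, hm]

variable [Nontrivial H]

lemma blockSize_mul (hP : P ∈ minCentralProj A) :
    blockSize A P * blockSize (commutant A) P = rk P := by
  have h := finrank_corner_commutant hP
  rw [← blockSize_sq hP, ← blockSize_sq (by rwa [minCentralProj_commutant]), ← mul_pow] at h
  rw [mul_comm]
  exact Nat.pow_left_injective two_ne_zero h

lemma blockSize_pos (hP : P ∈ minCentralProj A) : 0 < blockSize A P :=
  Nat.pos_of_mul_pos_right ((blockSize_mul hP).symm ▸ rk_pos hP.2.2.1)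

/-- The division of natural numbers in `blockMult` is exact, because rk P is the product of the
block sizes in A and in A'. -/
lemma blockMult_eq (hP : P ∈ minCentralProj A) : blockMult A P = blockSize (commutant A) P := by
  rw [blockMult, ← blockSize_mul hP, Nat.mul_div_cancel_left _ (blockSize_pos hP)]

lemma blockMult_commutant (hP : P ∈ minCentralProj A) :
    blockMult (commutant A) P = blockSize A P := by
  rw [blockMult_eq (by rwa [minCentralProj_commutant]), commutant_commutant]

lemma blockMult_pos (hP : P ∈ minCentralProj A) : 0 < blockMult A P := by
  rw [blockMult_eq hP]
  exact blockSize_pos (by rwa [minCentralProj_commutant])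

lemma blockMult_ne_zero (hP : P ∈ minCentralProj A) : (blockMult A P : ℂ) ≠ 0 := by
  exact_mod_cast (blockMult_pos hP).ne'

/-! ## The canonical trace -/

/-- The central density of the canonical trace with respect to the operator trace. -/
def cw (A : StarSubalgebra ℂ (H →L[ℂ] H)) : H →L[ℂ] H := wsum A fun P => (blockMult A P : ℝ)⁻¹

omit [Nontrivial H] in
lemma canonicalTrace_eq (A : StarSubalgebra ℂ (H →L[ℂ] H)) (a : H →L[ℂ] H) :
    canonicalTrace A a = opTrace (cw A * a) := by
  rw [cw, opTrace_wsum_mul, canonicalTrace, finsum_mem_eq_finite_toFinset_sum _ (finite_minCentralProj A)]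
  refine Finset.sum_congr rfl fun P _ => ?_
  push_cast
  rw [div_eq_inv_mul]

/-! ### Blocks and canonical trace of the relative commutant. -/

variable {M N : StarSubalgebra ℂ (H →L[ℂ] H)} {Q : H →L[ℂ] H}

/-- Presents M ∩ N' as the common commutant of the commuting pair N, M', so that the results on
pairs apply. -/
lemma relCommutant_eq (M N : StarSubalgebra ℂ (H →L[ℂ] H)) :
    relCommutant M N = commutant N ⊓ commutant (commutant M) := by
  rw [commutant_commutant, relCommutant, inf_comm]

/-- This self-duality lets the inverse of a density for M → N serve, after scaling, as a density for
N' → M'. -/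
lemma relCommutant_dual (M N : StarSubalgebra ℂ (H →L[ℂ] H)) :
    relCommutant (commutant N) (commutant M) = relCommutant M N := by
  rw [relCommutant, commutant_commutant, relCommutant, inf_comm]

lemma mul_mem_minCentralProj_relCommutant (hNM : N ≤ M) (hP : P ∈ minCentralProj N)
    (hQ : Q ∈ minCentralProj M) (hPQ : P * Q ≠ 0) : P * Q ∈ minCentralProj (relCommutant M N) := by
  rw [relCommutant_eq]
  exact pair_mem_minCentralProj (commutant_anti hNM) hP (by rwa [minCentralProj_commutant]) hPQ

lemma blockSize_relCommutant (hNM : N ≤ M) (hP : P ∈ minCentralProj N)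
    (hQ : Q ∈ minCentralProj M) (hPQ : P * Q ≠ 0) :
    blockSize (relCommutant M N) (P * Q) * (blockSize N P * blockMult M Q) = rk (P * Q) := by
  have hQ' : Q ∈ minCentralProj (commutant M) := by rwa [minCentralProj_commutant]
  have h := finrank_corner_pair (commutant_anti hNM) hP hQ'
  rw [← relCommutant_eq, ← blockSize_sq hP, ← blockSize_sq hQ', ← blockMult_eq hQ,
    ← blockSize_sq (mul_mem_minCentralProj_relCommutant hNM hP hQ hPQ), ← mul_pow, ← mul_pow] at h
  exact Nat.pow_left_injective two_ne_zero h

lemma blockMult_relCommutant (hNM : N ≤ M) (hP : P ∈ minCentralProj N)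
    (hQ : Q ∈ minCentralProj M) (hPQ : P * Q ≠ 0) :
    blockMult (relCommutant M N) (P * Q) = blockSize N P * blockMult M Q := by
  rw [blockMult, ← blockSize_relCommutant hNM hP hQ hPQ, Nat.mul_div_cancel_left _
    (blockSize_pos (mul_mem_minCentralProj_relCommutant hNM hP hQ hPQ))]

omit [Nontrivial H] in
lemma mul_cw (hP : P ∈ minCentralProj A) : P * cw A = (blockMult A P : ℂ)⁻¹ • P := by
  rw [cw, mul_wsum hP]
  push_cast
  rfl

lemma mul_cw_commutant (hP : P ∈ minCentralProj A) :
    P * cw (commutant A) = (blockSize A P : ℂ)⁻¹ • P := by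
  rw [mul_cw (by rwa [minCentralProj_commutant]), blockMult_commutant hP]

omit [Nontrivial H] in
lemma cw_mem_centre (A : StarSubalgebra ℂ (H →L[ℂ] H)) : cw A ∈ centre A := wsum_mem A _

omit [Nontrivial H] in
lemma eq_of_mul_minCentralProj {x y : H →L[ℂ] H}
    (h : ∀ P ∈ minCentralProj N, ∀ Q ∈ minCentralProj M, P * Q * x = P * Q * y) : x = y := by
  have h1 : ∀ x : H →L[ℂ] H, x = ∑ P ∈ mcp N, ∑ Q ∈ mcp M, P * Q * x := by
    intro x
    simp only [mul_assoc, ← Finset.mul_sum, ← Finset.sum_mul, sum_mcp, one_mul]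
  rw [h1 x, h1 y]
  exact Finset.sum_congr rfl fun P hP => Finset.sum_congr rfl fun Q hQ =>
    h P (mem_mcp.1 hP) Q (mem_mcp.1 hQ)

/-- The multiplicity of the block P Q is the multiplicity of Q in M times the size of P in N, and
the latter is the multiplicity of P in N'. -/
lemma cw_relCommutant (hNM : N ≤ M) : cw (relCommutant M N) = cw M * cw (commutant N) := by
  refine eq_of_mul_minCentralProj (M := M) (N := N) fun P hP Q hQ => ?_
  by_cases hPQ : P * Q = 0
  · rw [hPQ, zero_mul, zero_mul]
  rw [mul_cw (mul_mem_minCentralProj_relCommutant hNM hP hQ hPQ),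
    blockMult_relCommutant hNM hP hQ hPQ, mul_assoc P, ← mul_assoc Q, mul_cw hQ, smul_mul_assoc,
    mul_smul_comm, ← mul_assoc]
  have hc : P * Q = Q * P := minCentralProj_comm hQ (hNM hP.1.1)
  rw [hc, mul_assoc, mul_cw_commutant hP, mul_smul_comm, smul_smul]
  push_cast
  rw [mul_inv, mul_comm]

lemma canonicalTrace_relCommutant (hNM : N ≤ M) (hP : P ∈ minCentralProj N) (x : H →L[ℂ] H) :
    canonicalTrace M (P * x) = blockSize N P * canonicalTrace (relCommutant M N) (P * x) := by
  have hc : cw (commutant N) * P = P * cw (commutant N) :=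
    (mem_commutant.1 (cw_mem_centre _).1 P hP.1.1).symm
  rw [canonicalTrace_eq, canonicalTrace_eq, cw_relCommutant hNM, mul_assoc (cw M) _ (P * x), ← mul_assoc (cw (commutant N)) P x, hc,
    mul_cw_commutant hP, smul_mul_assoc, mul_smul_comm, map_smul, smul_eq_mul,
    mul_inv_cancel_left₀]
  exact_mod_cast (blockSize_pos hP).ne'

end BlockSize
end EntropicCertainty
end

open scoped ENNReal InnerProductSpace
set_option linter.unusedSectionVars false
open scoped ComplexOrder
noncomputable section
namespace EntropicCertainty
variable {H : Type*} [NormedAddCommGroup H] [InnerProductSpace ℂ H] [CompleteSpace H]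
section Density
variable [FiniteDimensional ℂ H] {A : StarSubalgebra ℂ (H →L[ℂ] H)} {P : H →L[ℂ] H}

/-! ## Densities -/

instance instFiniteDimensionalStarSubalgebra (A : StarSubalgebra ℂ (H →L[ℂ] H)) :
    FiniteDimensional ℂ A :=
  inferInstanceAs (FiniteDimensional ℂ A.toSubalgebra.toSubmodule)

/-- The canonical trace as a linear map. -/
def ctr (A : StarSubalgebra ℂ (H →L[ℂ] H)) : (H →L[ℂ] H) →ₗ[ℂ] ℂ :=
  opTrace ∘ₗ LinearMap.mulLeft ℂ (cw A)

lemma ctr_apply (A : StarSubalgebra ℂ (H →L[ℂ] H)) (a : H →L[ℂ] H) :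
    ctr A a = opTrace (cw A * a) := rfl

lemma canonicalTrace_eq_ctr (A : StarSubalgebra ℂ (H →L[ℂ] H)) (a : H →L[ℂ] H) :
    canonicalTrace A a = ctr A a := canonicalTrace_eq A a

lemma cw_comm {a : H →L[ℂ] H} (ha : a ∈ A) : a * cw A = cw A * a :=
  mem_commutant.1 (cw_mem_centre A).2 a ha

lemma ctr_mul_comm {a : H →L[ℂ] H} (ha : a ∈ A) (x : H →L[ℂ] H) :
    ctr A (a * x) = ctr A (x * a) := by
  rw [ctr_apply, ctr_apply, ← mul_assoc, ← cw_comm ha, mul_assoc, opTrace_mul_comm, mul_assoc]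

lemma ctr_star {x : H →L[ℂ] H} (hx : x ∈ A) : ctr A (star x) = star (ctr A x) := by
  rw [ctr_apply, ctr_apply, ← opTrace_star, star_mul, cw, star_wsum, ← cw, cw_comm (star_mem hx)]

lemma opTrace_mul_nonneg {a b : H →L[ℂ] H} (ha : 0 ≤ a) (hb : 0 ≤ b) : 0 ≤ opTrace (a * b) := by
  obtain ⟨s, rfl⟩ := CStarAlgebra.nonneg_iff_eq_star_mul_self.1 ha
  obtain ⟨t, rfl⟩ := CStarAlgebra.nonneg_iff_eq_star_mul_self.1 hb
  have : opTrace (star s * s * (star t * t)) = opTrace (star (s * star t) * (s * star t)) := by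
    rw [star_mul, star_star, ← mul_assoc, opTrace_mul_comm]
    simp only [mul_assoc]
  rw [this]
  exact opTrace_star_mul_self_nonneg _

lemma exists_sqrt_cw (A : StarSubalgebra ℂ (H →L[ℂ] H)) :
    ∃ k ∈ centre A, star k = k ∧ cw A = k * k := by
  refine ⟨wsum A fun P => Real.sqrt (blockMult A P : ℝ)⁻¹, wsum_mem A _, star_wsum _, ?_⟩
  rw [wsum_mul, cw]
  exact wsum_congr fun P _ => (Real.mul_self_sqrt (by positivity)).symm

lemma ctr_mul_nonneg {a b : H →L[ℂ] H} (ha : 0 ≤ a) (hb : 0 ≤ b) (hbA : b ∈ A) :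
    0 ≤ ctr A (a * b) := by
  obtain ⟨k, hk, hks, hkk⟩ := exists_sqrt_cw A
  have h1 : ctr A (a * b) = opTrace (a * (star k * b * k)) := by
    rw [ctr_apply, opTrace_mul_comm, hkk, hks, ← mem_commutant.1 hk.2 b hbA]
    simp only [mul_assoc]
  rw [h1]
  exact opTrace_mul_nonneg ha (star_left_conjugate_nonneg hb k)

lemma ctr_nonneg {b : H →L[ℂ] H} (hb : 0 ≤ b) (hbA : b ∈ A) : 0 ≤ ctr A b := by
  simpa using ctr_mul_nonneg zero_le_one hb hbA

variable [Nontrivial H]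

lemma mul_cw_inv (A : StarSubalgebra ℂ (H →L[ℂ] H)) :
    wsum A (fun P => (blockMult A P : ℝ)) * cw A = 1 := by
  rw [cw, wsum_mul, ← wsum_one A]
  refine wsum_congr fun P hP => mul_inv_cancel₀ ?_
  exact_mod_cast (blockMult_pos hP).ne'

lemma eq_zero_of_ctr_star_mul_self {x : H →L[ℂ] H} (h : ctr A (star x * x) = 0) : x = 0 := by
  obtain ⟨k, hk, hks, hkk⟩ := exists_sqrt_cw A
  have h1 : ctr A (star x * x) = opTrace (star (x * k) * (x * k)) := by
    rw [ctr_apply, hkk, mul_assoc, opTrace_mul_comm, star_mul, hks]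
    simp only [mul_assoc]
  rw [h1] at h
  have h2 := eq_zero_of_opTrace_star_mul_self h
  have h3 : x * (k * k * wsum A fun P => (blockMult A P : ℝ)) = 0 := by
    rw [← mul_assoc, ← mul_assoc, h2, zero_mul, zero_mul]
  rwa [← hkk, wsum_comm _ (cw_mem_centre A).1, mul_cw_inv, mul_one] at h3

omit [Nontrivial H] in
lemma eq_sum_specProj {a : H →L[ℂ] H} (ha : IsSelfAdjoint a) :
    a = ∑ t ∈ (finite_real_spectrum a).toFinset, (t : ℂ) • specProj a t := by
  conv_lhs => rw [← mul_one a, ← sum_specProj ha, Finset.mul_sum]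
  exact Finset.sum_congr rfl fun t _ => mul_specProj ha t

lemma eq_of_ctr_mul_eq {ρ ρ' : H →L[ℂ] H} (hρ : ρ ∈ A) (hρ' : ρ' ∈ A)
    (h : ∀ a ∈ A, ctr A (ρ * a) = ctr A (ρ' * a)) : ρ = ρ' := by
  rw [← sub_eq_zero, ← star_eq_zero]
  apply eq_zero_of_ctr_star_mul_self (A := A)
  rw [star_star, sub_mul, map_sub, h _ (star_mem (sub_mem hρ hρ')), sub_self]

/-- Polarizing with 1 + a and 1 + i a shows that the functional is hermitian, so ρ is self-adjoint
by faithfulness. Tested on the spectral projection of a negative eigenvalue, the hypothesis gives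
that projection trace zero. -/
lemma nonneg_of_ctr_nonneg {ρ : H →L[ℂ] H} (hρ : ρ ∈ A)
    (h : ∀ a ∈ A, 0 ≤ ctr A (ρ * (star a * a))) : 0 ≤ ρ := by
  have him : ∀ a ∈ A, (ctr A (ρ * (star a * a))).im = 0 := fun a ha =>
    ((Complex.nonneg_iff.1 (h a ha)).2).symm
  have hherm : ∀ a ∈ A, ctr A (ρ * star a) = star (ctr A (ρ * a)) := by
    intro a ha
    have h1 := him (1 + a) (add_mem (one_mem _) ha)
    have h2 := him (1 + Complex.I • a) (add_mem (one_mem _) (A.smul_mem ha _))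
    have h3 := him 1 (one_mem _)
    have h4 := him a ha
    simp only [star_add, star_one, star_smul, add_mul, mul_add, one_mul, mul_one, map_add,
      smul_mul_assoc, mul_smul_comm, map_smul, smul_eq_mul, Complex.add_im, Complex.mul_im,
      Complex.mul_re] at h1 h2 h3 h4
    simp at h1 h2 h3 h4
    apply Complex.ext <;> simp <;> linarith
  have hsa : IsSelfAdjoint ρ := by
    refine eq_of_ctr_mul_eq (star_mem hρ) hρ fun a ha => ?_
    have h1 := hherm _ (star_mem ha)
    rw [star_star] at h1
    rw [h1, ← ctr_star (mul_mem hρ (star_mem ha)), star_mul, star_star, ctr_mul_comm ha]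
  rw [eq_sum_specProj hsa]
  refine Finset.sum_nonneg fun t _ => ?_
  have hp := isStarProjection_specProj ρ t
  have hpA := specProj_mem A hρ hsa t
  rcases le_or_gt 0 t with ht | ht
  · exact smul_nonneg (by exact_mod_cast ht) hp.nonneg
  · have h1 := h _ hpA
    rw [hp.isSelfAdjoint.star_eq, hp.isIdempotentElem.eq, mul_specProj hsa, map_smul,
      smul_eq_mul] at h1
    have h2 := ctr_nonneg hp.nonneg hpA
    have h3 : ctr A (specProj ρ t) = 0 := by
      rw [Complex.nonneg_iff] at h1 h2
      simp only [Complex.re_ofReal_mul] at h1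
      apply Complex.ext
      · simp only [Complex.zero_re]; nlinarith [h1.1, h2.1]
      · exact h2.2.symm
    have h4 : specProj ρ t = 0 := by
      apply eq_zero_of_ctr_star_mul_self (A := A)
      rw [hp.isSelfAdjoint.star_eq, hp.isIdempotentElem.eq, h3]
    rw [h4, smul_zero]

/-- The trace pairing identifies `A` with its dual. -/
def traceDual (A : StarSubalgebra ℂ (H →L[ℂ] H)) : A ≃ₗ[ℂ] Module.Dual ℂ A :=
  LinearMap.linearEquivOfInjective
    (LinearMap.mk₂ ℂ (fun ρ a : A => ctr A ((ρ : H →L[ℂ] H) * a))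
      (fun _ _ _ => by simp [add_mul]) (fun _ _ _ => by simp) (fun _ _ _ => by simp [mul_add])
      (fun _ _ _ => by simp))
    (fun ρ ρ' h => Subtype.ext (eq_of_ctr_mul_eq ρ.2 ρ'.2 fun a ha => LinearMap.congr_fun h ⟨a, ha⟩))
    (Subspace.dual_finrank_eq).symm

lemma traceDual_apply (ρ a : A) : traceDual A ρ a = ctr A ((ρ : H →L[ℂ] H) * a) := rfl

lemma ctr_traceDual_symm (φ : Module.Dual ℂ A) (a : A) :
    ctr A (((traceDual A).symm φ : H →L[ℂ] H) * a) = φ a := by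
  rw [← traceDual_apply, LinearEquiv.apply_symm_apply]

lemma density_spec (A : StarSubalgebra ℂ (H →L[ℂ] H)) (φ : A →ₗ[ℂ] ℂ) :
    density A φ ∈ A ∧ ∀ a : A, ctr A (density A φ * (a : H →L[ℂ] H)) = φ a := by
  have h := Classical.epsilon_spec (p := fun ρ : H →L[ℂ] H =>
    ρ ∈ A ∧ ∀ a : A, canonicalTrace A (ρ * (a : H →L[ℂ] H)) = φ a)
    ⟨((traceDual A).symm φ : H →L[ℂ] H), SetLike.coe_mem _, fun a => by
      rw [canonicalTrace_eq_ctr]; exact ctr_traceDual_symm φ a⟩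
  refine ⟨h.1, fun a => ?_⟩
  rw [← canonicalTrace_eq_ctr]
  exact h.2 a

lemma density_eq {φ : A →ₗ[ℂ] ℂ} {ρ : H →L[ℂ] H} (hρ : ρ ∈ A)
    (h : ∀ a : A, ctr A (ρ * (a : H →L[ℂ] H)) = φ a) : density A φ = ρ :=
  eq_of_ctr_mul_eq (density_spec A φ).1 hρ fun a ha => by
    rw [(density_spec A φ).2 ⟨a, ha⟩, ← h]

/-! ## Conditional expectations and their densities -/

variable {M N : StarSubalgebra ℂ (H →L[ℂ] H)}

/-- `ρ` is the element of `M ∩ N'` for which `ε` is the adjoint, for the canonical traces, of the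
multiplication by `ρ`. -/
structure IsDensityOf (ε : M →ₗ[ℂ] N) (ρ : H →L[ℂ] H) : Prop where
  mem : ρ ∈ relCommutant M N
  nonneg : 0 ≤ ρ
  apply : ∀ n ∈ N, ∀ m : M, ctr M (ρ * (n * m)) = ctr N (n * (ε m : H →L[ℂ] H))

lemma IsDensityOf.comm {ε : M →ₗ[ℂ] N} {ρ : H →L[ℂ] H} (hρ : IsDensityOf ε ρ) {n : H →L[ℂ] H}
    (hn : n ∈ N) : n * ρ = ρ * n := mem_commutant.1 hρ.mem.2 n hn

/-- ρ represents Tr_N ∘ ε in the trace pairing of M. The left and right module properties give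
Tr_M(ρ n m) = Tr_M(ρ m n), whence ρ commutes with N. -/
lemma exists_isDensityOf (hNM : N ≤ M) {ε : M →ₗ[ℂ] N} (hε : IsCondExp M N ε) :
    ∃ ρ, IsDensityOf ε ρ := by
  let φ : Module.Dual ℂ M := ctr N ∘ₗ N.subtype.toAlgHom.toLinearMap ∘ₗ ε
  obtain ⟨ρ, hρ⟩ : ∃ ρ : M, ∀ m : M, ctr M ((ρ : H →L[ℂ] H) * m) = ctr N (ε m : H →L[ℂ] H) :=
    ⟨(traceDual M).symm φ, fun m => ctr_traceDual_symm φ m⟩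
  have hl : ∀ n ∈ N, ∀ m : M, ctr M ((ρ : H →L[ℂ] H) * (n * m)) = ctr N (n * (ε m : H →L[ℂ] H)) := by
    intro n hn m
    have h1 := hε.bimodule m ⟨n, hNM hn⟩ 1 hn (one_mem _)
    rw [mul_one] at h1
    have h2 := hρ (⟨n, hNM hn⟩ * m)
    rw [h1, OneMemClass.coe_one, mul_one] at h2
    exact h2
  have hr : ∀ n ∈ N, ∀ m : M, ctr M ((ρ : H →L[ℂ] H) * (m * n)) = ctr N (n * (ε m : H →L[ℂ] H)) := by
    intro n hn m
    have h1 := hε.bimodule m 1 ⟨n, hNM hn⟩ (one_mem _) hn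
    rw [one_mul] at h1
    have h2 := hρ (m * ⟨n, hNM hn⟩)
    rw [h1, OneMemClass.coe_one, one_mul, ← ctr_mul_comm hn] at h2
    exact h2
  refine ⟨ρ, ⟨ρ.2, mem_commutant.2 fun n hn => ?_⟩, nonneg_of_ctr_nonneg ρ.2 fun a ha => ?_, hl⟩
  · refine eq_of_ctr_mul_eq (mul_mem (hNM hn) ρ.2) (mul_mem ρ.2 (hNM hn)) fun a ha => ?_
    rw [mul_assoc, ctr_mul_comm (hNM hn), mul_assoc, mul_assoc, hl n hn ⟨a, ha⟩, hr n hn ⟨a, ha⟩]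
  · rw [hρ ⟨star a * a, mul_mem (star_mem ha) ha⟩]
    exact ctr_nonneg (hε.pos _ (star_mul_self_nonneg a)) (ε _).2

lemma IsDensityOf.ext {ε ε' : M →ₗ[ℂ] N} {ρ : H →L[ℂ] H} (h : IsDensityOf ε ρ)
    (h' : IsDensityOf ε' ρ) : ε = ε' := by
  ext m : 1
  refine Subtype.ext (eq_of_ctr_mul_eq (ε m).2 (ε' m).2 fun n hn => ?_)
  rw [ctr_mul_comm (ε m).2, ctr_mul_comm (ε' m).2, ← h.apply n hn, ← h'.apply n hn]

lemma mem_relCommutant_of_mem_centre (hNM : N ≤ M) {z : H →L[ℂ] H} (hz : z ∈ centre N) :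
    z ∈ relCommutant M N := ⟨hNM hz.1, hz.2⟩

lemma mem_relCommutant_of_mem_centre' (hNM : N ≤ M) {z : H →L[ℂ] H} (hz : z ∈ centre M) :
    z ∈ relCommutant M N := ⟨hz.1, commutant_anti hNM hz.2⟩

lemma ctr_relCommutant (hNM : N ≤ M) (hP : P ∈ minCentralProj N) (x : H →L[ℂ] H) :
    ctr M (P * x) = blockSize N P * ctr (relCommutant M N) (P * x) := by
  simpa only [canonicalTrace_eq_ctr] using canonicalTrace_relCommutant hNM hP x

lemma ctr_mul_minCentralProj (hP : P ∈ minCentralProj A) (x : H →L[ℂ] H) :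
    ctr A (P * x) = opTrace (P * x) / blockMult A P := by
  rw [ctr_apply, ← mul_assoc, ← cw_comm hP.1.1, mul_cw hP, smul_mul_assoc, map_smul, smul_eq_mul,
    inv_mul_eq_div]

lemma rk_eq (hP : P ∈ minCentralProj A) : (rk P : ℂ) = blockSize A P * blockMult A P := by
  rw [blockMult_eq hP, ← blockSize_mul hP]; push_cast; rfl

lemma blockSize_ne_zero (hP : P ∈ minCentralProj A) : (blockSize A P : ℂ) ≠ 0 := by
  exact_mod_cast (blockSize_pos hP).ne'

lemma ctr_minCentralProj (hP : P ∈ minCentralProj A) : ctr A P = blockSize A P := by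
  have h := ctr_mul_minCentralProj hP 1
  rw [mul_one] at h
  rw [h, opTrace_minCentralProj hP, rk_eq hP, mul_div_cancel_right₀ _ (blockMult_ne_zero hP)]

/-- On P the traces of M and of M ∩ N' differ by the block size of P in N. Dividing by rk P in
`partialState` supplies the same factor, since rk P is size times multiplicity. -/
lemma IsDensityOf.partialDensity_eq (hNM : N ≤ M) {ε : M →ₗ[ℂ] N} {ρ : H →L[ℂ] H}
    (hρ : IsDensityOf ε ρ) (hP : P ∈ minCentralProj N) : partialDensity ε P = P * ρ := by
  refine density_eq (mul_mem (mem_relCommutant_of_mem_centre hNM hP.1) hρ.mem) fun x => ?_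
  refine mul_left_cancel₀ (blockSize_ne_zero hP) ?_
  rw [mul_assoc, ← ctr_relCommutant hNM hP, ← mul_assoc, hρ.comm hP.1.1, mul_assoc,
    hρ.apply P hP.1.1 ⟨x, x.2.1⟩, ctr_mul_minCentralProj hP]
  change _ = _ * (opTrace (P * (ε ⟨x, x.2.1⟩ : H →L[ℂ] H)) / (rk P : ℂ))
  rw [rk_eq hP]
  have h1 := blockSize_ne_zero hP
  have h2 := blockMult_ne_zero hP
  field_simp

lemma IsDensityOf.ctr_eq_one (hNM : N ≤ M) {ε : M →ₗ[ℂ] N} (hε : IsCondExp M N ε) {ρ : H →L[ℂ] H}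
    (hρ : IsDensityOf ε ρ) (hP : P ∈ minCentralProj N) : ctr (relCommutant M N) (P * ρ) = 1 := by
  refine mul_left_cancel₀ (blockSize_ne_zero hP) ?_
  have h1 := hρ.apply P hP.1.1 1
  rw [hε.unital, OneMemClass.coe_one, OneMemClass.coe_one, mul_one] at h1
  rw [← ctr_relCommutant hNM hP, hρ.comm hP.1.1, h1, ctr_minCentralProj hP, mul_one]

/-- ε(m) is defined by duality in N. Commutation of ρ with N gives the bimodule property; it also
makes ε(1) central in N, and the normalization then says that ε(1) is 1 on each P. -/
lemma exists_condExp_of_density (hNM : N ≤ M) {ρ : H →L[ℂ] H} (hρ : ρ ∈ relCommutant M N)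
    (hρ0 : 0 ≤ ρ) (h1 : ∀ P ∈ minCentralProj N, ctr (relCommutant M N) (P * ρ) = 1) :
    ∃ ε ∈ condExps M N, IsDensityOf ε ρ := by
  have hcomm : ∀ n ∈ N, n * ρ = ρ * n := mem_commutant.1 hρ.2
  let T : M →ₗ[ℂ] Module.Dual ℂ N :=
    LinearMap.mk₂ ℂ (fun (m : M) (n : N) => ctr M (ρ * ((n : H →L[ℂ] H) * m)))
      (fun _ _ _ => by simp [mul_add]) (fun _ _ _ => by simp) (fun _ _ _ => by simp [mul_add, add_mul])
      (fun _ _ _ => by simp)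
  let ε : M →ₗ[ℂ] N := (traceDual N).symm.toLinearMap ∘ₗ T
  have hε : ∀ (m : M), ∀ n ∈ N, ctr N ((ε m : H →L[ℂ] H) * n) = ctr M (ρ * (n * m)) :=
    fun m n hn => ctr_traceDual_symm (T m) ⟨n, hn⟩
  refine ⟨ε, ⟨fun m hm => ?_, ?_, fun m n₁ n₂ hn₁ hn₂ => ?_⟩, hρ, hρ0, fun n hn m => ?_⟩
  · refine nonneg_of_ctr_nonneg (ε m).2 fun n hn => ?_
    rw [hε m _ (mul_mem (star_mem hn) hn)]
    have h2 : ρ * (star n * n * m) = star n * ρ * n * m := by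
      rw [hcomm _ (star_mem hn)]; simp only [mul_assoc]
    rw [h2]
    exact ctr_mul_nonneg (star_left_conjugate_nonneg hρ0 n) hm m.2
  · have hz : (ε 1 : H →L[ℂ] H) ∈ centre N := by
      refine ⟨(ε 1).2, mem_commutant.2 fun n hn => ?_⟩
      refine eq_of_ctr_mul_eq (mul_mem hn (ε 1).2) (mul_mem (ε 1).2 hn) fun n' hn' => ?_
      rw [mul_assoc, mul_assoc, ctr_mul_comm hn, mul_assoc, hε _ _ (mul_mem hn hn'),
        hε _ _ (mul_mem hn' hn), OneMemClass.coe_one, mul_one, mul_one, ← mul_assoc, ← mul_assoc,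
        ctr_mul_comm (mul_mem hρ.1 (hNM hn')), ← mul_assoc, hcomm n hn]
    refine Subtype.ext ?_
    have h2 : ∀ P ∈ mcp N, (ε 1 : H →L[ℂ] H) * P = P := by
      intro P hP
      rw [mem_mcp] at hP
      obtain ⟨c, hc⟩ := centre_mul_minCentralProj hz hP
      have h3 := hε 1 P hP.1.1
      rw [hc, map_smul, ctr_minCentralProj hP, OneMemClass.coe_one, mul_one, ← hcomm P hP.1.1,
        ctr_relCommutant hNM hP, h1 P hP, mul_one, smul_eq_mul] at h3
      rw [hc, mul_right_cancel₀ (blockSize_ne_zero hP) (h3.trans (one_mul _).symm), one_smul]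
    calc (ε 1 : H →L[ℂ] H) = (ε 1 : H →L[ℂ] H) * ∑ P ∈ mcp N, P := by rw [sum_mcp, mul_one]
      _ = ((1 : N) : H →L[ℂ] H) := by
        rw [Finset.mul_sum, Finset.sum_congr rfl h2, sum_mcp]; rfl
  · refine eq_of_ctr_mul_eq (ε _).2 (mul_mem (mul_mem hn₁ (ε m).2) hn₂) fun n hn => ?_
    have h3 : (n₁ : H →L[ℂ] H) * (ε m : H →L[ℂ] H) * n₂ * n = n₁ * ((ε m : H →L[ℂ] H) * (n₂ * n)) := by
      simp only [mul_assoc]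
    rw [hε _ n hn, h3, ctr_mul_comm hn₁, mul_assoc (ε m : H →L[ℂ] H),
      hε _ _ (mul_mem (mul_mem hn₂ hn) hn₁), MulMemClass.coe_mul, MulMemClass.coe_mul]
    have h2 : ρ * (n * ((n₁ : H →L[ℂ] H) * m * n₂)) = ρ * (n * (n₁ * m)) * n₂ := by
      simp only [mul_assoc]
    rw [h2, ← ctr_mul_comm n₂.2, ← mul_assoc, hcomm _ hn₂]
    simp only [mul_assoc]
  · rw [← hε m n hn, ctr_mul_comm hn]

lemma IsDensityOf.density_comp (hNM : N ≤ M) {ε : M →ₗ[ℂ] N} {ρ : H →L[ℂ] H}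
    (hρ : IsDensityOf ε ρ) (χ : N →ₗ[ℂ] ℂ) : density M (χ ∘ₗ ε) = density N χ * ρ := by
  have hχ := density_spec N χ
  refine density_eq (mul_mem (hNM hχ.1) hρ.mem.1) fun m => ?_
  rw [hρ.comm hχ.1, mul_assoc, hρ.apply _ hχ.1, hχ.2]
  rfl

end Density
end EntropicCertainty
end

open scoped ENNReal InnerProductSpace
set_option linter.unusedSectionVars false
open scoped ComplexOrder
noncomputable section
namespace EntropicCertainty
variable {H : Type*} [NormedAddCommGroup H] [InnerProductSpace ℂ H] [CompleteSpace H]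
section Index
variable [FiniteDimensional ℂ H]

/-! ## The index in terms of the density -/

lemma finrank_eigenspace_inf_range {D E : H →L[ℂ] H} (hD : IsSelfAdjoint D)
    (hE : IsStarProjection E) (hDE : Commute D E) (t : ℝ) :
    (Module.finrank ℂ (Module.End.eigenspace D.toLinearMap (t : ℂ) ⊓
      LinearMap.range E.toLinearMap : Submodule ℂ H) : ℂ) = opTrace (specProj D t * E) := by
  have hc : Commute (specProj D t) E := hDE.cfc_real _
  have hp : IsStarProjection (specProj D t * E) := (isStarProjection_specProj D t).mul hE hc
  suffices h : Module.End.eigenspace D.toLinearMap (t : ℂ) ⊓ LinearMap.range E.toLinearMap =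
      LinearMap.range (specProj D t * E).toLinearMap by
    rw [opTrace_projection hp, rk, h]
  ext v
  constructor
  · rintro ⟨hv, w, rfl⟩
    have h1 : D (E w) = (t : ℂ) • E w := Module.End.mem_eigenspace_iff.1 hv
    have h2 : E (E w) = E w := congrArg (fun T : H →L[ℂ] H => T w) hE.isIdempotentElem.eq
    refine ⟨E w, ?_⟩
    change specProj D t (E (E w)) = E w
    rw [h2, specProj_apply_eigenvector hD h1]
  · rintro ⟨w, rfl⟩
    refine ⟨Module.End.mem_eigenspace_iff.2 ?_, specProj D t w,
      (congrArg (fun T : H →L[ℂ] H => T w) hc.eq).symm⟩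
    exact congrArg (fun T : H →L[ℂ] H => T (E w)) (mul_specProj hD t)

lemma specProj_eq_zero {D : H →L[ℂ] H} {t : ℝ} (ht : t ∉ spectrum ℝ D) : specProj D t = 0 := by
  classical
  rw [specProj, cfc_congr (g := fun _ => (0 : ℝ)), cfc_const_zero]
  intro x hx
  simp only [ite_eq_right_iff, one_ne_zero]
  rintro rfl
  exact ht hx

/-- τ inverts D on the range of E, so its trace counts each eigenvalue t with weight 1/t. The
eigenvalue 0 has no eigenvector in that range, so its infinite weight is multiplied by 0; off the
spectrum the eigenspaces vanish. -/
lemma tsum_eigenspaces {D E τ : H →L[ℂ] H} (hD : 0 ≤ D) (hE : IsStarProjection E)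
    (hDE : Commute D E) (hτ : D * τ = E) (hEτ : E * τ = τ) {μ : ℕ} (hμ : 0 < μ) :
    ∑' t : ℝ, ((Module.finrank ℂ (Module.End.eigenspace D.toLinearMap (t : ℂ) ⊓
      LinearMap.range E.toLinearMap : Submodule ℂ H) : ℝ≥0∞) / (μ : ℝ≥0∞)) * (ENNReal.ofReal t)⁻¹ =
      ENNReal.ofReal ((opTrace τ).re / μ) := by
  have hDsa : IsSelfAdjoint D := .of_nonneg hD
  set d : ℝ → ℕ := fun t => Module.finrank ℂ (Module.End.eigenspace D.toLinearMap (t : ℂ) ⊓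
      LinearMap.range E.toLinearMap : Submodule ℂ H) with hd
  have hdt : ∀ t, (d t : ℂ) = opTrace (specProj D t * E) := finrank_eigenspace_inf_range hDsa hE hDE
  have hcD : ∀ t, specProj D t * D = (t : ℂ) • specProj D t := fun t => by
    have h : Commute (specProj D t) D := (Commute.refl D).cfc_real _
    rw [← mul_specProj hDsa, h.eq]
  have h1 : ∀ t : ℝ, (t : ℂ) • (specProj D t * τ) = specProj D t * E := fun t => by
    rw [← smul_mul_assoc, ← hcD, mul_assoc, hτ]
  have h0 : specProj D 0 * E = 0 := by rw [← h1]; simp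
  have hd0 : d 0 = 0 := by
    have := hdt 0
    rw [h0, map_zero] at this
    exact_mod_cast this
  have hterm : ∀ t, opTrace (specProj D t * τ) = (t : ℂ)⁻¹ * d t := by
    intro t
    by_cases ht : t = 0
    · rw [ht, ← hEτ, ← mul_assoc, h0, zero_mul, map_zero, Complex.ofReal_zero, inv_zero, zero_mul]
    · have ht' : (t : ℂ) ≠ 0 := by exact_mod_cast ht
      rw [hdt, ← h1, map_smul, smul_eq_mul, inv_mul_cancel_left₀ ht']
  have htr : (opTrace τ).re = ∑ t ∈ (finite_real_spectrum D).toFinset, t⁻¹ * d t := by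
    conv_lhs => rw [← one_mul τ, ← sum_specProj hDsa, Finset.sum_mul, map_sum]
    rw [Finset.sum_congr rfl fun t _ => hterm t, Complex.re_sum]
    refine Finset.sum_congr rfl fun t _ => ?_
    rw [← Complex.ofReal_inv, ← Complex.ofReal_natCast, ← Complex.ofReal_mul, Complex.ofReal_re]
  have hnn : ∀ t ∈ (finite_real_spectrum D).toFinset, 0 ≤ t := fun t ht =>
    spectrum_nonneg_of_nonneg hD (by simpa using ht)
  rw [htr, Finset.sum_div, ENNReal.ofReal_sum_of_nonneg fun t ht => by
    have := hnn t ht; positivity]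
  rw [tsum_eq_sum (s := (finite_real_spectrum D).toFinset)]
  · refine Finset.sum_congr rfl fun t ht => ?_
    rcases (hnn t ht).eq_or_lt with h | h
    · rw [← h]
      change ((d 0 : ℝ≥0∞) / _) * _ = _
      rw [hd0]
      simp
    · change ((d t : ℝ≥0∞) / _) * _ = _
      have hμ' : (0 : ℝ) < μ := by exact_mod_cast hμ
      rw [mul_div_assoc, ENNReal.ofReal_mul (by positivity), ENNReal.ofReal_inv_of_pos h, mul_comm,
        ENNReal.ofReal_div_of_pos hμ', ENNReal.ofReal_natCast, ENNReal.ofReal_natCast]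
  · intro t ht
    have hz : specProj D t = 0 := specProj_eq_zero (by simpa using ht)
    have hdz : d t = 0 := by
      have := hdt t
      rw [hz, zero_mul, map_zero] at this
      exact_mod_cast this
    change ((d t : ℝ≥0∞) / _) * _ = _
    rw [hdz]
    simp

/-! ### Inverses of positive operators, and the index as the trace of the inverse density. -/

lemma isSelfAdjoint_of_mul_eq_one {ρ τ : H →L[ℂ] H} (hρ : IsSelfAdjoint ρ) (h : ρ * τ = 1) :
    IsSelfAdjoint τ := by
  have h1 : star τ * ρ = 1 := by
    have := congrArg star h
    rwa [star_mul, star_one, hρ.star_eq] at this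
  calc star τ = star τ * (ρ * τ) := by rw [h, mul_one]
    _ = τ := by rw [← mul_assoc, h1, one_mul]

lemma mul_eq_one_symm {ρ τ : H →L[ℂ] H} (hρ : IsSelfAdjoint ρ) (h : ρ * τ = 1) : τ * ρ = 1 := by
  have := congrArg star h
  rwa [star_mul, star_one, hρ.star_eq, (isSelfAdjoint_of_mul_eq_one hρ h).star_eq] at this

lemma nonneg_of_mul_eq_one {ρ τ : H →L[ℂ] H} (hρ : 0 ≤ ρ) (h : ρ * τ = 1) : 0 ≤ τ := by
  have hτ := isSelfAdjoint_of_mul_eq_one (.of_nonneg hρ) h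
  have h1 := star_left_conjugate_nonneg hρ τ
  rwa [mul_assoc, h, mul_one, hτ.star_eq] at h1

lemma comm_of_mul_eq_one {ρ τ a : H →L[ℂ] H} (hρ : IsSelfAdjoint ρ) (h : ρ * τ = 1)
    (ha : a * ρ = ρ * a) : a * τ = τ * a := by
  have h' := mul_eq_one_symm hρ h
  calc a * τ = τ * ρ * a * τ := by rw [h', one_mul]
    _ = τ * (a * ρ) * τ := by rw [ha]; simp only [mul_assoc]
    _ = τ * a := by rw [mul_assoc, mul_assoc, h, mul_one]

lemma mem_of_mul_eq_one [Nontrivial H] {A : StarSubalgebra ℂ (H →L[ℂ] H)} {ρ τ : H →L[ℂ] H}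
    (hρA : ρ ∈ A) (hρ : IsSelfAdjoint ρ) (h : ρ * τ = 1) : τ ∈ A := by
  rw [← commutant_commutant A]
  exact mem_commutant.2 fun a ha =>
    comm_of_mul_eq_one hρ h (mem_commutant.1 ha ρ hρA).symm

lemma exists_mul_eq_one {ρ : H →L[ℂ] H} (h : ∀ v, ρ v = 0 → v = 0) : ∃ τ, ρ * τ = 1 := by
  have hinj : Function.Injective ρ.toLinearMap :=
    LinearMap.ker_eq_bot.1 (LinearMap.ker_eq_bot'.2 h)
  refine ⟨LinearMap.toContinuousLinearMap (LinearEquiv.ofInjectiveEndo _ hinj).symm.toLinearMap, ?_⟩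
  ext v
  exact (LinearEquiv.ofInjectiveEndo _ hinj).apply_symm_apply v

variable [Nontrivial H] {M N : StarSubalgebra ℂ (H →L[ℂ] H)} {P Q : H →L[ℂ] H}
  {ε : M →ₗ[ℂ] N} {ρ τ : H →L[ℂ] H}

lemma IsDensityOf.isSelfAdjoint (hρ : IsDensityOf ε ρ) : IsSelfAdjoint ρ := .of_nonneg hρ.nonneg

lemma proj_comm (hNM : N ≤ M) (hP : P ∈ minCentralProj N) (hQ : Q ∈ minCentralProj M) :
    P * Q = Q * P := minCentralProj_comm hQ (hNM hP.1.1)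

lemma isStarProjection_mul (hNM : N ≤ M) (hP : P ∈ minCentralProj N) (hQ : Q ∈ minCentralProj M) :
    IsStarProjection (P * Q) := hP.2.1.mul hQ.2.1 (proj_comm hNM hP hQ)

lemma mul_mem_relCommutant (hNM : N ≤ M) (hP : P ∈ minCentralProj N) (hQ : Q ∈ minCentralProj M) :
    P * Q ∈ relCommutant M N :=
  mul_mem (mem_relCommutant_of_mem_centre hNM hP.1) (mem_relCommutant_of_mem_centre' hNM hQ.1)

lemma mul_comm_relCommutant (hP : P ∈ minCentralProj N)
    (hQ : Q ∈ minCentralProj M) {x : H →L[ℂ] H} (hx : x ∈ relCommutant M N) :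
    P * Q * x = x * (P * Q) := by
  rw [mul_assoc, ← minCentralProj_comm hQ hx.1, ← mul_assoc, mem_commutant.1 hx.2 _ hP.1.1,
    mul_assoc]

lemma IsDensityOf.blockWeight_eq (hNM : N ≤ M) (hρ : IsDensityOf ε ρ) (hP : P ∈ minCentralProj N)
    (hQ : Q ∈ minCentralProj M) :
    blockWeight ε P Q = (ctr (relCommutant M N) (P * Q * ρ)).re := by
  rw [blockWeight, canonicalTrace_eq_ctr, hρ.partialDensity_eq hNM hP, ← mul_assoc,
    proj_comm hNM hP hQ]

lemma IsDensityOf.blockDensity_eq (hNM : N ≤ M) (hρ : IsDensityOf ε ρ) (hP : P ∈ minCentralProj N)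
    (hQ : Q ∈ minCentralProj M) :
    blockDensity ε P Q = ((blockWeight ε P Q)⁻¹ : ℂ) • (P * Q * ρ) := by
  rw [blockDensity, hρ.partialDensity_eq hNM hP, ← mul_assoc, proj_comm hNM hP hQ]

lemma conj_nonneg {E x : H →L[ℂ] H} (hE : IsStarProjection E) (hx : 0 ≤ x) (hc : E * x = x * E) :
    0 ≤ E * x := by
  have h := star_left_conjugate_nonneg hx E
  rwa [hE.isSelfAdjoint.star_eq, mul_assoc, ← hc, ← mul_assoc, hE.isIdempotentElem.eq] at h

lemma ctr_pos {A : StarSubalgebra ℂ (H →L[ℂ] H)} {x : H →L[ℂ] H} (hx : 0 ≤ x) (hxA : x ∈ A)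
    (h0 : x ≠ 0) : 0 < (ctr A x).re := by
  have h1 := ctr_nonneg hx hxA
  refine lt_of_le_of_ne (Complex.nonneg_iff.1 h1).1 fun h => h0 ?_
  have h2 : ctr A x = 0 := Complex.ext h.symm (Complex.nonneg_iff.1 h1).2.symm
  have hsa : IsSelfAdjoint x := .of_nonneg hx
  set s := cfc Real.sqrt x with hs
  have hssa : IsSelfAdjoint s := cfc_predicate _ _
  have hss : s * s = x := by
    rw [hs, ← cfc_mul _ _ x (continuousOn_spectrum _ x) (continuousOn_spectrum _ x)]
    conv_rhs => rw [← cfc_id' ℝ x]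
    exact cfc_congr fun t ht => Real.mul_self_sqrt (spectrum_nonneg_of_nonneg hx ht)
  have h3 : s = 0 := by
    apply eq_zero_of_ctr_star_mul_self (A := A)
    rw [hssa.star_eq, hss, h2]
  rw [← hss, h3, zero_mul]

lemma IsDensityOf.mul_ne_zero (hτ : ρ * τ = 1) (hPQ : P * Q ≠ 0) : P * Q * ρ ≠ 0 := by
  intro h
  apply hPQ
  rw [← mul_one (P * Q), ← hτ, ← mul_assoc, h, zero_mul]

lemma IsDensityOf.blockWeight_pos (hNM : N ≤ M) (hρ : IsDensityOf ε ρ) (hτ : ρ * τ = 1)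
    (hP : P ∈ minCentralProj N) (hQ : Q ∈ minCentralProj M) (hPQ : P * Q ≠ 0) :
    0 < blockWeight ε P Q := by
  rw [hρ.blockWeight_eq hNM hP hQ]
  exact ctr_pos (conj_nonneg (isStarProjection_mul hNM hP hQ) hρ.nonneg
    (mul_comm_relCommutant hP hQ hρ.mem))
    (mul_mem (mul_mem_relCommutant hNM hP hQ) hρ.mem) (IsDensityOf.mul_ne_zero hτ hPQ)

/-- On the block, the normalized density p⁻¹ P Q ρ has inverse p P Q τ. The weight p in its trace is
cancelled by the division in `centralIndex`. -/
lemma IsDensityOf.partialIndex_div (hNM : N ≤ M) (hρ : IsDensityOf ε ρ) (hτ : ρ * τ = 1)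
    (hP : P ∈ minCentralProj N) (hQ : Q ∈ minCentralProj M) (hPQ : P * Q ≠ 0) :
    partialIndex ε P Q / ENNReal.ofReal (blockWeight ε P Q) =
      ENNReal.ofReal (ctr (relCommutant M N) (P * Q * τ)).re := by
  have hp := hρ.blockWeight_pos hNM hτ hP hQ hPQ
  have hE := isStarProjection_mul hNM hP hQ
  have hEE : P * Q * (P * Q) = P * Q := hE.isIdempotentElem.eq
  have hc := mul_comm_relCommutant hP hQ hρ.mem
  set p := blockWeight ε P Q with hpdef
  have hp0 : (p : ℂ) ≠ 0 := by exact_mod_cast hp.ne'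
  have hPQR := mul_mem_minCentralProj_relCommutant hNM hP hQ hPQ
  have hD0 : 0 ≤ ((p : ℂ)⁻¹) • (P * Q * ρ) :=
    smul_nonneg (by rw [← Complex.ofReal_inv]; exact_mod_cast (inv_pos.2 hp).le)
      (conj_nonneg hE hρ.nonneg hc)
  have hmain := tsum_eigenspaces (D := ((p : ℂ)⁻¹) • (P * Q * ρ)) (E := P * Q)
    (τ := (p : ℂ) • (P * Q * τ)) (μ := blockMult (relCommutant M N) (P * Q)) hD0 hE
    (((Commute.refl (P * Q)).mul_left (show Commute ρ (P * Q) from hc.symm)).smul_left _)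
    (by
      rw [smul_mul_smul_comm, inv_mul_cancel₀ hp0, one_smul, hc, mul_assoc, ← mul_assoc (P * Q), hEE,
        ← mul_assoc, ← hc, mul_assoc, hτ, mul_one])
    (by rw [mul_smul_comm, ← mul_assoc, hEE]) (blockMult_pos hPQR)
  rw [partialIndex, hρ.blockDensity_eq hNM hP hQ, ← hpdef, hmain, map_smul, smul_eq_mul,
    Complex.re_ofReal_mul, mul_div_assoc, ENNReal.ofReal_mul hp.le, mul_comm,
    ENNReal.mul_div_cancel_right (by simpa using hp) ENNReal.ofReal_ne_top]
  congr 1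
  rw [ctr_mul_minCentralProj hPQR, Complex.div_natCast_re]

lemma IsDensityOf.centralIndex_eq (hNM : N ≤ M) (hρ : IsDensityOf ε ρ) (hτ : ρ * τ = 1)
    (hQ : Q ∈ minCentralProj M) :
    centralIndex ε Q = ENNReal.ofReal (ctr (relCommutant M N) (Q * τ)).re := by
  have hτR : τ ∈ relCommutant M N := mem_of_mul_eq_one hρ.mem hρ.isSelfAdjoint hτ
  have hτ0 := nonneg_of_mul_eq_one hρ.nonneg hτ
  have h1 : ∀ P : {P : H →L[ℂ] H // P ∈ minCentralProj N ∧ P * Q ≠ 0},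
      partialIndex ε P Q / ENNReal.ofReal (blockWeight ε P Q) =
        (fun P : H →L[ℂ] H => ENNReal.ofReal (ctr (relCommutant M N) (P * Q * τ)).re) P := fun P =>
    hρ.partialIndex_div hNM hτ P.2.1 hQ P.2.2
  have hnn : ∀ P ∈ mcp N, 0 ≤ (ctr (relCommutant M N) (P * Q * τ)).re := fun P hP => by
    rw [mem_mcp] at hP
    exact (Complex.nonneg_iff.1 (ctr_nonneg (conj_nonneg (isStarProjection_mul hNM hP hQ) hτ0
      (mul_comm_relCommutant hP hQ hτR)) (mul_mem (mul_mem_relCommutant hNM hP hQ) hτR))).1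
  have h2 : ctr (relCommutant M N) (Q * τ) = ∑ P ∈ mcp N, ctr (relCommutant M N) (P * Q * τ) := by
    rw [← map_sum]
    simp only [mul_assoc]
    rw [← Finset.sum_mul, sum_mcp, one_mul]
  rw [centralIndex, tsum_congr h1, h2, Complex.re_sum, ENNReal.ofReal_sum_of_nonneg hnn]
  have h3 := tsum_subtype {P : H →L[ℂ] H | P ∈ minCentralProj N ∧ P * Q ≠ 0}
    (fun P : H →L[ℂ] H => ENNReal.ofReal (ctr (relCommutant M N) (P * Q * τ)).re)
  refine h3.trans ?_
  rw [tsum_eq_sum (s := mcp N)]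
  · refine Finset.sum_congr rfl fun P hP => ?_
    by_cases hPQ : P * Q = 0
    · rw [Set.indicator_of_notMem fun h => h.2 hPQ, hPQ]; simp
    · exact Set.indicator_of_mem (s := {P : H →L[ℂ] H | P ∈ minCentralProj N ∧ P * Q ≠ 0})
        ⟨mem_mcp.1 hP, hPQ⟩ _
  · intro P hP
    exact Set.indicator_of_notMem (fun h => hP (mem_mcp.2 h.1)) _

lemma centralIndex_le_index (ε : M →ₗ[ℂ] N) (hQ : Q ∈ minCentralProj M) :
    centralIndex ε Q ≤ index ε := le_iSup₂ (f := fun Q _ => centralIndex ε Q) Q hQ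

/-- If ρ v = 0, every component P Q v is killed by the block density, and a nonzero one would
contribute 1/0 = ∞. This also covers zero weights, where `blockDensity` is 0 because 0⁻¹ = 0. -/
lemma IsDensityOf.exists_inv_of_index_lt_top (hNM : N ≤ M) (hρ : IsDensityOf ε ρ)
    (hfin : index ε < ∞) : ∃ τ, ρ * τ = 1 := by
  refine exists_mul_eq_one fun v hv => ?_
  have hzero : ∀ P ∈ minCentralProj N, ∀ Q ∈ minCentralProj M, (P * Q) v = 0 := by
    intro P hP Q hQ
    by_contra hne
    have hPQ : P * Q ≠ 0 := fun h => hne (by rw [h]; rfl)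
    have hmem : (P * Q) v ∈ Module.End.eigenspace (blockDensity ε P Q).toLinearMap ((0 : ℝ) : ℂ) ⊓
        LinearMap.range (P * Q).toLinearMap := by
      refine ⟨Module.End.mem_eigenspace_iff.2 ?_, v, rfl⟩
      rw [hρ.blockDensity_eq hNM hP hQ]
      change ((blockWeight ε P Q : ℂ)⁻¹ • (P * Q * ρ)) ((P * Q) v) = _
      have h1 : P * Q * ρ * (P * Q) = P * Q * (P * Q) * ρ := by
        rw [mul_assoc, ← mul_comm_relCommutant hP hQ hρ.mem, ← mul_assoc]
      have h2 : (P * Q * ρ) ((P * Q) v) = (P * Q * (P * Q)) (ρ v) :=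
        congrArg (fun T : H →L[ℂ] H => T v) h1
      rw [_root_.smul_apply, h2, hv]
      simp
    have hfr : Module.finrank ℂ (Module.End.eigenspace (blockDensity ε P Q).toLinearMap
        ((0 : ℝ) : ℂ) ⊓ LinearMap.range (P * Q).toLinearMap : Submodule ℂ H) ≠ 0 := by
      have : Nontrivial (Module.End.eigenspace (blockDensity ε P Q).toLinearMap
        ((0 : ℝ) : ℂ) ⊓ LinearMap.range (P * Q).toLinearMap : Submodule ℂ H) :=
        ⟨⟨_, hmem⟩, 0, fun h => hne (congrArg Subtype.val h)⟩
      exact Module.finrank_pos.ne'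
    have htop : partialIndex ε P Q = ∞ := by
      rw [partialIndex, eq_top_iff]
      refine le_trans ?_ (ENNReal.le_tsum (0 : ℝ))
      rw [ENNReal.ofReal_zero, ENNReal.inv_zero, ENNReal.mul_top]
      exact (ENNReal.div_pos (by exact_mod_cast hfr) (ENNReal.natCast_ne_top _)).ne'
    have h1 : partialIndex ε P Q / ENNReal.ofReal (blockWeight ε P Q) ≤ centralIndex ε Q :=
      ENNReal.le_tsum (f := fun P : {P : H →L[ℂ] H // P ∈ minCentralProj N ∧ P * Q ≠ 0} =>
        partialIndex ε P Q / ENNReal.ofReal (blockWeight ε P Q)) ⟨P, hP, hPQ⟩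
    rw [htop, ENNReal.top_div_of_ne_top ENNReal.ofReal_ne_top] at h1
    exact absurd (h1.trans (centralIndex_le_index ε hQ)) (not_le.2 hfin)
  have hsum : v = ∑ P ∈ mcp N, ∑ Q ∈ mcp M, (P * Q) v := by
    have h1 : (∑ P ∈ mcp N, ∑ Q ∈ mcp M, P * Q) = 1 := by
      rw [← Finset.sum_mul_sum, sum_mcp, sum_mcp, one_mul]
    have h2 := congrArg (fun T : H →L[ℂ] H => T v) h1
    simpa only [_root_.sum_apply, one_apply_eq_self] using h2.symm
  rw [hsum]
  exact Finset.sum_eq_zero fun P hP => Finset.sum_eq_zero fun Q hQ =>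
    hzero P (mem_mcp.1 hP) Q (mem_mcp.1 hQ)

lemma exists_mem_minCentralProj (A : StarSubalgebra ℂ (H →L[ℂ] H)) : ∃ P, P ∈ minCentralProj A := by
  by_contra! h
  have h1 := sum_mcp A
  rw [Finset.sum_eq_zero fun P hP => (h P (mem_mcp.1 hP)).elim] at h1
  exact zero_ne_one h1

lemma index_eq_of_forall {c : ℝ≥0∞} (h : ∀ Q ∈ minCentralProj M, centralIndex ε Q = c) :
    index ε = c := by
  obtain ⟨Q, hQ⟩ := exists_mem_minCentralProj M
  refine le_antisymm (iSup₂_le fun Q hQ => (h Q hQ).le) ?_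
  rw [← h Q hQ]
  exact centralIndex_le_index ε hQ

end Index
end EntropicCertainty
end

open scoped ENNReal InnerProductSpace
set_option linter.unusedSectionVars false
open scoped ComplexOrder
noncomputable section
namespace EntropicCertainty
variable {H : Type*} [NormedAddCommGroup H] [InnerProductSpace ℂ H] [CompleteSpace H]
section Entropy
variable [FiniteDimensional ℂ H]

/-! ## Relative entropies of vector states -/

/-- The functional `a ↦ ⟨ψ, a ψ⟩`. -/
def vecState (ψ : H) : (H →L[ℂ] H) →ₗ[ℂ] ℂ where
  toFun a := ⟪ψ, a ψ⟫_ℂ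
  map_add' a b := by simp
  map_smul' c a := by simp

/-- The density of a vector state. -/
def vecDensity (A : StarSubalgebra ℂ (H →L[ℂ] H)) (ψ : H) : H →L[ℂ] H :=
  density A (restrict (vecState ψ) A)

variable [Nontrivial H] {A : StarSubalgebra ℂ (H →L[ℂ] H)} {P : H →L[ℂ] H} {ψ : H}

lemma vecDensity_mem (A : StarSubalgebra ℂ (H →L[ℂ] H)) (ψ : H) : vecDensity A ψ ∈ A :=
  (density_spec A _).1

lemma ctr_vecDensity_mul {a : H →L[ℂ] H} (ha : a ∈ A) :
    ctr A (vecDensity A ψ * a) = ⟪ψ, a ψ⟫_ℂ := (density_spec A _).2 ⟨a, ha⟩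

omit [Nontrivial H] in
lemma inner_star_mul_self (a : H →L[ℂ] H) (ψ : H) :
    ⟪ψ, (star a * a) ψ⟫_ℂ = ((‖a ψ‖ ^ 2 : ℝ) : ℂ) := by
  rw [clm_mul_apply, ContinuousLinearMap.star_eq_adjoint,
    ContinuousLinearMap.adjoint_inner_right, inner_self_eq_norm_sq_to_K]
  push_cast
  rfl

lemma vecDensity_nonneg (A : StarSubalgebra ℂ (H →L[ℂ] H)) (ψ : H) : 0 ≤ vecDensity A ψ :=
  nonneg_of_ctr_nonneg (vecDensity_mem A ψ) fun a ha => by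
    rw [ctr_vecDensity_mul (mul_mem (star_mem ha) ha), inner_star_mul_self]
    exact Complex.zero_le_real.2 (sq_nonneg _)

lemma isSelfAdjoint_vecDensity (A : StarSubalgebra ℂ (H →L[ℂ] H)) (ψ : H) :
    IsSelfAdjoint (vecDensity A ψ) := .of_nonneg (vecDensity_nonneg A ψ)

lemma vecDensity_mul_specProj_zero (A : StarSubalgebra ℂ (H →L[ℂ] H)) (ψ : H) :
    vecDensity A ψ * specProj (vecDensity A ψ) 0 = 0 := by
  rw [mul_specProj (isSelfAdjoint_vecDensity A ψ)]
  simp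

lemma specProj_vecDensity_apply (A : StarSubalgebra ℂ (H →L[ℂ] H)) (ψ : H) :
    specProj (vecDensity A ψ) 0 ψ = 0 := by
  have hsa := isSelfAdjoint_vecDensity A ψ
  have he := isStarProjection_specProj (vecDensity A ψ) 0
  have h1 := ctr_vecDensity_mul (ψ := ψ) (specProj_mem A (vecDensity_mem A ψ) hsa 0)
  rw [vecDensity_mul_specProj_zero, map_zero] at h1
  have h2 := inner_star_mul_self (specProj (vecDensity A ψ) 0) ψ
  rw [he.isSelfAdjoint.star_eq, he.isIdempotentElem.eq, ← h1] at h2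
  have h3 : ‖specProj (vecDensity A ψ) 0 ψ‖ ^ 2 = 0 := by exact_mod_cast h2.symm
  exact norm_eq_zero.1 (pow_eq_zero_iff two_ne_zero |>.1 h3)

/-- ψ is annihilated by the kernel projection of its density, so it lies in the range. This makes
`log_mul_mul` usable at ψ when the density is singular. -/
lemma exists_vecDensity_apply_eq (A : StarSubalgebra ℂ (H →L[ℂ] H)) (ψ : H) :
    ∃ w, vecDensity A ψ w = ψ := by
  set d := vecDensity A ψ with hd
  have hsa : IsSelfAdjoint d := isSelfAdjoint_vecDensity A ψ
  refine ⟨cfc (fun x : ℝ => x⁻¹) d ψ, ?_⟩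
  have h1 : d * cfc (fun x : ℝ => x⁻¹) d + specProj d 0 = 1 := by
    rw [specProj]
    nth_rw 1 [← cfc_id' ℝ d]
    rw [← cfc_mul _ _ d (continuousOn_spectrum _ d) (continuousOn_spectrum _ d),
      ← cfc_add _ _ _ (continuousOn_spectrum _ d) (continuousOn_spectrum _ d), ← cfc_one ℝ d]
    refine cfc_congr fun x _ => ?_
    by_cases hx : x = 0 <;> simp [hx]
  have h2 := congrArg (fun T : H →L[ℂ] H => T ψ) h1
  simpa [clm_mul_apply, hd, specProj_vecDensity_apply] using h2

lemma mul_eq_zero_of_ctr_mul_eq_zero {x e : H →L[ℂ] H} (hx : 0 ≤ x) (he : IsStarProjection e)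
    (heA : e ∈ A) (h : ctr A (x * e) = 0) : x * e = 0 := by
  obtain ⟨s, rfl⟩ := CStarAlgebra.nonneg_iff_eq_star_mul_self.1 hx
  have h1 : s * e = 0 := by
    apply eq_zero_of_ctr_star_mul_self (A := A)
    rw [← h, star_mul, he.isSelfAdjoint.star_eq, mul_assoc, ctr_mul_comm heA, mul_assoc, mul_assoc,
      he.isIdempotentElem.eq, mul_assoc]
  rw [mul_assoc, h1, mul_zero]

/-- The kernel projection of the density in N annihilates ψ, hence has expectation zero in M as
well. It rules out the value ⊤ of `relEntropy`. -/
lemma vecDensity_ker_le {M N : StarSubalgebra ℂ (H →L[ℂ] H)} (hNM : N ≤ M) {v : H}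
    (hv : vecDensity N ψ v = 0) : vecDensity M ψ v = 0 := by
  have hsa := isSelfAdjoint_vecDensity N ψ
  have heN := specProj_mem N (vecDensity_mem N ψ) hsa 0
  have h1 : vecDensity M ψ * specProj (vecDensity N ψ) 0 = 0 := by
    refine mul_eq_zero_of_ctr_mul_eq_zero (vecDensity_nonneg M ψ) (isStarProjection_specProj _ _)
      (hNM heN) ?_
    rw [ctr_vecDensity_mul (hNM heN), specProj_vecDensity_apply, inner_zero_right]
  have h2 : specProj (vecDensity N ψ) 0 v = v :=
    specProj_apply_eigenvector hsa (by rw [hv]; simp)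
  rw [← h2, ← clm_mul_apply, h1]
  rfl

/-- The coefficients ⟨ψ, f_i⋆ ψ⟩ are Hilbert–Schmidt coefficients of the density, up to the
multiplicity relating canonical and operator trace. -/
lemma sum_opTrace_rankOne_smul (hP : P ∈ minCentralProj A) {ι : Type*} [Fintype ι]
    {f : ι → H →L[ℂ] H} (hf : IsHSBasis (corner A P) f) :
    ∑ i, opTrace (star (f i) * InnerProductSpace.rankOne ℂ ψ ψ) • f i =
      (blockMult A P : ℂ)⁻¹ • (P * vecDensity A ψ) := by
  have hmem : P * vecDensity A ψ ∈ corner A P :=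
    (mem_corner' hP).2 ⟨mul_mem hP.1.1 (vecDensity_mem A ψ), by rw [← mul_assoc, minCentralProj_sq hP]⟩
  rw [hf.expand _ hmem, Finset.smul_sum]
  refine Finset.sum_congr rfl fun i _ => ?_
  have hfi := (mem_corner' hP).1 (corner_star hP (hf.mem i))
  rw [smul_smul, opTrace_mul_rankOne, ← ctr_vecDensity_mul hfi.1]
  congr 1
  rw [← hfi.2, ← mul_assoc, minCentralProj_comm hP (vecDensity_mem A ψ), mul_assoc,
    ctr_mul_minCentralProj hP, div_eq_inv_mul]
  congr 1
  rw [← mul_assoc, opTrace_mul_comm, hfi.2]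

lemma casimirConst_eq (hP : P ∈ minCentralProj A) :
    casimirConst A P = (blockSize A P : ℂ) / blockMult A P := by
  rw [casimirConst, ← blockSize_sq hP, rk_eq hP]
  have h1 := blockSize_ne_zero hP
  have h2 := blockMult_ne_zero hP
  push_cast
  field_simp

/-- The density of a vector state in `A` and in `A'` act in the same way on the vector. -/
lemma vecDensity_commutant_apply (A : StarSubalgebra ℂ (H →L[ℂ] H)) (ψ : H) :
    vecDensity A ψ ψ = vecDensity (commutant A) ψ ψ := by
  have hblock : ∀ P ∈ mcp A, (P * vecDensity A ψ) ψ = (P * vecDensity (commutant A) ψ) ψ := by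
    intro P hP
    rw [mem_mcp] at hP
    have hP' : P ∈ minCentralProj (commutant A) := by rwa [minCentralProj_commutant]
    obtain ⟨f, hf, -⟩ := exists_isHSBasis (corner A P)
    obtain ⟨h, hh, -⟩ := exists_isHSBasis (corner (commutant A) P)
    -- Evaluated on ψ, the operator h |ψ⟩⟨ψ| h⋆ gives ⟨ψ, h⋆ψ⟩ h ψ. So one side of the duality
    -- becomes the density in A' and the other the density in A, both applied to ψ.
    have h1 := casimir_dual hP hf hh (InnerProductSpace.rankOne ℂ ψ ψ)
    rw [sum_opTrace_rankOne_smul hP hf] at h1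
    have h2 := congrArg (fun T : H →L[ℂ] H => T ψ) h1
    have h3 : (∑ l, h l * InnerProductSpace.rankOne ℂ ψ ψ * star (h l)) ψ =
        (∑ l, opTrace (star (h l) * InnerProductSpace.rankOne ℂ ψ ψ) • h l) ψ := by
      simp only [_root_.sum_apply]
      refine Finset.sum_congr rfl fun l _ => ?_
      rw [opTrace_mul_rankOne, _root_.smul_apply, clm_mul_apply, clm_mul_apply,
        InnerProductSpace.rankOne_apply, map_smul]
    simp only [_root_.smul_apply] at h2
    rw [h3, sum_opTrace_rankOne_smul hP' hh, blockMult_commutant hP, casimirConst_eq hP,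
      _root_.smul_apply, smul_smul] at h2
    have h4 := blockSize_ne_zero hP
    have h5 := blockMult_ne_zero hP
    have h6 : (blockSize A P : ℂ) / blockMult A P * (blockSize A P : ℂ)⁻¹ = (blockMult A P : ℂ)⁻¹ := by
      field_simp
    rw [h6] at h2
    exact (smul_right_injective H (inv_ne_zero h5) h2).symm
  have hsum : ∀ x : H →L[ℂ] H, x ψ = ∑ P ∈ mcp A, (P * x) ψ := fun x => by
    rw [← _root_.sum_apply, ← Finset.sum_mul, sum_mcp, one_mul]
  rw [hsum, hsum (vecDensity (commutant A) ψ)]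
  exact Finset.sum_congr rfl hblock

lemma log_vecDensity_commutant_apply (A : StarSubalgebra ℂ (H →L[ℂ] H)) (ψ : H) :
    CFC.log (vecDensity A ψ) ψ = CFC.log (vecDensity (commutant A) ψ) ψ :=
  cfc_apply_eq_of_apply_eq Real.log (isSelfAdjoint_vecDensity _ _) (isSelfAdjoint_vecDensity _ _)
    (mem_commutant.1 (vecDensity_mem (commutant A) ψ) _ (vecDensity_mem A ψ))
    (vecDensity_commutant_apply A ψ)

variable {M N : StarSubalgebra ℂ (H →L[ℂ] H)} {ε : M →ₗ[ℂ] N} {ρ τ : H →L[ℂ] H}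

/-- The relative entropy of a vector state with respect to a conditional expectation. -/
lemma relEntropy_vecState (hNM : N ≤ M) (hρ : IsDensityOf ε ρ) (hτ : ρ * τ = 1) (ψ : H) :
    relEntropy M (restrict (vecState ψ) M) (restrict (vecState ψ) N ∘ₗ ε) =
      (((⟪ψ, CFC.log (vecDensity M ψ) ψ⟫_ℂ).re - (⟪ψ, CFC.log (vecDensity N ψ) ψ⟫_ℂ).re -
        (⟪ψ, CFC.log ρ ψ⟫_ℂ).re : ℝ) : EReal) := by
  have hinj : ∀ v, ρ v = 0 → v = 0 := fun v hv => by
    have h := congrArg (fun T : H →L[ℂ] H => T v) (mul_eq_one_symm hρ.isSelfAdjoint hτ)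
    rw [clm_mul_apply, hv, map_zero] at h
    exact h.symm
  have hsaN := isSelfAdjoint_vecDensity N ψ
  have hcomm : Commute (vecDensity N ψ) ρ := hρ.comm (vecDensity_mem N ψ)
  have hsa : IsSelfAdjoint (vecDensity N ψ * ρ) := (hsaN.commute_iff hρ.isSelfAdjoint).1 hcomm
  have hd : density M (restrict (vecState ψ) N ∘ₗ ε) = vecDensity N ψ * ρ := hρ.density_comp hNM _
  have hker : LinearMap.ker (vecDensity N ψ * ρ).toLinearMap ≤
      LinearMap.ker (vecDensity M ψ).toLinearMap := by
    intro v hv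
    have hv' : (vecDensity N ψ * ρ) v = 0 := hv
    rw [hcomm.eq, clm_mul_apply] at hv'
    exact vecDensity_ker_le hNM (hinj _ hv')
  have hM : vecDensity N ψ * ρ ∈ M := mul_mem (hNM (vecDensity_mem N ψ)) hρ.mem.1
  -- Additivity of the logarithm at ψ is `log_mul_mul` evaluated at a preimage w of ψ under its
  -- density in N.
  obtain ⟨w, hw⟩ := exists_vecDensity_apply_eq N ψ
  have hlog : CFC.log (vecDensity N ψ * ρ) ψ = CFC.log (vecDensity N ψ) ψ + CFC.log ρ ψ := by
    have h := congrArg (fun T : H →L[ℂ] H => T w)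
      (log_mul_mul hsaN hρ.isSelfAdjoint hcomm hinj)
    simpa only [clm_mul_apply, hw, _root_.add_apply] using h
  have hlm : CFC.log (vecDensity M ψ) - CFC.log (vecDensity N ψ * ρ) ∈ M :=
    sub_mem (cfc_mem M Real.log (vecDensity_mem M ψ) (isSelfAdjoint_vecDensity M ψ))
      (cfc_mem M Real.log hM hsa)
  rw [relEntropy, hd, show density M (restrict (vecState ψ) M) = vecDensity M ψ from rfl,
    if_pos hker, canonicalTrace_eq_ctr, ctr_vecDensity_mul hlm, _root_.sub_apply, hlog,
    inner_sub_right, inner_add_right]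
  congr 1
  simp only [Complex.sub_re, Complex.add_re]
  ring

/-! ### The certainty relation and the dual conditional expectation. -/

lemma log_add_log {σ : H →L[ℂ] H} {c : ℝ} (hρ : IsSelfAdjoint ρ) (hσ : IsSelfAdjoint σ)
    (hc : c ≠ 0) (h : ρ * σ = (c : ℂ) • 1) (v : H) :
    CFC.log ρ v + CFC.log σ v = ((Real.log c : ℝ) : ℂ) • v := by
  have hc' : (c : ℂ) ≠ 0 := by exact_mod_cast hc
  have h' : σ * ρ = (c : ℂ) • 1 := by
    have := congrArg star h
    rwa [star_mul, hρ.star_eq, hσ.star_eq, star_smul, star_one, RCLike.star_def,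
      Complex.conj_ofReal] at this
  have h1 : ρ * ((c : ℂ)⁻¹ • σ) = 1 := by rw [mul_smul_comm, h, smul_smul, inv_mul_cancel₀ hc', one_smul]
  have hinj : ∀ v, σ v = 0 → v = 0 := fun v hv => by
    have h2 := congrArg (fun T : H →L[ℂ] H => T v) h
    rw [clm_mul_apply, hv, map_zero] at h2
    exact (smul_eq_zero.1 h2.symm).resolve_left hc'
  have h2 := log_mul_mul hρ hσ (show ρ * σ = σ * ρ by rw [h, h']) hinj
  have h3 := congrArg (fun T => T * ((c : ℂ)⁻¹ • σ)) h2
  simp only [mul_assoc, h1, mul_one] at h3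
  have h4 := congrArg (fun T : H →L[ℂ] H => T v) h3
  simp only [_root_.add_apply] at h4
  rw [← h4, h]
  exact cfc_apply_eigenvector Real.log (by
    rw [IsSelfAdjoint, star_smul, star_one, RCLike.star_def, Complex.conj_ofReal]) rfl

lemma eq_of_inner_re_eq {S T : H →L[ℂ] H} (hS : IsSelfAdjoint S) (hT : IsSelfAdjoint T)
    (h : ∀ ψ : H, ‖ψ‖ = 1 → (⟪ψ, S ψ⟫_ℂ).re = (⟪ψ, T ψ⟫_ℂ).re) : S = T := by
  have himag : ∀ {S : H →L[ℂ] H}, IsSelfAdjoint S → ∀ ψ, (⟪ψ, S ψ⟫_ℂ).im = 0 := by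
    intro S hS ψ
    have h1 : (starRingEnd ℂ) ⟪ψ, S ψ⟫_ℂ = ⟪ψ, S ψ⟫_ℂ := by
      rw [inner_conj_symm, ← ContinuousLinearMap.adjoint_inner_right,
        ← ContinuousLinearMap.star_eq_adjoint, hS.star_eq]
    exact Complex.conj_eq_iff_im.1 h1
  apply ContinuousLinearMap.coe_injective
  rw [← ext_inner_map]
  intro ψ
  rw [← inner_conj_symm, ← inner_conj_symm (T.toLinearMap ψ)]
  congr 1
  change ⟪ψ, S ψ⟫_ℂ = ⟪ψ, T ψ⟫_ℂ
  by_cases hψ : ψ = 0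
  · rw [hψ, inner_zero_left, inner_zero_left]
  have hn : (‖ψ‖ : ℂ) ≠ 0 := by exact_mod_cast norm_ne_zero_iff.2 hψ
  have h1 : ⟪((‖ψ‖ : ℂ)⁻¹ • ψ), S ((‖ψ‖ : ℂ)⁻¹ • ψ)⟫_ℂ = ⟪((‖ψ‖ : ℂ)⁻¹ • ψ), T ((‖ψ‖ : ℂ)⁻¹ • ψ)⟫_ℂ := by
    apply Complex.ext
    · exact h _ (norm_smul_inv_norm hψ)
    · rw [himag hS, himag hT]
  simp only [map_smul, inner_smul_left, inner_smul_right] at h1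
  have hn' : (starRingEnd ℂ) (‖ψ‖ : ℂ)⁻¹ ≠ 0 := by simpa using hψ
  exact mul_left_cancel₀ hn' (mul_left_cancel₀ (inv_ne_zero hn) h1)

lemma eq_of_log_eq {σ σ' κ κ' : H →L[ℂ] H} (hσ : 0 ≤ σ) (hσ' : 0 ≤ σ') (h1 : σ * κ = 1)
    (h1' : σ' * κ' = 1) (h : CFC.log σ = CFC.log σ') : σ = σ' := by
  have hpos : ∀ {σ κ : H →L[ℂ] H}, 0 ≤ σ → σ * κ = 1 → IsStrictlyPositive σ := fun {σ κ} hσ h1 =>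
    IsUnit.isStrictlyPositive
      (show IsUnit σ from ⟨⟨σ, κ, h1, mul_eq_one_symm (.of_nonneg hσ) h1⟩, rfl⟩) hσ
  rw [← CFC.exp_log σ (hpos hσ h1), h, CFC.exp_log σ' (hpos hσ' h1')]

/-- The densities of ψ in M and M', and in N and N', enter the two entropies with opposite signs and
have logarithms that agree on ψ. They cancel, and only the densities of ε and ε' remain. -/
lemma certaintyRelation_iff {μ : ℝ} (hμ : 0 < μ)
    (hNM : N ≤ M) (hρ : IsDensityOf ε ρ) (hτ : ρ * τ = 1) (hidx : index ε = ENNReal.ofReal μ)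
    {ε' : commutant N →ₗ[ℂ] commutant M} {σ κ : H →L[ℂ] H} (hσ : IsDensityOf ε' σ)
    (hκ : σ * κ = 1) :
    CertaintyRelation ε ε' ↔ ∀ ψ : H, ‖ψ‖ = 1 →
      -(⟪ψ, CFC.log ρ ψ⟫_ℂ).re - (⟪ψ, CFC.log σ ψ⟫_ℂ).re = Real.log μ := by
  have hmain : ∀ ψ : H, relEntropy M (restrict (vecState ψ) M) (restrict (vecState ψ) N ∘ₗ ε) +
      relEntropy (commutant N) (restrict (vecState ψ) (commutant N))
        (restrict (vecState ψ) (commutant M) ∘ₗ ε') =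
      ((-(⟪ψ, CFC.log ρ ψ⟫_ℂ).re - (⟪ψ, CFC.log σ ψ⟫_ℂ).re : ℝ) : EReal) := by
    intro ψ
    rw [relEntropy_vecState hNM hρ hτ, relEntropy_vecState (commutant_anti hNM) hσ hκ,
      ← EReal.coe_add, ← log_vecDensity_commutant_apply, ← log_vecDensity_commutant_apply]
    congr 1
    ring
  have hpure : ∀ ω : (H →L[ℂ] H) →ₗ[ℂ] ℂ, IsPureState ω ↔ ∃ ψ : H, ‖ψ‖ = 1 ∧ ω = vecState ψ :=
    fun ω => ⟨fun ⟨ψ, h1, h2⟩ => ⟨ψ, h1, LinearMap.ext h2⟩, fun ⟨ψ, h1, h2⟩ => ⟨ψ, h1, fun a => by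
      rw [h2]; rfl⟩⟩
  rw [CertaintyRelation, hidx, ENNReal.log_ofReal_of_pos hμ]
  constructor
  · intro h ψ hψ
    have := h (vecState ψ) ((hpure _).2 ⟨ψ, hψ, rfl⟩)
    rw [hmain] at this
    exact_mod_cast this
  · intro h ω hω
    obtain ⟨ψ, hψ, rfl⟩ := (hpure ω).1 hω
    rw [hmain, h ψ hψ]

/-- The entropic certainty relation determines a unique dual conditional expectation. -/
theorem exists_dual_condExp (hNM : N ≤ M) (hε : ε ∈ scalarCondExps M N) :
    ∃ ε' ∈ scalarCondExps (commutant N) (commutant M),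
      CertaintyRelation ε ε' ∧ index ε' = index ε ∧
      ∀ ε'' ∈ scalarCondExps (commutant N) (commutant M), CertaintyRelation ε ε'' → ε'' = ε' := by
  obtain ⟨hεC, hfin, hconst⟩ := hε
  have hMN' := commutant_anti hNM
  obtain ⟨ρ, hρ⟩ := exists_isDensityOf hNM hεC
  obtain ⟨τ, hτ⟩ := hρ.exists_inv_of_index_lt_top hNM hfin
  set R := relCommutant M N with hR
  have hR' : relCommutant (commutant N) (commutant M) = R := relCommutant_dual M N
  have hτR : τ ∈ R := mem_of_mul_eq_one hρ.mem hρ.isSelfAdjoint hτ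
  have hτ0 := nonneg_of_mul_eq_one hρ.nonneg hτ
  have hQτ : ∀ Q ∈ minCentralProj M, 0 ≤ Q * τ ∧ Q * τ ∈ R := fun Q hQ =>
    ⟨conj_nonneg hQ.2.1 hτ0 (minCentralProj_comm hQ hτR.1).symm,
      mul_mem (mem_relCommutant_of_mem_centre' hNM hQ.1) hτR⟩
  obtain ⟨Q₀, hQ₀⟩ := exists_mem_minCentralProj M
  -- The common value of the λ_Q, read off at an arbitrary Q₀.
  set μ := (ctr R (Q₀ * τ)).re with hμdef
  have hμ : 0 < μ := by
    refine ctr_pos (hQτ Q₀ hQ₀).1 (hQτ Q₀ hQ₀).2 fun h => hQ₀.2.2.1 ?_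
    rw [← mul_one Q₀, ← mul_eq_one_symm hρ.isSelfAdjoint hτ, ← mul_assoc, h, zero_mul]
  have hμ' : (μ : ℂ) ≠ 0 := by exact_mod_cast hμ.ne'
  have hall : ∀ Q ∈ minCentralProj M, ctr R (Q * τ) = μ := by
    intro Q hQ
    have h1 := hconst Q hQ Q₀ hQ₀
    rw [hρ.centralIndex_eq hNM hτ hQ, hρ.centralIndex_eq hNM hτ hQ₀] at h1
    have hQ0 := Complex.nonneg_iff.1 (ctr_nonneg (hQτ Q hQ).1 (hQτ Q hQ).2)
    have h2 := (ENNReal.ofReal_eq_ofReal_iff hQ0.1 hμ.le).1 h1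
    exact Complex.ext (by rw [h2, Complex.ofReal_re]) (by rw [← hQ0.2, Complex.ofReal_im])
  have hidx : index ε = ENNReal.ofReal μ := index_eq_of_forall fun Q hQ => by
    rw [hρ.centralIndex_eq hNM hτ hQ, hall Q hQ, Complex.ofReal_re]
  -- Tr_R(Qσ) = λ_Q/μ = 1 for every Q is precisely the normalization for the inclusion of M' in N'.
  -- The inverse μρ of σ will give the dual index Tr_R(P μρ) = μ.
  set σ := ((μ : ℂ)⁻¹) • τ with hσdef
  have hσR : σ ∈ R := R.smul_mem hτR _
  have hσ0 : 0 ≤ σ :=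
    smul_nonneg (by rw [← Complex.ofReal_inv]; exact_mod_cast (inv_pos.2 hμ).le) hτ0
  have hκ : σ * ((μ : ℂ) • ρ) = 1 := by
    rw [hσdef, smul_mul_smul_comm, inv_mul_cancel₀ hμ', one_smul,
      mul_eq_one_symm hρ.isSelfAdjoint hτ]
  obtain ⟨ε', hε'C, hε'⟩ := exists_condExp_of_density (ρ := σ) hMN' (by rw [hR']; exact hσR) hσ0
    (fun Q hQ => by
      rw [minCentralProj_commutant] at hQ
      rw [hR', hσdef, mul_smul_comm, map_smul, hall Q hQ, smul_eq_mul, inv_mul_cancel₀ hμ'])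
  have hc' : ∀ P ∈ minCentralProj (commutant N), centralIndex ε' P = ENNReal.ofReal μ := by
    intro P hP
    rw [hε'.centralIndex_eq hMN' hκ hP, hR', mul_smul_comm, map_smul]
    rw [minCentralProj_commutant] at hP
    rw [hρ.ctr_eq_one hNM hεC hP, smul_eq_mul, mul_one, Complex.ofReal_re]
  have hidx' : index ε' = ENNReal.ofReal μ := index_eq_of_forall hc'
  have hcert : CertaintyRelation ε ε' := by
    rw [certaintyRelation_iff hμ hNM hρ hτ hidx hε' hκ]
    intro ψ hψ
    have h1 := log_add_log (c := μ⁻¹) hρ.isSelfAdjoint hε'.isSelfAdjoint (inv_ne_zero hμ.ne')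
      (by rw [hσdef, mul_smul_comm, hτ]; push_cast; rfl) ψ
    have h2 := congrArg (fun v => (⟪ψ, v⟫_ℂ).re) h1
    simp only [inner_add_right, inner_smul_right, Complex.add_re, inner_self_eq_norm_sq_to_K, hψ,
      Real.log_inv] at h2
    simp at h2
    linarith
  refine ⟨ε', ⟨hε'C, by rw [hidx']; exact ENNReal.ofReal_lt_top, fun P₁ h₁ P₂ h₂ => by
    rw [hc' P₁ h₁, hc' P₂ h₂]⟩, hcert, by rw [hidx', hidx], ?_⟩
  rintro ε'' ⟨hC'', hfin'', -⟩ hcert''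
  obtain ⟨σ'', hσ''⟩ := exists_isDensityOf hMN' hC''
  obtain ⟨κ'', hκ''⟩ := hσ''.exists_inv_of_index_lt_top hMN' hfin''
  rw [certaintyRelation_iff hμ hNM hρ hτ hidx hε' hκ] at hcert
  rw [certaintyRelation_iff hμ hNM hρ hτ hidx hσ'' hκ''] at hcert''
  -- Both relations have the same right-hand side and the same ρ, so the two logarithms have equal
  -- quadratic forms.
  have hlog : CFC.log σ'' = CFC.log σ :=
    eq_of_inner_re_eq (cfc_predicate _ _) (cfc_predicate _ _) fun ψ hψ => by
      linarith [hcert ψ hψ, hcert'' ψ hψ]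
  have hσσ : σ'' = σ := eq_of_log_eq hσ''.nonneg hσ0 hκ'' hκ hlog
  rw [hσσ] at hσ''
  exact hσ''.ext hε'

end Entropy
end EntropicCertainty
end

open scoped ENNReal InnerProductSpace
set_option linter.unusedSectionVars false
open scoped ComplexOrder
noncomputable section
namespace EntropicCertainty

/-! ## Nonnegative singular vectors -/

section SingularVectors

/-- A nonnegative matrix has a singular value with nonnegative singular vectors. -/
lemma exists_nonneg_singular_vectors {ι κ : Type*} [Fintype ι] [Fintype κ] (m : ι → κ → ℝ)
    (hm : ∀ i k, 0 ≤ m i k) (hpos : ∃ i k, 0 < m i k) :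
    ∃ (d : ℝ) (u : ι → ℝ) (v : κ → ℝ), 0 < d ∧ (∀ i, 0 ≤ u i) ∧ (∀ k, 0 ≤ v k) ∧
      (∀ i, ∑ k, m i k * v k = d * u i) ∧ (∀ k, ∑ i, m i k * u i = d * v k) ∧
      ∑ k, v k ^ 2 = 1 := by
  classical
  obtain ⟨i₀, k₀, h₀⟩ := hpos
  set L : ι → (κ → ℝ) → ℝ := fun i w => ∑ k, m i k * w k with hL
  set f : (κ → ℝ) → ℝ := fun w => ∑ i, L i w ^ 2 with hf
  have hLc : ∀ i, Continuous (L i) := fun i => by fun_prop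
  have hfc : Continuous f := continuous_finsetSum _ fun i _ => (hLc i).pow 2
  set S : Set (κ → ℝ) := {w | ∑ k, w k ^ 2 = 1} with hS
  have hScl : IsClosed S := isClosed_eq (by fun_prop) continuous_const
  have hSc : IsCompact S := by
    refine (isCompact_univ_pi fun _ : κ => isCompact_Icc (a := (-1 : ℝ)) (b := 1)).of_isClosed_subset
      hScl fun w hw k _ => ?_
    have h1 : w k ^ 2 ≤ ∑ k, w k ^ 2 :=
      Finset.single_le_sum (f := fun k => w k ^ 2) (fun k _ => sq_nonneg _) (Finset.mem_univ k)
    rw [show ∑ k, w k ^ 2 = 1 from hw] at h1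
    exact abs_le.1 ((sq_le_one_iff_abs_le_one _).1 h1)
  have hsingle : Pi.single k₀ 1 ∈ S := by
    rw [hS, Set.mem_ofPred_eq, Finset.sum_eq_single k₀]
    · simp
    · intro k _ hk; simp [hk]
    · simp
  obtain ⟨w, hwS, hwmax⟩ := hSc.exists_isMaxOn ⟨_, hsingle⟩ hfc.continuousOn
  -- Because m has nonnegative entries, absolute values do not decrease f, so v is again a
  -- maximizer.
  set v : κ → ℝ := fun k => |w k| with hv
  have hvS : ∑ k, v k ^ 2 = 1 := by
    simp only [hv, sq_abs]; exact hwS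
  have hfv : f w ≤ f v := by
    refine Finset.sum_le_sum fun i _ => sq_le_sq' ?_ ?_
    · rw [neg_le, hL]
      simp only [← Finset.sum_neg_distrib]
      exact Finset.sum_le_sum fun k _ => by
        have := mul_le_mul_of_nonneg_left (neg_abs_le (w k)) (hm i k)
        simp only [hv]; linarith
    · exact Finset.sum_le_sum fun k _ => mul_le_mul_of_nonneg_left (le_abs_self _) (hm i k)
  have hmax : ∀ x ∈ S, f x ≤ f v := fun x hx => (hwmax hx).trans hfv
  have hD : 0 < f v := by
    refine lt_of_lt_of_le ?_ (hmax _ hsingle)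
    refine Finset.sum_pos' (fun i _ => sq_nonneg _) ⟨i₀, Finset.mem_univ _, ?_⟩
    have : L i₀ (Pi.single k₀ 1) = m i₀ k₀ := by
      rw [hL]; simp [Pi.single_apply]
    rw [this]; positivity
  have hLs : ∀ i (c : ℝ) x, L i (fun k => c * x k) = c * L i x := fun i c x => by
    simp only [hL, Finset.mul_sum]
    exact Finset.sum_congr rfl fun k _ => by ring
  have hLa : ∀ i (c : ℝ) x, L i (fun k => v k + c * x k) = L i v + c * L i x := fun i c x => by
    simp only [hL, Finset.mul_sum, ← Finset.sum_add_distrib]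
    exact Finset.sum_congr rfl fun k _ => by ring
  have hbound : ∀ x : κ → ℝ, f x ≤ f v * ∑ k, x k ^ 2 := by
    intro x
    set r := ∑ k, x k ^ 2 with hr
    have hr0 : 0 ≤ r := Finset.sum_nonneg fun k _ => sq_nonneg _
    rcases hr0.eq_or_lt with h | h
    · have hx : ∀ k, x k = 0 := fun k => by
        have h1 := (Finset.sum_eq_zero_iff_of_nonneg fun k _ => sq_nonneg (x k)).1
          (hr.symm.trans h.symm) k (Finset.mem_univ k)
        exact pow_eq_zero_iff two_ne_zero |>.1 h1
      simp [hf, hL, hx, ← h]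
    · have hs : Real.sqrt r ≠ 0 := (Real.sqrt_pos.2 h).ne'
      have hmem : (fun k => (Real.sqrt r)⁻¹ * x k) ∈ S := by
        simp only [hS, Set.mem_ofPred_eq, mul_pow, ← Finset.mul_sum]
        rw [← hr, inv_pow, Real.sq_sqrt hr0, inv_mul_cancel₀ h.ne']
      have h2 := hmax _ hmem
      simp only [hf, hLs, mul_pow, ← Finset.mul_sum] at h2
      rw [inv_pow, Real.sq_sqrt hr0, inv_mul_le_iff₀ h, mul_comm] at h2
      exact h2
  have hcrit : ∀ k, ∑ i, m i k * L i v = f v * v k := by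
    intro k
    set e : κ → ℝ := Pi.single k 1 with he
    have hLe : ∀ i, L i e = m i k := fun i => by simp [hL, he, Pi.single_apply]
    have hve : ∑ j, v j * e j = v k := by simp [he, Pi.single_apply]
    -- First-order condition without derivatives: the bound along v + t e is a quadratic inequality
    -- in t with zero constant term, so its discriminant forces the linear coefficient to vanish.
    have h1 : ∀ t : ℝ, 0 ≤ (f v * ∑ j, e j ^ 2 - f e) * (t * t) +
        2 * (f v * v k - ∑ i, m i k * L i v) * t + 0 := by
      intro t
      have h2 := hbound fun j => v j + t * e j
      have h3 : f (fun j => v j + t * e j) = f v + 2 * t * ∑ i, m i k * L i v + t ^ 2 * f e := by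
        simp only [hf, hLa, Finset.mul_sum, ← Finset.sum_add_distrib]
        exact Finset.sum_congr rfl fun i _ => by rw [hLe]; ring
      have h4 : ∑ j, (v j + t * e j) ^ 2 = 1 + 2 * t * v k + t ^ 2 * ∑ j, e j ^ 2 := by
        rw [← hvS, ← hve]
        simp only [Finset.mul_sum, ← Finset.sum_add_distrib]
        exact Finset.sum_congr rfl fun i _ => by ring
      rw [h3, h4] at h2
      nlinarith
    have h5 := discrim_le_zero h1
    rw [discrim, mul_zero, sub_zero] at h5
    have h6 := pow_eq_zero_iff two_ne_zero |>.1 (le_antisymm h5 (sq_nonneg _))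
    linarith
  have hs := Real.sqrt_pos.2 hD
  have hss := Real.mul_self_sqrt hD.le
  refine ⟨Real.sqrt (f v), fun i => (Real.sqrt (f v))⁻¹ * L i v, v, hs, fun i => ?_,
    fun k => abs_nonneg _, fun i => ?_, fun k => ?_, hvS⟩
  · exact mul_nonneg (inv_nonneg.2 hs.le)
      (Finset.sum_nonneg fun k _ => mul_nonneg (hm i k) (abs_nonneg _))
  · rw [mul_inv_cancel_left₀ hs.ne']
  · have h1 : ∑ i, m i k * ((Real.sqrt (f v))⁻¹ * L i v) =
        (Real.sqrt (f v))⁻¹ * ∑ i, m i k * L i v := by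
      rw [Finset.mul_sum]
      exact Finset.sum_congr rfl fun i _ => by ring
    rw [h1, hcrit k]
    nth_rw 2 [← hss]
    rw [mul_assoc, inv_mul_cancel_left₀ hs.ne']

lemma exists_nonneg_singular_vectors_finset {ι κ : Type*} (s : Finset ι) (t : Finset κ)
    (m : ι → κ → ℝ) (hm : ∀ i k, 0 ≤ m i k) (hpos : ∃ i ∈ s, ∃ k ∈ t, 0 < m i k) :
    ∃ (d : ℝ) (u : ι → ℝ) (v : κ → ℝ), 0 < d ∧ (∀ i ∈ s, 0 ≤ u i) ∧ (∀ k ∈ t, 0 ≤ v k) ∧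
      (∀ i ∈ s, ∑ k ∈ t, m i k * v k = d * u i) ∧ (∀ k ∈ t, ∑ i ∈ s, m i k * u i = d * v k) ∧
      ∑ k ∈ t, v k ^ 2 = 1 := by
  obtain ⟨i, hi, k, hk, h⟩ := hpos
  obtain ⟨d, u, v, hd, hu, hv, hmv, hmu, hv1⟩ := exists_nonneg_singular_vectors
    (fun (i : s) (k : t) => m i k) (fun i k => hm i k) ⟨⟨i, hi⟩, ⟨k, hk⟩, h⟩
  have hue : ∀ i : s, Function.extend Subtype.val u 0 (i : ι) = u i :=
    Subtype.val_injective.extend_apply u 0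
  have hve : ∀ k : t, Function.extend Subtype.val v 0 (k : κ) = v k :=
    Subtype.val_injective.extend_apply v 0
  refine ⟨d, Function.extend Subtype.val u 0, Function.extend Subtype.val v 0, hd,
    fun i hi => ?_, fun k hk => ?_, fun i hi => ?_, fun k hk => ?_, ?_⟩
  · rw [hue ⟨i, hi⟩]; exact hu _
  · rw [hve ⟨k, hk⟩]; exact hv _
  · rw [← Finset.sum_coe_sort, hue ⟨i, hi⟩, ← hmv]
    exact Finset.sum_congr rfl fun k _ => by rw [hve]
  · rw [← Finset.sum_coe_sort, hve ⟨k, hk⟩, ← hmu]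
    exact Finset.sum_congr rfl fun k _ => by rw [hue]
  · rw [← Finset.sum_coe_sort, ← hv1]
    exact Finset.sum_congr rfl fun k _ => by rw [hve]

end SingularVectors

variable {H : Type*} [NormedAddCommGroup H] [InnerProductSpace ℂ H] [CompleteSpace H]

section MinimalIndex
variable [FiniteDimensional ℂ H] {M N : StarSubalgebra ℂ (H →L[ℂ] H)} {P Q : H →L[ℂ] H}
  {u v : (H →L[ℂ] H) → ℝ} {d : ℝ}

/-! ## The minimal index -/

/-- The entries of the inclusion matrix. -/
def inclusionMatrix (M N : StarSubalgebra ℂ (H →L[ℂ] H)) (P Q : H →L[ℂ] H) : ℝ :=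
  blockSize (relCommutant M N) (P * Q)

lemma inclusionMatrix_nonneg (P Q : H →L[ℂ] H) : 0 ≤ inclusionMatrix M N P Q := Nat.cast_nonneg _

/-- `u` and `v` are positive singular vectors of the inclusion matrix, for the singular value `d`. -/
structure IsPerronPair (M N : StarSubalgebra ℂ (H →L[ℂ] H)) (u v : (H →L[ℂ] H) → ℝ) (d : ℝ) :
    Prop where
  d_pos : 0 < d
  u_pos : ∀ P ∈ mcp N, 0 < u P
  v_pos : ∀ Q ∈ mcp M, 0 < v Q
  sum_mul_v : ∀ P ∈ mcp N, ∑ Q ∈ mcp M, inclusionMatrix M N P Q * v Q = d * u P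
  sum_mul_u : ∀ Q ∈ mcp M, ∑ P ∈ mcp N, inclusionMatrix M N P Q * u P = d * v Q
  sum_v_sq : ∑ Q ∈ mcp M, v Q ^ 2 = 1

variable [Nontrivial H]

lemma ctr_mul_eq_inclusionMatrix (hNM : N ≤ M) (hP : P ∈ minCentralProj N)
    (hQ : Q ∈ minCentralProj M) :
    ctr (relCommutant M N) (P * Q) = (inclusionMatrix M N P Q : ℂ) := by
  by_cases hPQ : P * Q = 0
  · have h : blockSize (relCommutant M N) 0 = 0 := by
      change Nat.sqrt (Module.finrank ℂ ((relCommutant M N).toSubalgebra.toSubmodule.map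
        (LinearMap.mulLeft ℂ (0 : H →L[ℂ] H)))) = 0
      rw [LinearMap.mulLeft_zero_eq_zero, Submodule.map_zero, finrank_bot, Nat.sqrt_zero]
    rw [inclusionMatrix, hPQ, map_zero, h]
    simp
  · rw [ctr_minCentralProj (mul_mem_minCentralProj_relCommutant hNM hP hQ hPQ), inclusionMatrix]
    simp

lemma inclusionMatrix_pos (hNM : N ≤ M) (hP : P ∈ minCentralProj N) (hQ : Q ∈ minCentralProj M)
    (hPQ : P * Q ≠ 0) : 0 < inclusionMatrix M N P Q := by
  rw [inclusionMatrix]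
  exact_mod_cast blockSize_pos (mul_mem_minCentralProj_relCommutant hNM hP hQ hPQ)

lemma sum_mul_mcp (M N : StarSubalgebra ℂ (H →L[ℂ] H)) :
    ∑ P ∈ mcp N, ∑ Q ∈ mcp M, P * Q = 1 := by
  rw [← Finset.sum_mul_sum, sum_mcp, sum_mcp, one_mul]

lemma exists_mul_ne_zero (M N : StarSubalgebra ℂ (H →L[ℂ] H)) :
    ∃ P ∈ mcp N, ∃ Q ∈ mcp M, P * Q ≠ 0 := by
  by_contra! h
  have h1 := sum_mul_mcp M N
  rw [Finset.sum_eq_zero fun P hP => Finset.sum_eq_zero fun Q hQ => h P hP Q hQ] at h1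
  exact zero_ne_one h1

lemma exists_isPerronPair (hNM : N ≤ M) (hconn : IsConnectedInclusion M N) :
    ∃ u v d, IsPerronPair M N u v d := by
  classical
  obtain ⟨d, u, v, hd, hu, hv, hmv, hmu, hv1⟩ := exists_nonneg_singular_vectors_finset (mcp N) (mcp M)
    (inclusionMatrix M N) inclusionMatrix_nonneg (by
      obtain ⟨P, hP, Q, hQ, hPQ⟩ := exists_mul_ne_zero M N
      exact ⟨P, hP, Q, hQ, inclusionMatrix_pos hNM (mem_mcp.1 hP) (mem_mcp.1 hQ) hPQ⟩)
  have hu0 : ∀ P ∈ mcp N, ∀ Q ∈ mcp M, P * Q ≠ 0 → u P = 0 → v Q = 0 := by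
    intro P hP Q hQ hPQ h
    have h1 := hmv P hP
    rw [h, mul_zero, Finset.sum_eq_zero_iff_of_nonneg fun Q hQ =>
      mul_nonneg (inclusionMatrix_nonneg _ _) (hv Q hQ)] at h1
    exact (mul_eq_zero.1 (h1 Q hQ)).resolve_left
      (inclusionMatrix_pos hNM (mem_mcp.1 hP) (mem_mcp.1 hQ) hPQ).ne'
  have hv0 : ∀ P ∈ mcp N, ∀ Q ∈ mcp M, P * Q ≠ 0 → v Q = 0 → u P = 0 := by
    intro P hP Q hQ hPQ h
    have h1 := hmu Q hQ
    rw [h, mul_zero, Finset.sum_eq_zero_iff_of_nonneg fun P hP =>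
      mul_nonneg (inclusionMatrix_nonneg _ _) (hu P hP)] at h1
    exact (mul_eq_zero.1 (h1 P hP)).resolve_left
      (inclusionMatrix_pos hNM (mem_mcp.1 hP) (mem_mcp.1 hQ) hPQ).ne'
  -- p and q are the central projections of the zero sets of v and u. The singular equations match
  -- these sets whenever P Q ≠ 0, so p = q lies in both centres; connectedness makes it a scalar,
  -- which is 0 because v ≠ 0.
  set p := wsum M fun Q => if v Q = 0 then 1 else 0 with hp
  set q := wsum N fun P => if u P = 0 then 1 else 0 with hq
  have hPp : ∀ P ∈ mcp N, ∀ Q ∈ mcp M, P * Q * p = P * Q * q := by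
    intro P hP Q hQ
    by_cases hPQ : P * Q = 0
    · rw [hPQ, zero_mul, zero_mul]
    · have h1 := minCentralProj_comm (mem_mcp.1 hQ) (hNM (mem_mcp.1 hP).1.1)
      rw [mul_assoc, hp, mul_wsum (mem_mcp.1 hQ), h1, mul_assoc, hq, mul_wsum (mem_mcp.1 hP),
        mul_smul_comm, mul_smul_comm, ← h1]
      simp only [show (v Q = 0 ↔ u P = 0) from ⟨hv0 P hP Q hQ hPQ, hu0 P hP Q hQ hPQ⟩]
  have hpq : p = q := by
    rw [← one_mul p, ← one_mul q, ← sum_mul_mcp M N]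
    simp only [Finset.sum_mul]
    exact Finset.sum_congr rfl fun P hP => Finset.sum_congr rfl fun Q hQ => hPp P hP Q hQ
  have hbot : p ∈ centre M ⊓ centre N := ⟨wsum_mem M _, hpq ▸ wsum_mem N _⟩
  rw [hconn] at hbot
  obtain ⟨c, hc⟩ := StarSubalgebra.mem_bot.1 hbot
  rw [Algebra.algebraMap_eq_smul_one] at hc
  have hp0 : p = 0 := by
    obtain ⟨Q, hQ, hvQ⟩ : ∃ Q ∈ mcp M, v Q ≠ 0 := by
      by_contra! h
      rw [Finset.sum_eq_zero fun Q hQ => by rw [h Q hQ]; norm_num] at hv1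
      exact zero_ne_one hv1
    have h1 := mul_wsum (mem_mcp.1 hQ) fun Q => if v Q = 0 then 1 else 0
    rw [← hp, ← hc, if_neg hvQ, mul_smul_comm, mul_one, Complex.ofReal_zero, zero_smul] at h1
    rw [← hc, (smul_eq_zero.1 h1).resolve_right (mem_mcp.1 hQ).2.2.1, zero_smul]
  refine ⟨u, v, d, hd, fun P hP => (hu P hP).lt_of_ne' fun h => ?_,
    fun Q hQ => (hv Q hQ).lt_of_ne' fun h => ?_, hmv, hmu, hv1⟩
  · have h1 := mul_wsum (mem_mcp.1 hP) fun P => if u P = 0 then 1 else 0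
    rw [← hq, ← hpq, hp0, mul_zero, if_pos h, Complex.ofReal_one, one_smul] at h1
    exact (mem_mcp.1 hP).2.2.1 h1.symm
  · have h1 := mul_wsum (mem_mcp.1 hQ) fun Q => if v Q = 0 then 1 else 0
    rw [← hp, hp0, mul_zero, if_pos h, Complex.ofReal_one, one_smul] at h1
    exact (mem_mcp.1 hQ).2.2.1 h1.symm

end MinimalIndex
end EntropicCertainty
end

/-! ### The unique expectation of minimal index. -/

open scoped ENNReal InnerProductSpace
set_option linter.unusedSectionVars false
open scoped ComplexOrder
noncomputable section
namespace EntropicCertainty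
variable {H : Type*} [NormedAddCommGroup H] [InnerProductSpace ℂ H] [CompleteSpace H]
section MinimalIndex
variable [FiniteDimensional ℂ H] {M N : StarSubalgebra ℂ (H →L[ℂ] H)} {P Q : H →L[ℂ] H}
  {u v : (H →L[ℂ] H) → ℝ} {d : ℝ} [Nontrivial H]

lemma wsum_nonneg {A : StarSubalgebra ℂ (H →L[ℂ] H)} {w : (H →L[ℂ] H) → ℝ}
    (hw : ∀ P ∈ mcp A, 0 ≤ w P) : 0 ≤ wsum A w :=
  Finset.sum_nonneg fun P hP =>
    smul_nonneg (by exact_mod_cast hw P hP) (mem_mcp.1 hP).2.1.nonneg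

lemma ctr_wsum_mul (B A : StarSubalgebra ℂ (H →L[ℂ] H)) (w : (H →L[ℂ] H) → ℝ) (x : H →L[ℂ] H) :
    ctr B (wsum A w * x) = ∑ P ∈ mcp A, (w P : ℂ) * ctr B (P * x) := by
  rw [wsum, Finset.sum_mul, map_sum]
  exact Finset.sum_congr rfl fun P _ => by rw [smul_mul_assoc, map_smul, smul_eq_mul]

lemma ctr_mul_wsum_right (hNM : N ≤ M) (hP : P ∈ mcp N) (w : (H →L[ℂ] H) → ℝ) :
    ctr (relCommutant M N) (P * wsum M w) = ((∑ Q ∈ mcp M, inclusionMatrix M N P Q * w Q : ℝ) : ℂ) := by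
  rw [wsum, Finset.mul_sum, map_sum, Complex.ofReal_sum]
  refine Finset.sum_congr rfl fun Q hQ => ?_
  rw [mul_smul_comm, map_smul, smul_eq_mul,
    ctr_mul_eq_inclusionMatrix hNM (mem_mcp.1 hP) (mem_mcp.1 hQ), Complex.ofReal_mul, mul_comm]

lemma ctr_mul_wsum_left (hNM : N ≤ M) (hQ : Q ∈ mcp M) (w : (H →L[ℂ] H) → ℝ) :
    ctr (relCommutant M N) (Q * wsum N w) = ((∑ P ∈ mcp N, inclusionMatrix M N P Q * w P : ℝ) : ℂ) := by
  rw [wsum, Finset.mul_sum, map_sum, Complex.ofReal_sum]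
  refine Finset.sum_congr rfl fun P hP => ?_
  rw [mul_smul_comm, map_smul, smul_eq_mul, ← proj_comm hNM (mem_mcp.1 hP) (mem_mcp.1 hQ),
    ctr_mul_eq_inclusionMatrix hNM (mem_mcp.1 hP) (mem_mcp.1 hQ), Complex.ofReal_mul, mul_comm]

namespace IsPerronPair

/-- d‖u‖² and d‖v‖² are both ∑ u_P m_PQ v_Q. -/
lemma sum_u_sq (h : IsPerronPair M N u v d) : ∑ P ∈ mcp N, u P ^ 2 = 1 := by
  have h1 : d * ∑ P ∈ mcp N, u P ^ 2 = d * ∑ Q ∈ mcp M, v Q ^ 2 := by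
    calc d * ∑ P ∈ mcp N, u P ^ 2 = ∑ P ∈ mcp N, u P * (d * u P) := by
          rw [Finset.mul_sum]; exact Finset.sum_congr rfl fun P _ => by ring
      _ = ∑ P ∈ mcp N, ∑ Q ∈ mcp M, v Q * (inclusionMatrix M N P Q * u P) := by
          refine Finset.sum_congr rfl fun P hP => ?_
          rw [← h.sum_mul_v P hP, Finset.mul_sum]
          exact Finset.sum_congr rfl fun Q _ => by ring
      _ = ∑ Q ∈ mcp M, v Q * (d * v Q) := by
          rw [Finset.sum_comm]
          refine Finset.sum_congr rfl fun Q hQ => ?_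
          rw [← h.sum_mul_u Q hQ, Finset.mul_sum]
      _ = d * ∑ Q ∈ mcp M, v Q ^ 2 := by
          rw [Finset.mul_sum]; exact Finset.sum_congr rfl fun P _ => by ring
  rw [mul_left_cancel₀ h.d_pos.ne' h1, h.sum_v_sq]

/-- The density of the minimal conditional expectation. -/
def minDensity (M N : StarSubalgebra ℂ (H →L[ℂ] H)) (u v : (H →L[ℂ] H) → ℝ) (d : ℝ) : H →L[ℂ] H :=
  wsum N (fun P => (d * u P)⁻¹) * wsum M v

lemma minDensity_mul (h : IsPerronPair M N u v d) :
    minDensity M N u v d * (wsum M (fun Q => (v Q)⁻¹) * wsum N fun P => d * u P) = 1 := by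
  have h1 : wsum M v * wsum M (fun Q => (v Q)⁻¹) = 1 := by
    rw [wsum_mul, ← wsum_one M]
    exact wsum_congr fun Q hQ => mul_inv_cancel₀ (h.v_pos Q (mem_mcp.2 hQ)).ne'
  have h2 : wsum N (fun P => (d * u P)⁻¹) * (wsum N fun P => d * u P) = 1 := by
    rw [wsum_mul, ← wsum_one N]
    exact wsum_congr fun P hP =>
      inv_mul_cancel₀ (mul_pos h.d_pos (h.u_pos P (mem_mcp.2 hP))).ne'
  rw [minDensity, mul_assoc, ← mul_assoc (wsum M v), h1, one_mul, h2]

lemma minDensity_mem (hNM : N ≤ M) : minDensity M N u v d ∈ relCommutant M N :=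
  mul_mem (mem_relCommutant_of_mem_centre hNM (wsum_mem N _))
    (mem_relCommutant_of_mem_centre' hNM (wsum_mem M _))

lemma minDensity_nonneg (hNM : N ≤ M) (h : IsPerronPair M N u v d) :
    0 ≤ minDensity M N u v d := by
  have h1 : ∀ P ∈ mcp N, 0 ≤ P * wsum M v := fun P hP =>
    conj_nonneg (mem_mcp.1 hP).2.1 (wsum_nonneg fun Q hQ => (h.v_pos Q hQ).le)
      (wsum_comm v (hNM (mem_mcp.1 hP).1.1))
  rw [minDensity, wsum, Finset.sum_mul]
  refine Finset.sum_nonneg fun P hP => ?_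
  rw [smul_mul_assoc]
  exact smul_nonneg (by exact_mod_cast (inv_pos.2 (mul_pos h.d_pos (h.u_pos P hP))).le) (h1 P hP)

lemma ctr_mul_minDensity (hNM : N ≤ M) (h : IsPerronPair M N u v d) (hP : P ∈ minCentralProj N) :
    ctr (relCommutant M N) (P * minDensity M N u v d) = 1 := by
  have hP' := mem_mcp.2 hP
  have h0 := mul_pos h.d_pos (h.u_pos P hP')
  rw [minDensity, ← mul_assoc, mul_wsum hP, smul_mul_assoc, map_smul, ctr_mul_wsum_right hNM hP',
    h.sum_mul_v P hP', smul_eq_mul, ← Complex.ofReal_mul, inv_mul_cancel₀ h0.ne', Complex.ofReal_one]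

/-- One singular equation, ∑_Q m_PQ v_Q = d u_P, normalizes the density; the other gives λ_Q = v_Q⁻¹
· d ∑_P m_PQ u_P = d² for every Q. -/
lemma exists_minimal (hNM : N ≤ M) (h : IsPerronPair M N u v d) :
    ∃ ε ∈ condExps M N, IsDensityOf ε (minDensity M N u v d) ∧
      ∀ Q ∈ minCentralProj M, centralIndex ε Q = ENNReal.ofReal (d ^ 2) := by
  obtain ⟨ε, hε, hρ⟩ := exists_condExp_of_density hNM (minDensity_mem hNM)
    (h.minDensity_nonneg hNM) fun P hP => h.ctr_mul_minDensity hNM hP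
  refine ⟨ε, hε, hρ, fun Q hQ => ?_⟩
  have hQ' := mem_mcp.2 hQ
  have h1 : ∑ P ∈ mcp N, inclusionMatrix M N P Q * (d * u P) = d * (d * v Q) := by
    rw [← h.sum_mul_u Q hQ', Finset.mul_sum]
    exact Finset.sum_congr rfl fun P _ => by ring
  rw [hρ.centralIndex_eq hNM (h.minDensity_mul) hQ, ← mul_assoc, mul_wsum hQ, smul_mul_assoc,
    map_smul, ctr_mul_wsum_left hNM hQ', h1, smul_eq_mul, ← Complex.ofReal_mul, Complex.ofReal_re]
  congr 1
  have := (h.v_pos Q hQ').ne'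
  field_simp

/-- The density of a conditional expectation of index at most `d ^ 2`. -/
lemma isDensityOf_of_index_le (hNM : N ≤ M) (h : IsPerronPair M N u v d) {ε : M →ₗ[ℂ] N}
    (hε : ε ∈ condExps M N) (hle : index ε ≤ ENNReal.ofReal (d ^ 2)) :
    IsDensityOf ε (minDensity M N u v d) := by
  obtain ⟨ρ, hρ⟩ := exists_isDensityOf hNM hε
  obtain ⟨τ, hτ⟩ := hρ.exists_inv_of_index_lt_top hNM (hle.trans_lt ENNReal.ofReal_lt_top)
  have hτ' := mul_eq_one_symm hρ.isSelfAdjoint hτ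
  have hτsa := isSelfAdjoint_of_mul_eq_one hρ.isSelfAdjoint hτ
  have hτR : τ ∈ relCommutant M N := mem_of_mul_eq_one hρ.mem hρ.isSelfAdjoint hτ
  set R := relCommutant M N with hR
  set U := wsum N fun P => d * u P with hU
  set V := wsum M v with hV
  have hUR : U ∈ R := mem_relCommutant_of_mem_centre hNM (wsum_mem N _)
  have hVR : V ∈ R := mem_relCommutant_of_mem_centre' hNM (wsum_mem M _)
  have hUc : ∀ {x}, x ∈ R → U * x = x * U := fun hx => mem_commutant.1 hx.2 _ (wsum_mem N _).1
  have hVc : ∀ {x}, x ∈ R → V * x = x * V := fun hx => (wsum_comm v hx.1).symm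
  -- X vanishes exactly when ρ = U⁻¹V. The traces `t1`, `t2`, `t3` of the terms of X τ X are d², d²
  -- and at most d², so this positive element has trace at most d² − 2d² + d² = 0.
  set X := U * ρ - V with hX
  have hXR : X ∈ R := sub_mem (mul_mem hUR hρ.mem) hVR
  have hXsa : star X = X := by
    rw [hX, star_sub, star_mul, hρ.isSelfAdjoint.star_eq, hU, hV, star_wsum, star_wsum, ← hU,
      ← hUc hρ.mem]
  have hXτ : X * τ = U - V * τ := by rw [hX, sub_mul, mul_assoc, hτ, mul_one]
  have hexp : X * τ * X = U * (U * ρ) - 2 • (U * V) + V * V * τ := by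
    have e1 : V * τ * (U * ρ) = U * V := by
      rw [hUc hρ.mem, mul_assoc, ← mul_assoc τ, hτ', one_mul, hUc hVR]
    have e2 : V * τ * V = V * V * τ := by rw [mul_assoc, ← hVc hτR, mul_assoc]
    rw [hXτ, hX, sub_mul, mul_sub, mul_sub, e1, e2, two_smul]
    abel
  have hXX : 0 ≤ X * τ * X := by
    have h1 := star_left_conjugate_nonneg (nonneg_of_mul_eq_one hρ.nonneg hτ) X
    rwa [hXsa] at h1
  have t1 : ctr R (U * (U * ρ)) = ((d ^ 2 : ℝ) : ℂ) := by
    have e : ∀ P ∈ mcp N, ((d * u P : ℝ) : ℂ) * ctr R (P * (U * ρ)) = ((d ^ 2 * u P ^ 2 : ℝ) : ℂ) := by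
      intro P hP
      rw [hU, ← mul_assoc P, mul_wsum (mem_mcp.1 hP), smul_mul_assoc, map_smul, smul_eq_mul,
        hρ.ctr_eq_one hNM hε (mem_mcp.1 hP)]
      push_cast; ring
    conv_lhs => rw [hU, ctr_wsum_mul, ← hU]
    rw [Finset.sum_congr rfl e, ← Complex.ofReal_sum, ← Finset.mul_sum, h.sum_u_sq, mul_one]
  have t2 : ctr R (U * V) = ((d ^ 2 : ℝ) : ℂ) := by
    have e : ∀ P ∈ mcp N, ((d * u P : ℝ) : ℂ) * ctr R (P * V) = ((d ^ 2 * u P ^ 2 : ℝ) : ℂ) := by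
      intro P hP
      rw [hV, ctr_mul_wsum_right hNM hP, h.sum_mul_v P hP]
      push_cast; ring
    rw [hU, ctr_wsum_mul, Finset.sum_congr rfl e, ← Complex.ofReal_sum, ← Finset.mul_sum, h.sum_u_sq,
      mul_one]
  have t3 : (ctr R (V * V * τ)).re ≤ d ^ 2 := by
    have e : ∀ Q ∈ mcp M, (((v Q * v Q : ℝ) : ℂ) * ctr R (Q * τ)).re ≤ v Q ^ 2 * d ^ 2 := by
      intro Q hQ
      have e1 := (centralIndex_le_index ε (mem_mcp.1 hQ)).trans hle
      rw [hρ.centralIndex_eq hNM hτ (mem_mcp.1 hQ),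
        ENNReal.ofReal_le_ofReal_iff (sq_nonneg d)] at e1
      rw [Complex.re_ofReal_mul, ← sq]
      exact mul_le_mul_of_nonneg_left e1 (sq_nonneg _)
    rw [hV, wsum_mul, ctr_wsum_mul, Complex.re_sum]
    refine (Finset.sum_le_sum e).trans ?_
    rw [← Finset.sum_mul, h.sum_v_sq, one_mul]
  have hX0 : X * τ * X = 0 := by
    by_contra hne
    have h1 := ctr_pos hXX (mul_mem (mul_mem hXR hτR) hXR) hne
    rw [hexp, map_add, map_sub, map_nsmul, t1, t2, Complex.add_re, Complex.sub_re,
      Complex.re_nsmul, Complex.ofReal_re, two_smul] at h1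
    linarith
  have hXzero : X = 0 := by
    have hXρ : X * ρ = ρ * X := by
      rw [hX, sub_mul, mul_sub, hVc hρ.mem, ← mul_assoc ρ, ← hUc hρ.mem]
    -- X commutes with ρ, so X² = ρ (X τ X).
    have h1 : star X * X = 0 := by
      calc star X * X = ρ * (τ * X) * X := by rw [hXsa, ← mul_assoc ρ, hτ, one_mul]
        _ = ρ * (X * τ * X) := by
          rw [← comm_of_mul_eq_one hρ.isSelfAdjoint hτ hXρ, mul_assoc]
        _ = 0 := by rw [hX0, mul_zero]
    exact eq_zero_of_ctr_star_mul_self (A := R) (by rw [h1, map_zero])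
  have hfin : minDensity M N u v d = ρ := by
    have h2 : wsum N (fun P => (d * u P)⁻¹) * U = 1 := by
      rw [hU, wsum_mul, ← wsum_one N]
      exact wsum_congr fun P hP =>
        inv_mul_cancel₀ (mul_pos h.d_pos (h.u_pos P (mem_mcp.2 hP))).ne'
    rw [minDensity, ← hV, ← sub_eq_zero.1 (hX ▸ hXzero : U * ρ - V = 0), ← mul_assoc, h2, one_mul]
  rwa [hfin]

/-- An expectation of index below d² would have density `minDensity`, hence be the one of index
exactly d². -/
lemma le_index (hNM : N ≤ M) (h : IsPerronPair M N u v d) {ε : M →ₗ[ℂ] N}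
    (hε : ε ∈ condExps M N) : ENNReal.ofReal (d ^ 2) ≤ index ε := by
  by_contra! hlt
  obtain ⟨ε₀, -, hρ₀, hind⟩ := h.exists_minimal hNM
  rw [(h.isDensityOf_of_index_le hNM hε hlt.le).ext hρ₀, index_eq_of_forall hind] at hlt
  exact lt_irrefl _ hlt

lemma minimalIndex_eq (hNM : N ≤ M) (h : IsPerronPair M N u v d) :
    minimalIndex M N = ENNReal.ofReal (d ^ 2) := by
  obtain ⟨ε₀, hε₀, -, hind⟩ := h.exists_minimal hNM
  refine le_antisymm ?_ (le_iInf₂ fun ε hε => h.le_index hNM hε)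
  rw [← index_eq_of_forall hind]
  exact iInf₂_le (f := fun (ε : M →ₗ[ℂ] N) (_ : ε ∈ condExps M N) => index ε) ε₀ hε₀

end IsPerronPair

/-- There is a unique conditional expectation of minimal index. -/
theorem exists_unique_minimal_condExp (hNM : N ≤ M) (hconn : IsConnectedInclusion M N) :
    ∃ ε₀ ∈ scalarCondExps M N, index ε₀ = minimalIndex M N ∧
      (∀ ε ∈ condExps M N, index ε₀ ≤ index ε) ∧
      ∀ ε₁ ∈ condExps M N, (∀ ε ∈ condExps M N, index ε₁ ≤ index ε) → ε₁ = ε₀ := by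
  obtain ⟨u, v, d, h⟩ := exists_isPerronPair hNM hconn
  obtain ⟨ε₀, hε₀, hρ₀, hind⟩ := h.exists_minimal hNM
  have hi := index_eq_of_forall hind
  refine ⟨ε₀, ⟨hε₀, hi ▸ ENNReal.ofReal_lt_top, fun Q₁ h₁ Q₂ h₂ => (hind Q₁ h₁).trans (hind Q₂ h₂).symm⟩,
    hi.trans (h.minimalIndex_eq hNM).symm, fun ε hε => hi.trans_le (h.le_index hNM hε),
    fun ε₁ hε₁ hmin => ?_⟩
  exact (h.isDensityOf_of_index_le hNM hε₁ ((hmin ε₀ hε₀).trans hi.le)).ext hρ₀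

end MinimalIndex

/-! ### Invariance of the minimal index under isomorphisms of inclusions. -/

section Transport

variable [FiniteDimensional ℂ H] {M N : StarSubalgebra ℂ (H →L[ℂ] H)}
  {K : Type*} [NormedAddCommGroup K] [InnerProductSpace ℂ K] [CompleteSpace K]
  [FiniteDimensional ℂ K] {M₁ N₁ : StarSubalgebra ℂ (K →L[ℂ] K)}

open Classical in
/-- A `*`-isomorphism `M → M₁`, extended by zero. -/
def transport (Φ : M ≃⋆ₐ[ℂ] M₁) (x : H →L[ℂ] H) : K →L[ℂ] K :=
  if hx : x ∈ M then (Φ ⟨x, hx⟩ : K →L[ℂ] K) else 0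

variable {Φ : M ≃⋆ₐ[ℂ] M₁} {x y : H →L[ℂ] H}

lemma transport_of_mem (hx : x ∈ M) : transport Φ x = (Φ ⟨x, hx⟩ : K →L[ℂ] K) := dif_pos hx

lemma transport_mem (hx : x ∈ M) : transport Φ x ∈ M₁ := by
  rw [transport_of_mem hx]; exact (Φ _).2

lemma transport_zero : transport Φ 0 = 0 := by
  rw [transport_of_mem (zero_mem M), show (⟨0, zero_mem M⟩ : M) = 0 from
    Subtype.ext (ZeroMemClass.coe_zero M).symm, map_zero, ZeroMemClass.coe_zero]

lemma transport_mul (hx : x ∈ M) (hy : y ∈ M) :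
    transport Φ (x * y) = transport Φ x * transport Φ y := by
  rw [transport_of_mem hx, transport_of_mem hy, transport_of_mem (mul_mem hx hy)]
  exact congrArg Subtype.val (map_mul Φ ⟨x, hx⟩ ⟨y, hy⟩)

lemma transport_star (hx : x ∈ M) : transport Φ (star x) = star (transport Φ x) := by
  have h : Φ (star ⟨x, hx⟩) = star (Φ ⟨x, hx⟩) := map_star Φ _
  rw [transport_of_mem hx, transport_of_mem (star_mem hx), ← StarMemClass.coe_star, ← h]
  rfl

lemma transport_symm_transport (hx : x ∈ M) : transport Φ.symm (transport Φ x) = x := by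
  rw [transport_of_mem (transport_mem hx)]
  simp only [transport_of_mem hx, Subtype.coe_eta, StarAlgEquiv.symm_apply_apply]

lemma transport_transport_symm {y : K →L[ℂ] K} (hy : y ∈ M₁) :
    transport Φ (transport Φ.symm y) = y := by
  rw [transport_of_mem (transport_mem hy)]
  simp only [transport_of_mem hy, Subtype.coe_eta, StarAlgEquiv.apply_symm_apply]

/-- `Φ` restricts to an isomorphism of `A ≤ M` with `A₁ ≤ M₁`. -/
structure RestrictsTo (Φ : M ≃⋆ₐ[ℂ] M₁) (A : StarSubalgebra ℂ (H →L[ℂ] H))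
    (A₁ : StarSubalgebra ℂ (K →L[ℂ] K)) : Prop where
  le : A ≤ M
  le' : A₁ ≤ M₁
  iff : ∀ x : M, (x : H →L[ℂ] H) ∈ A ↔ (Φ x : K →L[ℂ] K) ∈ A₁

namespace RestrictsTo

variable {A : StarSubalgebra ℂ (H →L[ℂ] H)} {A₁ : StarSubalgebra ℂ (K →L[ℂ] K)}

lemma symm (h : RestrictsTo Φ A A₁) : RestrictsTo Φ.symm A₁ A :=
  ⟨h.le', h.le, fun x => by rw [h.iff, StarAlgEquiv.apply_symm_apply]⟩

lemma refl (Φ : M ≃⋆ₐ[ℂ] M₁) : RestrictsTo Φ M M₁ :=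
  ⟨le_rfl, le_rfl, fun x => ⟨fun _ => (Φ x).2, fun _ => x.2⟩⟩

lemma transport_mem_sub (h : RestrictsTo Φ A A₁) (hx : x ∈ A) : transport Φ x ∈ A₁ := by
  rw [transport_of_mem (h.le hx)]
  exact (h.iff ⟨x, h.le hx⟩).1 hx

lemma transport_mem_commutant (h : RestrictsTo Φ A A₁) (hx : x ∈ M) (hxA : x ∈ commutant A) :
    transport Φ x ∈ commutant A₁ :=
  mem_commutant.2 fun a ha => by
    have ha' := h.symm.transport_mem_sub ha
    have h1 := congrArg (transport Φ) (mem_commutant.1 hxA _ ha')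
    rwa [transport_mul (h.le ha') hx, transport_mul hx (h.le ha'),
      transport_transport_symm (h.le' ha)] at h1

lemma transport_mem_centre (h : RestrictsTo Φ A A₁) (hx : x ∈ centre A) :
    transport Φ x ∈ centre A₁ :=
  ⟨h.transport_mem_sub hx.1, h.transport_mem_commutant (h.le hx.1) hx.2⟩

/-- Φ does not act on the full commutant of A; only the part inside M can be transported. -/
lemma relCommutant (h : RestrictsTo Φ A A₁) :
    RestrictsTo Φ (relCommutant M A) (relCommutant M₁ A₁) := by
  refine ⟨fun x hx => hx.1, fun x hx => hx.1, fun x => ⟨fun hx => ⟨(Φ x).2, ?_⟩, fun hx => ⟨x.2, ?_⟩⟩⟩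
  · have h1 := h.transport_mem_commutant x.2 hx.2
    rwa [transport_of_mem x.2] at h1
  · have h1 := h.symm.transport_mem_commutant (Φ x).2 hx.2
    rw [transport_of_mem (Φ x).2] at h1
    simpa using h1

lemma transport_isStarProjection (hx : x ∈ M) (hp : IsStarProjection x) :
    IsStarProjection (transport Φ x) := by
  refine ⟨?_, ?_⟩
  · rw [IsIdempotentElem, ← transport_mul hx hx, hp.isIdempotentElem.eq]
  · rw [IsSelfAdjoint, ← transport_star hx, hp.isSelfAdjoint.star_eq]

lemma transport_mem_minCentralProj (h : RestrictsTo Φ A A₁) (hx : x ∈ minCentralProj A) :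
    transport Φ x ∈ minCentralProj A₁ := by
  have hxM := h.le hx.1.1
  refine ⟨h.transport_mem_centre hx.1, transport_isStarProjection hxM hx.2.1, fun h0 => hx.2.2.1 ?_,
    fun q hq hqp hqx => ?_⟩
  · rw [← transport_symm_transport (Φ := Φ) hxM, h0, transport_zero]
  · have hqM := h.le' hq.1
    have h1 := congrArg (transport Φ.symm) hqx
    rw [transport_mul hqM (transport_mem hxM), transport_symm_transport hxM] at h1
    rcases hx.2.2.2 _ (h.symm.transport_mem_centre hq) (transport_isStarProjection hqM hqp) h1 with
      h2 | h2
    · exact .inl (by rw [← transport_transport_symm (Φ := Φ) hqM, h2, transport_zero])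
    · exact .inr (by rw [← h2, transport_transport_symm hqM])

/-- Unlike the multiplicity, the size is a dimension inside M: both corners are injective images of
one subspace of M. -/
lemma blockSize_eq (h : RestrictsTo Φ A A₁) (hx : x ∈ A) :
    blockSize A₁ (transport Φ x) = blockSize A x := by
  let f : M →ₗ[ℂ] (H →L[ℂ] H) := M.subtype.toAlgHom.toLinearMap
  let g : M →ₗ[ℂ] (K →L[ℂ] K) := M₁.subtype.toAlgHom.toLinearMap ∘ₗ Φ.toAlgEquiv.toLinearMap
  have hf : Function.Injective f := Subtype.val_injective
  have hg : Function.Injective g := Subtype.val_injective.comp Φ.injective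
  set C : Submodule ℂ M := (corner A x).comap f with hC
  have h1 : corner A x = C.map f := by
    rw [hC, Submodule.map_comap_eq, eq_comm, inf_eq_right]
    rintro _ ⟨a, ha, rfl⟩
    exact ⟨⟨x * a, h.le (mul_mem hx ha)⟩, rfl⟩
  have h2 : corner A₁ (transport Φ x) = C.map g := by
    apply le_antisymm
    · rintro _ ⟨a, ha, rfl⟩
      have ha' := h.symm.transport_mem_sub ha
      refine ⟨⟨x * transport Φ.symm a, h.le (mul_mem hx ha')⟩, ⟨_, ha', rfl⟩, ?_⟩
      change (Φ ⟨x * transport Φ.symm a, _⟩ : K →L[ℂ] K) = transport Φ x * a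
      rw [← transport_of_mem, transport_mul (h.le hx) (h.le ha'), transport_transport_symm (h.le' ha)]
    · rintro _ ⟨m, ⟨a, ha, ham⟩, rfl⟩
      refine ⟨transport Φ a, h.transport_mem_sub ha, ?_⟩
      change transport Φ x * transport Φ a = (Φ m : K →L[ℂ] K)
      rw [← transport_mul (h.le hx) (h.le ha), ← transport_of_mem m.2]
      exact congrArg (transport Φ) ham
  change Nat.sqrt (Module.finrank ℂ (corner A₁ (transport Φ x))) =
    Nat.sqrt (Module.finrank ℂ (corner A x))
  rw [h1, h2, ← (Submodule.equivMapOfInjective f hf C).finrank_eq,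
    ← (Submodule.equivMapOfInjective g hg C).finrank_eq]

lemma sum_transport (h : RestrictsTo Φ A A₁) (w : (H →L[ℂ] H) → ℝ) :
    ∑ y ∈ mcp A₁, w (transport Φ.symm y) = ∑ x ∈ mcp A, w x := by
  refine Finset.sum_nbij' (transport Φ.symm) (transport Φ) ?_ ?_ ?_ ?_ ?_
  · exact fun y hy => mem_mcp.2 (h.symm.transport_mem_minCentralProj (mem_mcp.1 hy))
  · exact fun x hx => mem_mcp.2 (h.transport_mem_minCentralProj (mem_mcp.1 hx))
  · exact fun y hy => transport_transport_symm (h.le' (mem_mcp.1 hy).1.1)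
  · exact fun x hx => transport_symm_transport (h.le (mem_mcp.1 hx).1.1)
  · exact fun y _ => rfl

lemma inclusionMatrix_eq [Nontrivial K] (h : RestrictsTo Φ A A₁) {P Q : K →L[ℂ] K} (hP : P ∈ mcp A₁)
    (hQ : Q ∈ mcp M₁) : inclusionMatrix M A (transport Φ.symm P) (transport Φ.symm Q) =
      inclusionMatrix M₁ A₁ P Q := by
  have hP' := h.le' (mem_mcp.1 hP).1.1
  have hQ' := (mem_mcp.1 hQ).1.1
  rw [inclusionMatrix, inclusionMatrix, ← transport_mul hP' hQ', h.relCommutant.symm.blockSize_eq]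
  exact mul_mem (mem_relCommutant_of_mem_centre h.le' (mem_mcp.1 hP).1)
    (mem_relCommutant_of_mem_centre' h.le' (mem_mcp.1 hQ).1)

/-- Transporting the Perron pair, with the same d, dispenses with proving that the second inclusion
is connected. -/
lemma isPerronPair [Nontrivial K] (h : RestrictsTo Φ N N₁) {u v : (H →L[ℂ] H) → ℝ} {d : ℝ}
    (huv : IsPerronPair M N u v d) :
    IsPerronPair M₁ N₁ (u ∘ transport Φ.symm) (v ∘ transport Φ.symm) d := by
  have hN : ∀ P ∈ mcp N₁, transport Φ.symm P ∈ mcp N := fun P hP =>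
    mem_mcp.2 (h.symm.transport_mem_minCentralProj (mem_mcp.1 hP))
  have hM : ∀ Q ∈ mcp M₁, transport Φ.symm Q ∈ mcp M := fun Q hQ =>
    mem_mcp.2 ((refl Φ).symm.transport_mem_minCentralProj (mem_mcp.1 hQ))
  refine ⟨huv.d_pos, fun P hP => huv.u_pos _ (hN P hP), fun Q hQ => huv.v_pos _ (hM Q hQ),
    fun P hP => ?_, fun Q hQ => ?_, ?_⟩
  · rw [Function.comp_apply, ← huv.sum_mul_v _ (hN P hP), ← (refl Φ).sum_transport]
    exact Finset.sum_congr rfl fun Q hQ => by rw [h.inclusionMatrix_eq hP hQ, Function.comp_apply]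
  · rw [Function.comp_apply, ← huv.sum_mul_u _ (hM Q hQ), ← h.sum_transport]
    exact Finset.sum_congr rfl fun P hP => by rw [h.inclusionMatrix_eq hP hQ, Function.comp_apply]
  · rw [← huv.sum_v_sq, ← (refl Φ).sum_transport]
    rfl

end RestrictsTo

/-- The minimal index is an invariant of the inclusion. -/
theorem minimalIndex_eq_of_starAlgEquiv [Nontrivial H] (hNM : N ≤ M)
    (hconn : IsConnectedInclusion M N) (hNM₁ : N₁ ≤ M₁) (Φ : M ≃⋆ₐ[ℂ] M₁)
    (hΦ : ∀ x : M, (x : H →L[ℂ] H) ∈ N ↔ (Φ x : K →L[ℂ] K) ∈ N₁) :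
    minimalIndex M N = minimalIndex M₁ N₁ := by
  have : Nontrivial K := by
    by_contra hK
    rw [not_nontrivial_iff_subsingleton] at hK
    have h1 : (1 : M) = 0 := Φ.injective (Subtype.ext (ContinuousLinearMap.ext fun k =>
      Subsingleton.elim _ _))
    exact one_ne_zero (α := H →L[ℂ] H) (congrArg Subtype.val h1)
  obtain ⟨u, v, d, h⟩ := exists_isPerronPair hNM hconn
  have h₁ := (⟨hNM, hNM₁, hΦ⟩ : RestrictsTo Φ N N₁).isPerronPair h
  rw [h.minimalIndex_eq hNM, h₁.minimalIndex_eq hNM₁]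

end Transport
end EntropicCertainty
end

theorem mainTheorem1 {H : Type*} [NormedAddCommGroup H] [InnerProductSpace ℂ H]
    [CompleteSpace H] [FiniteDimensional ℂ H] [Nontrivial H]
    (M N : StarSubalgebra ℂ (H →L[ℂ] H)) (hNM : N ≤ M)
    (hconn : EntropicCertainty.IsConnectedInclusion M N) :
    -- the entropic certainty relation, with a unique dual conditional expectation
    (∀ ε ∈ EntropicCertainty.scalarCondExps M N,
      ∃ ε' ∈ EntropicCertainty.scalarCondExps (EntropicCertainty.commutant N)
          (EntropicCertainty.commutant M),
        EntropicCertainty.CertaintyRelation ε ε' ∧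
        EntropicCertainty.index ε' = EntropicCertainty.index ε ∧
        ∀ ε'' ∈ EntropicCertainty.scalarCondExps (EntropicCertainty.commutant N)
            (EntropicCertainty.commutant M),
          EntropicCertainty.CertaintyRelation ε ε'' → ε'' = ε') ∧
    -- the index has a unique minimizer among all conditional expectations
    (∃ ε₀ ∈ EntropicCertainty.scalarCondExps M N,
      EntropicCertainty.index ε₀ = EntropicCertainty.minimalIndex M N ∧
      (∀ ε ∈ EntropicCertainty.condExps M N,
        EntropicCertainty.index ε₀ ≤ EntropicCertainty.index ε) ∧
      ∀ ε₁ ∈ EntropicCertainty.condExps M N,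
        (∀ ε ∈ EntropicCertainty.condExps M N,
          EntropicCertainty.index ε₁ ≤ EntropicCertainty.index ε) → ε₁ = ε₀) ∧
    -- the minimal index depends only on the inclusion, not on the Hilbert space it acts on
    (∀ (K : Type*) [NormedAddCommGroup K] [InnerProductSpace ℂ K] [CompleteSpace K]
      [FiniteDimensional ℂ K] (M₁ N₁ : StarSubalgebra ℂ (K →L[ℂ] K)), N₁ ≤ M₁ →
      ∀ Φ : M ≃⋆ₐ[ℂ] M₁,
        (∀ x : M, (x : H →L[ℂ] H) ∈ N ↔ (Φ x : K →L[ℂ] K) ∈ N₁) →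
        EntropicCertainty.minimalIndex M N = EntropicCertainty.minimalIndex M₁ N₁) := by
  refine ⟨fun ε hε => EntropicCertainty.exists_dual_condExp hNM hε,
    EntropicCertainty.exists_unique_minimal_condExp hNM hconn, ?_⟩
  intro K _ _ _ _ M₁ N₁ hNM₁ Φ hΦ
  exact EntropicCertainty.minimalIndex_eq_of_starAlgEquiv hNM hconn hNM₁ Φ hΦ
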